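/- **Conventions.** Let $\mathbb{K}$ be a field. A *parameter $\mathbb{K}$-algebra* is a complete local noetherian commutative $\mathbb{K}$-algebra $R$ with maximal ideal $\mathfrak{m}$ and residue field $R/\mathfrak{m}=\mathbb{K}$; the resulting homomorphism $R\to\mathbb{K}$ is its augmentation. Put $R_i := R/\mathfrak{m}^{i+1}$. A Poisson $R$-algebra is a commutative $R$-algebra with an $R$-bilinear bracket that is antisymmetric ($\{a,b\}=-\{b,a\}$), satisfies the Jacobi identity, and is a derivation in each argument. Let $C$ be a commutative $\mathbb{K}$-algebra, regarded as a Poisson algebra with zero bracket. An *associative* (resp. *Poisson*) *$R$-deformation of $C$* is an associative unital (resp. Poisson) $R$-algebra $A$ that is flat and $\mathfrak{m}$-adically complete (i.e. $A\to\varprojlim_i R_i\otimes_R A$ is bijective) as an $R$-module, together with an isomorphism $\mathbb{K}\otimes_R A\to C$ of (Poisson) $\mathbb{K}$-algebras, called the augmentation. A *gauge transformation* $A\to A'$ is an isomorphism of unital (resp. Poisson) $R$-algebras commuting with the augmentations. These form categories $\mathsf{AssDef}(R,C)$ and $\mathsf{PoisDef}(R,C)$. Let $\mathcal{O}_X$ be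 a sheaf of commutative $\mathbb{K}$-algebras on a topological space $X$. An *associative* (resp. *Poisson*) *$R$-deformation of $\mathcal{O}_X$* is a sheaf $\mathcal{A}$ of associative unital (resp. Poisson) $R$-algebras on $X$ that is flat (all stalks are flat over $R$) and $\mathfrak{m}$-adically complete (the canonical map $\mathcal{A}\to\varprojlim_i (R_i\otimes_R\mathcal{A})$ is an isomorphism, where $R_i\otimes_R\mathcal{A}$ is the sheaf associated to $U\mapsto R_i\otimes_R\Gamma(U,\mathcal{A})$), together with an isomorphism $\mathbb{K}\otimes_R\mathcal{A}\to\mathcal{O}_X$ of sheaves of (Poisson) $\mathbb{K}$-algebras, called the augmentation, where $\mathcal{O}_X$ has the zero bracket. A *gauge transformation* is an isomorphism of sheaves of unital (resp. Poisson) $R$-algebras commuting with the augmentations. These form categories $\mathsf{AssDef}(R,\mathcal{O}_X)$ and $\mathsf{PoisDef}(R,\mathcal{O}_X)$. **Theorem.** Let $R$ be a parameter $\mathbb{K}$-algebra, let $X$ be an affine algebraic variety over $\mathbb{K}$ (an integral affine scheme of finite type over $\mathbb{K}$) with structure sheaf $\mathcal{O}_X$, and let $C:=\Gamma(X,\mathcal{O}_X)$.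 For every associative (resp. Poisson) $R$-deformation $\mathcal{A}$ of $\mathcal{O}_X$, the algebra $\Gamma(X,\mathcal{A})$, with the induced augmentation, is an associative (resp. Poisson) $R$-deformation of $C$, and the following hold. 1. For every associative (resp. Poisson) $R$-deformation $A$ of $C$ there exist an associative (resp. Poisson) $R$-deformation $\mathcal{A}$ of $\mathcal{O}_X$ and a gauge transformation $g: A\to\Gamma(X,\mathcal{A})$. 2. If $\mathcal{A},\mathcal{A}'$ are associative (resp. Poisson) $R$-deformations of $\mathcal{O}_X$ and $h:\Gamma(X,\mathcal{A})\to\Gamma(X,\mathcal{A}')$ is a gauge transformation, then there is a unique gauge transformation $\tilde h:\mathcal{A}\to\mathcal{A}'$ with $\Gamma(X,\tilde h)=h$. 3. Consequently the functors $$\Gamma(X,-):\mathsf{AssDef}(R,\mathcal{O}_X)\to\mathsf{AssDef}(R,C),\qquad \Gamma(X,-):\mathsf{PoisDef}(R,\mathcal{O}_X)\to\mathsf{PoisDef}(R,C)$$ are equivalences of categories. -/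

import Mathlib

open CategoryTheory Opposite TopologicalSpace AlgebraicGeometry

universe u

noncomputable section

namespace Deformation

/-! ### Parameter algebras -/

/-- A parameter `K`-algebra: a complete local noetherian commutative `K`-algebra `R`,
with maximal ideal `𝔪`, such that the structure map `K → R / 𝔪` is an isomorphism. -/
class IsParameterAlgebra (K R : Type u) [Field K] [CommRing R] [Algebra K R] : Prop where
  isLocalRing : IsLocalRing R
  isNoetherianRing : IsNoetherianRing R
  isAdicComplete : IsAdicComplete (IsLocalRing.maximalIdeal R) R
  residue_bijective : Function.Bijective (algebraMap K (IsLocalRing.ResidueField R))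

section Augmentation

variable (K R : Type u) [Field K] [CommRing R] [Algebra K R]

/-- The maximal ideal `𝔪` of a parameter algebra. -/
abbrev paramIdeal [IsParameterAlgebra K R] : Ideal R :=
  haveI : IsLocalRing R := IsParameterAlgebra.isLocalRing K
  IsLocalRing.maximalIdeal R

/-- The augmentation `R → R / 𝔪 = K` of a parameter algebra. -/
def augmentation [IsParameterAlgebra K R] : R →+* K :=
  haveI : IsLocalRing R := IsParameterAlgebra.isLocalRing K
  (RingEquiv.ofBijective (algebraMap K (IsLocalRing.ResidueField R))
    IsParameterAlgebra.residue_bijective).symm.toRingHom.comp (IsLocalRing.residue R)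

end Augmentation

/-! ### Algebras and modules -/

/-- Restriction of scalars for commutative algebras, along a homomorphism `f : R → S`. -/
def restrictAlg {R S : Type u} [CommRing R] [CommRing S] (f : R →+* S) :
    CommAlgCat.{u} S ⥤ CommAlgCat.{u} R where
  obj C :=
    letI : Algebra R C := Algebra.compHom C f
    CommAlgCat.of R C
  map {C D} g :=
    letI : Algebra R C := Algebra.compHom C f
    letI : Algebra R D := Algebra.compHom D f
    CommAlgCat.ofHom
      { g.hom.toRingHom with commutes' := fun r => g.hom.commutes (f r) }

/-- The underlying module of an associative algebra. -/
abbrev assToMod (R : Type u) [CommRing R] : AlgCat.{u} R ⥤ ModuleCat.{u} R :=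
  forget₂ (AlgCat.{u} R) (ModuleCat.{u} R)

/-- The underlying associative algebra of a commutative algebra. -/
abbrev commToAss (R : Type u) [CommRing R] : CommAlgCat.{u} R ⥤ AlgCat.{u} R :=
  forget₂ (CommAlgCat.{u} R) (AlgCat.{u} R)

/-- The underlying module of a commutative algebra. -/
abbrev commToMod (R : Type u) [CommRing R] : CommAlgCat.{u} R ⥤ ModuleCat.{u} R :=
  commToAss R ⋙ assToMod R

/-- An `R`-bilinear Poisson bracket on a commutative `R`-algebra. -/
@[ext]
structure PoissonBracket (R A : Type u) [CommRing R] [CommRing A] [Algebra R A] where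
  br : A →ₗ[R] A →ₗ[R] A
  antisymm : ∀ a b, br a b = -br b a
  jacobi : ∀ a b c, br a (br b c) + br b (br c a) + br c (br a b) = 0
  leibniz_right : ∀ a b c, br a (b * c) = br a b * c + b * br a c
  leibniz_left : ∀ a b c, br (a * b) c = a * br b c + br a c * b

/-! ### Deformations of algebras -/

section Algebras

variable {K : Type u} (R : Type u) [Field K] [CommRing R] [Algebra K R]
  [IsParameterAlgebra K R]

/-- The commutative `K`-algebra `C`, viewed as an `R`-algebra via the augmentation `R → K`. -/
abbrev viaAug (C : CommAlgCat.{u} K) : CommAlgCat.{u} R :=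
  (restrictAlg (augmentation K R)).obj C

/-- The `K`-linear homomorphism `K ⊗_R M → N` induced by an `R`-linear homomorphism `M → N`,
where `N` is a `K`-module. -/
def inducedHom {M : ModuleCat.{u} R} {N : ModuleCat.{u} K}
    (φ : M ⟶ (ModuleCat.restrictScalars (augmentation K R)).obj N) :
    (ModuleCat.extendScalars (augmentation K R)).obj M ⟶ N :=
  ((ModuleCat.extendRestrictScalarsAdj (augmentation K R)).homEquiv M N).symm φ

/-- The linear conditions on an `R`-deformation `M` of a `K`-module `N`: `M` is flat,
`𝔪`-adically complete, and the induced homomorphism `K ⊗_R M → N` is an isomorphism. -/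
structure IsDeformationModule {M : ModuleCat.{u} R} {N : ModuleCat.{u} K}
    (φ : M ⟶ (ModuleCat.restrictScalars (augmentation K R)).obj N) : Prop where
  flat : Module.Flat R M
  complete : IsAdicComplete (paramIdeal K R) M
  isIso : IsIso (inducedHom R φ)

variable (C : CommAlgCat.{u} K)

/-- An associative `R`-algebra with an `R`-algebra homomorphism to `C`; equivalently, with a
`K`-algebra homomorphism `K ⊗_R A → C`. -/
structure AugAss where
  alg : AlgCat.{u} R
  aug : alg ⟶ (commToAss R).obj (viaAug R C)

/-- A Poisson `R`-algebra with a homomorphism of Poisson `R`-algebras to `C`, where `C` has the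
zero bracket. -/
structure AugPois where
  alg : CommAlgCat.{u} R
  bracket : PoissonBracket R alg
  aug : alg ⟶ viaAug R C
  aug_bracket : ∀ a b : alg, aug.hom (bracket.br a b) = 0

variable {R C}

/-- An isomorphism of `R`-algebras that commutes with the augmentations to `C`. -/
@[ext]
structure AugAss.Hom (A A' : AugAss R C) where
  iso : A.alg ≅ A'.alg
  comm : iso.hom ≫ A'.aug = A.aug

/-- An isomorphism of Poisson `R`-algebras that commutes with the augmentations to `C`. -/
@[ext]
structure AugPois.Hom (A A' : AugPois R C) where
  iso : A.alg ≅ A'.alg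
  comm : iso.hom ≫ A'.aug = A.aug
  map_bracket : ∀ a b : A.alg,
    iso.hom.hom (A.bracket.br a b) = A'.bracket.br (iso.hom.hom a) (iso.hom.hom b)

instance : Category (AugAss R C) where
  Hom := AugAss.Hom
  id A := ⟨Iso.refl _, by simp⟩
  comp f g := ⟨f.iso ≪≫ g.iso, by simp [f.comm, g.comm]⟩
  id_comp f := AugAss.Hom.ext (by simp)
  comp_id f := AugAss.Hom.ext (by simp)
  assoc f g h := AugAss.Hom.ext (by simp)

instance : Category (AugPois R C) where
  Hom := AugPois.Hom
  id A := ⟨Iso.refl _, by simp, by simp⟩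
  comp f g := ⟨f.iso ≪≫ g.iso, by simp [f.comm, g.comm], by
    intro a b
    simp [f.map_bracket, g.map_bracket]⟩
  id_comp f := AugPois.Hom.ext (by simp)
  comp_id f := AugPois.Hom.ext (by simp)
  assoc f g h := AugPois.Hom.ext (by simp)

variable (R C)

/-- An augmented associative `R`-algebra is an associative `R`-deformation of `C` if it is flat,
`𝔪`-adically complete, and `K ⊗_R A → C` is an isomorphism. -/
def isAssDef : ObjectProperty (AugAss R C) := fun A =>
  IsDeformationModule (M := (assToMod R).obj A.alg) (N := (commToMod K).obj C) R
    ((assToMod R).map A.aug)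

/-- An augmented Poisson `R`-algebra is a Poisson `R`-deformation of `C` if it is flat,
`𝔪`-adically complete, and `K ⊗_R A → C` is an isomorphism. -/
def isPoisDef : ObjectProperty (AugPois R C) := fun A =>
  IsDeformationModule (M := (commToMod R).obj A.alg) (N := (commToMod K).obj C) R
    ((commToMod R).map A.aug)

/-- The category of associative `R`-deformations of `C` and gauge transformations. -/
abbrev AssDef := (isAssDef R C).FullSubcategory

/-- The category of Poisson `R`-deformations of `C` and gauge transformations. -/
abbrev PoisDef := (isPoisDef R C).FullSubcategory

end Algebras

/-! ### Sheaves of modules: flatness and completeness -/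

section Sheaves

variable {R : Type u} [CommRing R] {X : TopCat.{u}}

/-- A sheaf of `R`-modules is flat if all its stalks are flat. -/
def IsFlat (F : TopCat.Presheaf (ModuleCat.{u} R) X) : Prop :=
  ∀ x : X, Module.Flat R (F.stalk x)

variable (I : Ideal R) (F : TopCat.Presheaf (ModuleCat.{u} R) X)

/-- The presheaf `U ↦ R_i ⊗_R Γ(U, F)`, where `R_i = R / I ^ (i + 1)`. -/
def truncPre (i : ℕ) : TopCat.Presheaf (ModuleCat.{u} R) X :=
  F ⋙ MonoidalCategory.tensorLeft (ModuleCat.of R (R ⧸ I ^ (i + 1)))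

/-- The sheaf `R_i ⊗_R F`: the sheaf associated to `U ↦ R_i ⊗_R Γ(U, F)`. -/
def trunc (i : ℕ) : TopCat.Presheaf (ModuleCat.{u} R) X :=
  sheafify (Opens.grothendieckTopology X) (truncPre I F i)

/-- The homomorphism of presheaves induced by the projections `R_{i+1} → R_i`. -/
def truncPreMap (i : ℕ) : truncPre I F (i + 1) ⟶ truncPre I F i :=
  Functor.whiskerLeft F ((MonoidalCategory.tensoringLeft (ModuleCat.{u} R)).map
    (ModuleCat.ofHom (Submodule.factor (Ideal.pow_le_pow_right (Nat.le_succ (i + 1))))))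

/-- The canonical homomorphism of sheaves `R_{i+1} ⊗_R F → R_i ⊗_R F`. -/
def truncMap (i : ℕ) : trunc I F (i + 1) ⟶ trunc I F i :=
  sheafifyMap (Opens.grothendieckTopology X) (truncPreMap I F i)

/-- The homomorphism of presheaves `F → R_i ⊗_R F`, `s ↦ 1 ⊗ s`. -/
def toTruncPre (i : ℕ) : F ⟶ truncPre I F i where
  app U := ModuleCat.ofHom (TensorProduct.mk R (R ⧸ I ^ (i + 1)) (F.obj U) 1)
  naturality U V f := by
    ext s
    rfl

/-- The canonical homomorphism of sheaves `F → R_i ⊗_R F`. -/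
def toTrunc (i : ℕ) : F ⟶ trunc I F i :=
  toTruncPre I F i ≫ toSheafify (Opens.grothendieckTopology X) (truncPre I F i)

/-- A sheaf `F` of `R`-modules is `I`-adically complete if `F → lim_i (R_i ⊗_R F)` is an
isomorphism: for every open set `U`, each compatible family of sections of the sheaves
`R_i ⊗_R F` on `U` comes from a unique section of `F` on `U`. -/
def IsAdicallyComplete : Prop :=
  ∀ (U : (Opens X)ᵒᵖ) (s : ∀ i : ℕ, (trunc I F i).obj U),
    (∀ i, ((truncMap I F i).app U).hom (s (i + 1)) = s i) →
      ∃! t : F.obj U, ∀ i, ((toTrunc I F i).app U).hom t = s i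

end Sheaves

/-! ### Deformations of sheaves of algebras -/

/-- A sheaf of commutative `K`-algebras: a presheaf of commutative `K`-algebras whose underlying
presheaf of sets is a sheaf. -/
structure CommAlgSheaf (K : Type u) [CommRing K] (X : TopCat.{u}) where
  pre : TopCat.Presheaf (CommAlgCat.{u} K) X
  isSheaf : TopCat.Presheaf.IsSheaf (pre ⋙ forget (CommAlgCat.{u} K))

/-- The underlying presheaf of modules of a sheaf of commutative algebras is a sheaf. -/
theorem CommAlgSheaf.isSheaf_mod {K : Type u} [CommRing K] {X : TopCat.{u}}
    (O : CommAlgSheaf K X) :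
    Presheaf.IsSheaf (Opens.grothendieckTopology X) (O.pre ⋙ commToMod K) :=
  (Presheaf.isSheaf_iff_isSheaf_comp (Opens.grothendieckTopology X) (O.pre ⋙ commToMod K)
    (forget (ModuleCat.{u} K))).2 O.isSheaf

section SheafDef

variable {K : Type u} (R : Type u) [Field K] [CommRing R] [Algebra K R]
  [IsParameterAlgebra K R] {X : TopCat.{u}}

/-- Given a homomorphism `φ : F → N` of sheaves of `R`-modules, where `N` is a sheaf of
`K`-modules, this is the induced homomorphism `K ⊗_R F → N` of sheaves of `K`-modules. Here
`K ⊗_R F` is the sheaf associated to `U ↦ K ⊗_R Γ(U, F)`. -/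
def inducedSheafHom {F : TopCat.Presheaf (ModuleCat.{u} R) X}
    {N : TopCat.Presheaf (ModuleCat.{u} K) X}
    (hN : Presheaf.IsSheaf (Opens.grothendieckTopology X) N)
    (φ : F ⟶ N ⋙ ModuleCat.restrictScalars (augmentation K R)) :
    sheafify (Opens.grothendieckTopology X)
      (F ⋙ ModuleCat.extendScalars (augmentation K R)) ⟶ N :=
  sheafifyLift (Opens.grothendieckTopology X)
    ((((ModuleCat.extendRestrictScalarsAdj (augmentation K R)).whiskerRight
      (Opens X)ᵒᵖ).homEquiv F N).symm φ) hN

/-- The linear conditions on an `R`-deformation of a sheaf of `K`-modules. -/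
structure IsDeformationSheaf {F : TopCat.Presheaf (ModuleCat.{u} R) X}
    {N : TopCat.Presheaf (ModuleCat.{u} K) X}
    (hN : Presheaf.IsSheaf (Opens.grothendieckTopology X) N)
    (φ : F ⟶ N ⋙ ModuleCat.restrictScalars (augmentation K R)) : Prop where
  flat : IsFlat F
  complete : IsAdicallyComplete (paramIdeal K R) F
  isIso : IsIso (inducedSheafHom R hN φ)

variable (O : CommAlgSheaf K X)

/-- A sheaf of associative `R`-algebras on `X` with a homomorphism of sheaves of `R`-algebras to
`O`; equivalently, with a homomorphism of sheaves of `K`-algebras `K ⊗_R 𝒜 → O`. -/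
structure AugAssSheaf where
  pre : TopCat.Presheaf (AlgCat.{u} R) X
  isSheaf : TopCat.Presheaf.IsSheaf (pre ⋙ forget (AlgCat.{u} R))
  aug : pre ⟶ O.pre ⋙ restrictAlg (augmentation K R) ⋙ commToAss R

/-- A sheaf of Poisson `R`-algebras on `X` with a homomorphism of sheaves of Poisson `R`-algebras
to `O`, where `O` has the zero bracket. -/
structure AugPoisSheaf where
  pre : TopCat.Presheaf (CommAlgCat.{u} R) X
  isSheaf : TopCat.Presheaf.IsSheaf (pre ⋙ forget (CommAlgCat.{u} R))
  bracket : ∀ U : (Opens X)ᵒᵖ, PoissonBracket R (pre.obj U)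
  map_bracket : ∀ {U V : (Opens X)ᵒᵖ} (i : U ⟶ V) (a b : pre.obj U),
    (pre.map i).hom ((bracket U).br a b) =
      (bracket V).br ((pre.map i).hom a) ((pre.map i).hom b)
  aug : pre ⟶ O.pre ⋙ restrictAlg (augmentation K R)
  aug_bracket : ∀ (U : (Opens X)ᵒᵖ) (a b : pre.obj U),
    (aug.app U).hom ((bracket U).br a b) = 0

variable {R O}

/-- An isomorphism of sheaves of `R`-algebras that commutes with the augmentations to `O`. -/
@[ext]
structure AugAssSheaf.Hom (A A' : AugAssSheaf R O) where
  iso : A.pre ≅ A'.pre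
  comm : iso.hom ≫ A'.aug = A.aug

/-- An isomorphism of sheaves of Poisson `R`-algebras that commutes with the augmentations
to `O`. -/
@[ext]
structure AugPoisSheaf.Hom (A A' : AugPoisSheaf R O) where
  iso : A.pre ≅ A'.pre
  comm : iso.hom ≫ A'.aug = A.aug
  map_bracket : ∀ (U : (Opens X)ᵒᵖ) (a b : A.pre.obj U),
    (iso.hom.app U).hom ((A.bracket U).br a b) =
      (A'.bracket U).br ((iso.hom.app U).hom a) ((iso.hom.app U).hom b)

instance : Category (AugAssSheaf R O) where
  Hom := AugAssSheaf.Hom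
  id A := ⟨Iso.refl _, by simp⟩
  comp f g := ⟨f.iso ≪≫ g.iso, by simp [f.comm, g.comm]⟩
  id_comp f := AugAssSheaf.Hom.ext (by simp)
  comp_id f := AugAssSheaf.Hom.ext (by simp)
  assoc f g h := AugAssSheaf.Hom.ext (by simp)

instance : Category (AugPoisSheaf R O) where
  Hom := AugPoisSheaf.Hom
  id A := ⟨Iso.refl _, by simp, fun _ _ _ => rfl⟩
  comp f g := ⟨f.iso ≪≫ g.iso, by simp [f.comm, g.comm], by
    intro U a b
    simp [f.map_bracket, g.map_bracket]⟩
  id_comp f := AugPoisSheaf.Hom.ext (by simp)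
  comp_id f := AugPoisSheaf.Hom.ext (by simp)
  assoc f g h := AugPoisSheaf.Hom.ext (by simp)

variable (R O)

/-- An augmented sheaf of associative `R`-algebras is an associative `R`-deformation of `O` if it
is flat, `𝔪`-adically complete, and `K ⊗_R 𝒜 → O` is an isomorphism. -/
def isAssDefSheaf : ObjectProperty (AugAssSheaf R O) := fun A =>
  IsDeformationSheaf (F := A.pre ⋙ assToMod R) R O.isSheaf_mod
    (Functor.whiskerRight A.aug (assToMod R))

/-- An augmented sheaf of Poisson `R`-algebras is a Poisson `R`-deformation of `O` if it is flat,
`𝔪`-adically complete, and `K ⊗_R 𝒜 → O` is an isomorphism. -/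
def isPoisDefSheaf : ObjectProperty (AugPoisSheaf R O) := fun A =>
  IsDeformationSheaf (F := A.pre ⋙ commToMod R) R O.isSheaf_mod
    (Functor.whiskerRight A.aug (commToMod R))

/-- The category of associative `R`-deformations of `O` and gauge transformations. -/
abbrev AssDefSheaf := (isAssDefSheaf R O).FullSubcategory

/-- The category of Poisson `R`-deformations of `O` and gauge transformations. -/
abbrev PoisDefSheaf := (isPoisDefSheaf R O).FullSubcategory

/-! ### Global sections -/

/-- The commutative `K`-algebra `Γ(X, O)`. -/
abbrev globalSections : CommAlgCat.{u} K := O.pre.obj (op ⊤)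

/-- The functor `Γ(X, -)` on augmented sheaves of associative algebras. -/
def gammaAss : AugAssSheaf R O ⥤ AugAss R (globalSections O) where
  obj A := ⟨A.pre.obj (op ⊤), A.aug.app (op ⊤)⟩
  map f := ⟨f.iso.app (op ⊤), NatTrans.congr_app f.comm (op ⊤)⟩

/-- The functor `Γ(X, -)` on augmented sheaves of Poisson algebras. -/
def gammaPois : AugPoisSheaf R O ⥤ AugPois R (globalSections O) where
  obj A := ⟨A.pre.obj (op ⊤), A.bracket (op ⊤), A.aug.app (op ⊤), A.aug_bracket (op ⊤)⟩
  map f := ⟨f.iso.app (op ⊤), NatTrans.congr_app f.comm (op ⊤), f.map_bracket (op ⊤)⟩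

/-- The functor `Γ(X, -)` from associative deformations of `O` to associative deformations of
`Γ(X, O)`, as soon as `Γ(X, -)` takes deformations to deformations. -/
def gammaAssDef
    (h : ∀ A : AssDefSheaf R O, isAssDef R (globalSections O) ((gammaAss R O).obj A.obj)) :
    AssDefSheaf R O ⥤ AssDef R (globalSections O) :=
  (isAssDef R (globalSections O)).lift ((isAssDefSheaf R O).ι ⋙ gammaAss R O) h

/-- The functor `Γ(X, -)` from Poisson deformations of `O` to Poisson deformations of `Γ(X, O)`,
as soon as `Γ(X, -)` takes deformations to deformations. -/
def gammaPoisDef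
    (h : ∀ A : PoisDefSheaf R O, isPoisDef R (globalSections O) ((gammaPois R O).obj A.obj)) :
    PoisDefSheaf R O ⥤ PoisDef R (globalSections O) :=
  (isPoisDef R (globalSections O)).lift ((isPoisDefSheaf R O).ι ⋙ gammaPois R O) h

end SheafDef

/-! ### Algebraic varieties -/

/-- An algebraic variety over a field `K`: an integral separated `K`-scheme of finite type. -/
structure IsAlgebraicVariety {K : Type u} [Field K] {X : Scheme.{u}}
    (f : X ⟶ Spec (CommRingCat.of K)) : Prop where
  isIntegral : IsIntegral X
  isSeparated : IsSeparated f
  locallyOfFiniteType : LocallyOfFiniteType f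
  quasiCompact : QuasiCompact f

section StructureSheaf

variable {K : Type u} [Field K] {X : Scheme.{u}} (f : X ⟶ Spec (CommRingCat.of K))

/-- The homomorphism `K → Γ(U, O_X)` given by the structure morphism `f : X → Spec K`. -/
def scalarMap (U : (Opens X)ᵒᵖ) : K →+* X.presheaf.obj U :=
  ((Scheme.ΓSpecIso (CommRingCat.of K)).inv ≫ f.appTop ≫
    X.presheaf.map (homOfLE (le_top : U.unop ≤ ⊤)).op).hom

theorem map_scalarMap {U V : (Opens X)ᵒᵖ} (i : U ⟶ V) :
    (X.presheaf.map i).hom.comp (scalarMap f U) = scalarMap f V := by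
  rw [scalarMap, scalarMap, ← CommRingCat.hom_comp, Category.assoc, Category.assoc,
    ← Functor.map_comp]
  rfl

/-- The structure sheaf of a `K`-scheme, as a sheaf of commutative `K`-algebras. -/
def structureSheaf : CommAlgSheaf K X.toPresheafedSpace.carrier where
  pre :=
    { obj := fun U =>
        letI : Algebra K (X.presheaf.obj U) := (scalarMap f U).toAlgebra
        CommAlgCat.of K (X.presheaf.obj U)
      map := fun {U V} i =>
        letI : Algebra K (X.presheaf.obj U) := (scalarMap f U).toAlgebra
        letI : Algebra K (X.presheaf.obj V) := (scalarMap f V).toAlgebra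
        CommAlgCat.ofHom
          { (X.presheaf.map i).hom with
            commutes' := fun r => RingHom.congr_fun (map_scalarMap f i) r }
      map_id := fun U => 
        ConcreteCategory.hom_ext _ _ fun x => congrArg (fun g => g.hom x) (X.presheaf.map_id U)
      map_comp := fun i j => 
        ConcreteCategory.hom_ext _ _ fun x => congrArg (fun g => g.hom x) (X.presheaf.map_comp i j) }
  isSheaf := (Presheaf.isSheaf_iff_isSheaf_comp (Opens.grothendieckTopology X) X.presheaf
    (forget CommRingCat.{u})).1 X.sheaf.property

end StructureSheaf

end Deformation

end

open CategoryTheory AlgebraicGeometry Deformation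

/-! Write `I` for the maximal ideal of `R`. Everything is reduced to statements modulo `I` by
looking at leading coefficients. If `e` is a basis of `I ^ i / I ^ (i + 1)`, an element of `I ^ i M`
is `∑ e_k y_k` modulo `I ^ (i + 1) M`. When `M` is flat, the classes of the `y_k` in `M / I M` are
well defined (`IsGrBasis.coeff_mem`). Conversely, a complete module in which they are well defined
is flat (`flat_of_coeff_mem`). Completeness then turns statements about leading coefficients into
statements about elements, by successive approximation.

Global sections. The obstruction to lifting a section of `R_i ⊗ 𝒜` to `R_{i+1} ⊗ 𝒜` is a family of
Čech 1-cocycles of `O_X`, and these are coboundaries on basic open sets of an affine scheme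
(`exists_coboundary`). Hence the sections of `𝒜` on every `D(s)`, in particular on `X`, form a
deformation (`IsDefSheaf.isDefMod`).

Uniqueness and extension of gauge transformations. A deformation of a commutative algebra is
commutative modulo `I`. So the Ore condition holds modulo every `I ^ n`, and elements invertible
modulo `I` are invertible. Therefore the sections on `D(s)` are a completed Ore localization of the
global sections, with its universal property (`IsDefLoc.algHom_ext`, `IsDefLoc.exists_lift`). A
homomorphism of global sections extends uniquely to each `D(s)`, and the extensions glue
(`exists_natTrans`).

Existence. As `X` is integral, all localizations of a deformation `A` of `C` can be compared inside
one algebra `Q`, a deformation of the function field built as a limit of Ore localizations of `A / I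
^ n A` (`exists_generic_localization`). A section on `U` of the required sheaf is an element of `Q`
that, near each point of `U` and modulo each `I ^ n`, is a fraction with denominator not vanishing
at that point. On `D(s)` such elements are fractions with denominators nonvanishing on `D(s)`
(`mem_fracClosure_iff`), so they form a deformation (`isDefMod_of_range_eq_fracClosure`). A sheaf
that is good on a basis is a deformation (`isDefSheaf_of_basis`). Finally `A → Γ(X, 𝒜)` is
bijective, being a map between deformations of the same algebra.

Poisson case. Commutativity, and identities between brackets, spread from `A` to its localizations
one argument at a time. Derivations extend because they are homomorphisms to dual numbers, and this
extends brackets (`IsDefLoc.exists_poissonBracket`). -/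

noncomputable section

namespace Deformation

/-! ### Flat and complete modules -/

section Modules

variable {R : Type*} [CommRing R] (I : Ideal R)

/-- A surjective homomorphism `π : M → N` from a flat and `I`-adically complete module,
with kernel `I M`. -/
structure IsDefMod {M N : Type*} [AddCommGroup M] [Module R M] [AddCommGroup N] [Module R N]
    (π : M →ₗ[R] N) : Prop where
  flat : Module.Flat R M
  complete : IsAdicComplete I M
  surj : Function.Surjective π
  ker : ∀ x, π x = 0 ↔ x ∈ (I • ⊤ : Submodule R M)

/-- The elements `e` of `I ^ i` form a basis of `I ^ i / I ^ (i + 1)` over `R / I`. -/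
structure IsGrBasis (i : ℕ) {r : ℕ} (e : Fin r → R) : Prop where
  mem : ∀ k, e k ∈ I ^ i
  gen : ∀ x ∈ I ^ i, ∃ a : Fin r → R, x - ∑ k, a k * e k ∈ I ^ (i + 1)
  indep : ∀ a : Fin r → R, ∑ k, a k * e k ∈ I ^ (i + 1) → ∀ k, a k ∈ I

/-- As `R` is noetherian, `I ^ i / I ^ (i + 1)` is a finite-dimensional vector space over the field
`R ⧸ I`; the family `e` lifts a basis of it. -/
theorem exists_isGrBasis [IsNoetherianRing R] [I.IsMaximal] (i : ℕ) :
    ∃ (r : ℕ) (e : Fin r → R), IsGrBasis I i e := by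
  let _ : Field (R ⧸ I) := Ideal.Quotient.field I
  let G := (I ^ i : Ideal R) ⧸ (I • ⊤ : Submodule R (I ^ i : Ideal R))
  have : Module.Finite R G := inferInstance
  have : Module.Finite (R ⧸ I) G := Module.Finite.of_restrictScalars_finite R (R ⧸ I) G
  let b := Module.finBasis (R ⧸ I) G
  choose e he using fun k => Submodule.Quotient.mk_surjective _ (b k)
  have hmem : ∀ x : (I ^ i : Ideal R),
      x ∈ (I • ⊤ : Submodule R (I ^ i : Ideal R)) ↔ (x : R) ∈ I ^ (i + 1) := by
    intro x
    have h : (I • ⊤ : Submodule R (I ^ i : Ideal R)).map (I ^ i : Ideal R).subtype =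
        I ^ (i + 1) := by
      rw [Submodule.map_smul'', Submodule.map_top, Submodule.range_subtype, pow_succ', smul_eq_mul]
    rw [← h, Submodule.mem_map]
    exact ⟨fun hx => ⟨x, hx, rfl⟩, fun ⟨y, hy, hxy⟩ => by
      rwa [← Subtype.ext hxy]⟩
  have hsum : ∀ a : Fin _ → R, ((∑ k, a k • e k : (I ^ i : Ideal R)) : R) = ∑ k, a k * e k := by
    intro a; simp
  have hmk : ∀ a : Fin _ → R, (Submodule.Quotient.mk (∑ k, a k • e k) : G) =
      ∑ k, (Ideal.Quotient.mk I (a k)) • b k := by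
    intro a
    change (Submodule.mkQ _ : _ →ₗ[R] G) _ = _
    rw [map_sum]
    refine Finset.sum_congr rfl fun k _ => ?_
    rw [map_smul, ← he k]
    rfl
  refine ⟨_, fun k => e k, fun k => (e k).2, fun x hx => ?_, fun a ha => ?_⟩
  · choose a ha using fun k =>
      Ideal.Quotient.mk_surjective (b.repr (Submodule.Quotient.mk ⟨x, hx⟩) k)
    refine ⟨a, ?_⟩
    rw [← hsum, ← AddSubgroupClass.coe_sub (⟨x, hx⟩ : (I ^ i : Ideal R)), ← hmem,
      ← Submodule.Quotient.eq, hmk]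
    simp_rw [ha]
    exact (b.sum_repr _).symm
  · rw [← hsum, ← hmem, ← Submodule.Quotient.mk_eq_zero, hmk] at ha
    intro k
    exact Ideal.Quotient.eq_zero_iff_mem.1 (Fintype.linearIndependent_iff.1 b.linearIndependent _ ha k)

variable {I} {M : Type*} [AddCommGroup M] [Module R M]

theorem IsGrBasis.exists_sum {i r : ℕ} {e : Fin r → R} (he : IsGrBasis I i e) {x : M}
    (hx : x ∈ (I ^ i • ⊤ : Submodule R M)) :
    ∃ y : Fin r → M, x - ∑ k, e k • y k ∈ (I ^ (i + 1) • ⊤ : Submodule R M) := by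
  induction hx using Submodule.smul_induction_on' with
  | smul a ha m _ =>
    obtain ⟨c, hc⟩ := he.gen a ha
    refine ⟨fun k => c k • m, ?_⟩
    have : a • m - ∑ k, e k • c k • m = (a - ∑ k, c k * e k) • m := by
      rw [sub_smul, Finset.sum_smul]
      simp only [smul_smul, mul_comm]
    rw [this]
    exact Submodule.smul_mem_smul hc trivial
  | add x _ y _ hx hy =>
    obtain ⟨f, hf⟩ := hx
    obtain ⟨g, hg⟩ := hy
    refine ⟨f + g, ?_⟩
    convert add_mem hf hg using 1
    simp only [Pi.add_apply, smul_add, Finset.sum_add_distrib]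
    abel

theorem IsGrBasis.sum_mem {i r : ℕ} {e : Fin r → R} (he : IsGrBasis I i e) {y : Fin r → M}
    (j : ℕ) (hy : ∀ k, y k ∈ (I ^ j • ⊤ : Submodule R M)) :
    ∑ k, e k • y k ∈ (I ^ (i + j) • ⊤ : Submodule R M) := by
  refine _root_.sum_mem fun k _ => ?_
  rw [pow_add, Submodule.mul_smul]
  exact Submodule.smul_mem_smul (he.mem k) (hy k)

/-- This is where flatness is spent. By the equational criterion the relation `∑ e_k x_k - ∑ f_l y_l
= 0` with `f_l ∈ I ^ (i + 1)` is trivial: `x_k = ∑ a_kj z_j`, with `∑_k e_k a_kj ∈ I ^ (i + 1)`.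
Independence of `e` then puts every `a_kj` in `I`. -/
theorem IsGrBasis.coeff_mem {i r : ℕ} {e : Fin r → R} (he : IsGrBasis I i e) [Module.Flat R M]
    {x : Fin r → M} (hx : ∑ k, e k • x k ∈ (I ^ (i + 1) • ⊤ : Submodule R M)) (k : Fin r) :
    x k ∈ (I • ⊤ : Submodule R M) := by
  obtain ⟨n, f, y, hf, hxy⟩ : ∃ (n : ℕ) (f : Fin n → R) (y : Fin n → M),
      (∀ l, f l ∈ I ^ (i + 1)) ∧ ∑ k, e k • x k = ∑ l, f l • y l := by
    generalize ∑ k, e k • x k = z at hx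
    induction hx using Submodule.smul_induction_on' with
    | smul a ha m _ => exact ⟨1, fun _ => a, fun _ => m, fun _ => ha, by simp⟩
    | add x _ y _ hx hy =>
      obtain ⟨n, f, u, hf, rfl⟩ := hx
      obtain ⟨n', f', u', hf', rfl⟩ := hy
      refine ⟨n + n', Fin.append f f', Fin.append u u', fun l => ?_, ?_⟩
      · refine Fin.addCases (fun j => ?_) (fun j => ?_) l
        · simpa using hf j
        · simpa using hf' j
      · simp [Fin.sum_univ_add]
  have h0 : ∑ t : Fin r ⊕ Fin n, Sum.elim e (fun l => - f l) t • Sum.elim x y t = 0 := by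
    simp [hxy]
  obtain ⟨p, a, z, hz, ha⟩ := Module.Flat.isTrivialRelation_of_sum_smul_eq_zero h0
  have hk := hz (Sum.inl k)
  simp only [Sum.elim_inl] at hk
  rw [hk]
  refine _root_.sum_mem fun j _ => Submodule.smul_mem_smul ?_ Submodule.mem_top
  refine he.indep (fun k => a (Sum.inl k) j) ?_ k
  have := ha j
  simp only [Fintype.sum_sum_type, Sum.elim_inl, Sum.elim_inr, neg_mul, Finset.sum_neg_distrib,
    add_neg_eq_zero] at this
  simp_rw [mul_comm (a (Sum.inl _) j)]
  rw [this]
  exact _root_.sum_mem fun l _ => Ideal.mul_mem_right _ _ (hf l)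

theorem mem_smul_top_of_succ {i : ℕ} {x : M} (hx : x ∈ (I ^ (i + 1) • ⊤ : Submodule R M)) :
    x ∈ (I ^ i • ⊤ : Submodule R M) :=
  Submodule.smul_mono_left (Ideal.pow_le_pow_right (Nat.le_succ i)) hx

theorem smul_top_anti {i j : ℕ} (h : i ≤ j) :
    (I ^ j • ⊤ : Submodule R M) ≤ (I ^ i • ⊤ : Submodule R M) :=
  Submodule.smul_mono_left (Ideal.pow_le_pow_right h)

theorem eq_zero_of_forall_mem [IsHausdorff I M] {x : M}
    (hx : ∀ i : ℕ, x ∈ (I ^ i • ⊤ : Submodule R M)) : x = 0 :=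
  IsHausdorff.haus ‹_› x fun n => SModEq.zero.2 (hx n)

theorem exists_limit [IsPrecomplete I M] (f : ℕ → M)
    (hf : ∀ i, f (i + 1) - f i ∈ (I ^ i • ⊤ : Submodule R M)) :
    ∃ x, ∀ i, x - f i ∈ (I ^ i • ⊤ : Submodule R M) := by
  have h : ∀ m k, f (m + k) - f m ∈ (I ^ m • ⊤ : Submodule R M) := by
    intro m k
    induction k with
    | zero => simp
    | succ k ih =>
      have := add_mem (smul_top_anti (Nat.le_add_right m k) (hf (m + k))) ih
      rwa [sub_add_sub_cancel] at this
  obtain ⟨L, hL⟩ := IsPrecomplete.prec (I := I) ‹_› (f := f) (by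
    intro m n hmn
    obtain ⟨k, rfl⟩ := Nat.exists_eq_add_of_le hmn
    exact (SModEq.sub_mem.2 (h m k)).symm)
  exact ⟨L, fun i => SModEq.sub_mem.1 (hL i).symm⟩

/-- A decreasing filtration `W` of `M` such that `M` is complete with respect to `W`, and the
homomorphisms `I ^ i M → W i / W (i + 1)` are defined and surjective. -/
structure IsCompleteFiltration (I : Ideal R) (W : ℕ → Submodule R M) : Prop where
  sep : ∀ x, (∀ i, x ∈ W i) → x = 0
  complete : ∀ f : ℕ → M, (∀ i, f (i + 1) - f i ∈ W i) → ∃ x, ∀ i, x - f i ∈ W i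
  pow : ∀ i, I ^ i • ⊤ ≤ W i
  anti : ∀ i, W (i + 1) ≤ W i
  gen : ∀ i, W i ≤ I ^ i • ⊤ ⊔ W (i + 1)

theorem exists_sum_of_mem_span_smul {r : ℕ} {g : Fin r → R} {P : Submodule R M} {y : M}
    (hy : y ∈ Ideal.span (Set.range g) • P) :
    ∃ z : Fin r → M, (∀ k, z k ∈ P) ∧ y = ∑ k, g k • z k := by
  induction hy using Submodule.smul_induction_on' with
  | smul a ha m hm =>
    obtain ⟨c, rfl⟩ := Ideal.mem_span_range_iff_exists_fun.1 ha
    refine ⟨fun k => c k • m, fun k => P.smul_mem _ hm, ?_⟩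
    simp only [Finset.sum_smul, smul_smul, mul_comm]
  | add x _ y _ hx hy =>
    obtain ⟨f, hf, rfl⟩ := hx
    obtain ⟨f', hf', rfl⟩ := hy
    exact ⟨f + f', fun k => add_mem (hf k) (hf' k), by simp [smul_add, Finset.sum_add_distrib]⟩

namespace IsCompleteFiltration

variable {W : ℕ → Submodule R M}

theorem antitone (hW : IsCompleteFiltration I W) : Antitone W := antitone_nat_of_succ_le hW.anti

/-- With `I ^ i` generated by finitely many `g_k`, an element of `W (i + j)` is `∑ g_k z_k` modulo
`W (i + j + 1)` with `z_k ∈ I ^ j M`. The corrections to each of the finitely many coefficients form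
a convergent series, so an element of `W i` is exactly `∑ g_k Z_k`. -/
theorem eq_smul_top (hW : IsCompleteFiltration I W) [IsNoetherianRing R] (i : ℕ) :
    W i = I ^ i • ⊤ := by
  refine le_antisymm (fun x hx => ?_) (hW.pow i)
  obtain ⟨r, g, hg⟩ := Submodule.fg_iff_exists_fin_generating_family.1
    (IsNoetherian.noetherian (I ^ i : Ideal R))
  have hg' : Ideal.span (Set.range g) = I ^ i := hg
  have key : ∀ (j : ℕ) (y : W (i + j)), ∃ z : Fin r → M,
      (∀ k, z k ∈ (I ^ j • ⊤ : Submodule R M)) ∧ y - ∑ k, g k • z k ∈ W (i + (j + 1)) := by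
    rintro j ⟨y, hy⟩
    obtain ⟨y', hy', w, hw, rfl⟩ := Submodule.mem_sup.1 (hW.gen _ hy)
    rw [pow_add, Submodule.mul_smul, ← hg'] at hy'
    obtain ⟨z, hz, rfl⟩ := exists_sum_of_mem_span_smul hy'
    exact ⟨z, hz, by simpa [add_assoc] using hw⟩
  choose z hz hzW using key
  -- `y n` is what remains of `x` after `n` corrections.
  let y : ∀ n, W (i + n) := fun n => Nat.rec ⟨x, hx⟩ (fun j y => ⟨_, hzW j y⟩) n
  have hy : ∀ n, x - ∑ k, g k • ∑ j ∈ Finset.range n, z j (y j) k = (y n).1 := by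
    intro n
    induction n with
    | zero => simp [y]
    | succ n ih =>
      simp only [Finset.sum_range_succ, smul_add, Finset.sum_add_distrib, ← sub_sub, ih]
      rfl
  choose Z hZ using fun k => hW.complete (fun n => ∑ j ∈ Finset.range n, z j (y j) k) fun n => by
    rw [Finset.sum_range_succ_sub_sum]
    exact hW.pow n (hz n (y n) k)
  have hxZ : x - ∑ k, g k • Z k = 0 := by
    refine hW.sep _ fun n => ?_
    have h1 := hW.antitone (Nat.le_add_left n i) (y n).2
    have h2 : ∑ k, g k • (Z k - ∑ j ∈ Finset.range n, z j (y j) k) ∈ W n :=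
      sum_mem fun k _ => (W n).smul_mem _ (hZ k n)
    rw [← hy] at h1
    convert sub_mem h1 h2 using 1
    simp only [smul_sub, Finset.sum_sub_distrib]
    abel
  rw [sub_eq_zero.1 hxZ, ← hg']
  exact sum_mem fun k _ =>
    Submodule.smul_mem_smul (Ideal.subset_span (Set.mem_range_self k)) Submodule.mem_top

theorem isAdicComplete (hW : IsCompleteFiltration I W) [IsNoetherianRing R] :
    IsAdicComplete I M where
  haus' x hx := hW.sep x fun i => by
    rw [hW.eq_smul_top]
    exact SModEq.zero.1 (hx i)
  prec' f hf := by
    obtain ⟨x, hx⟩ := hW.complete f fun i => by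
      rw [hW.eq_smul_top]
      exact SModEq.sub_mem.1 (hf (Nat.le_succ i)).symm
    refine ⟨x, fun n => (SModEq.sub_mem.2 ?_).symm⟩
    rw [← hW.eq_smul_top]
    exact hx n

end IsCompleteFiltration

end Modules

/-! ### The flatness criterion -/

section Flat

variable {R : Type*} [CommRing R] {I : Ideal R} {M : Type*} [AddCommGroup M] [Module R M]

theorem mem_pow_smul_top_pi {n : ℕ} {v : Fin n → R} {i : ℕ} :
    v ∈ (I ^ i • ⊤ : Submodule R (Fin n → R)) ↔ ∀ k, v k ∈ I ^ i := by
  classical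
  refine ⟨fun hv k => ?_, fun hv => ?_⟩
  · induction hv using Submodule.smul_induction_on' with
    | smul a ha m _ => exact Ideal.mul_mem_right _ _ ha
    | add x _ y _ hx hy => exact add_mem hx hy
  · rw [pi_eq_sum_univ v]
    exact sum_mem fun k _ => Submodule.smul_mem_smul (hv k) Submodule.mem_top

/-- The syzygies of a vector over a noetherian ring are generated by finitely many vectors, and
coefficients can be chosen compatibly with the adic filtrations. -/
theorem exists_syzygies [IsNoetherianRing R] [IsHausdorff I R] {n : ℕ} (f : Fin n → R) :
    ∃ (p c : ℕ) (s : Fin p → Fin n → R), (∀ l, ∑ k, f k * s l k = 0) ∧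
      ∀ v : Fin n → R, ∑ k, f k * v k = 0 → ∃ z : Fin p → R, (∀ k, v k = ∑ l, s l k * z l) ∧
        ∀ i, (∀ k, v k ∈ I ^ (i + c)) → ∀ l, z l ∈ I ^ i := by
  let φ : (Fin n → R) →ₗ[R] R := Fintype.linearCombination R f
  have hφ : ∀ v, φ v = ∑ k, f k * v k := fun v => by
    simp [φ, Fintype.linearCombination_apply, mul_comm]
  obtain ⟨p, s, hs⟩ := Submodule.fg_iff_exists_fin_generating_family.1
    (IsNoetherian.noetherian (LinearMap.ker φ))
  -- Artin–Rees: `c` bounds the loss of `I`-adic order when a syzygy is written in terms of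
  -- generators.
  obtain ⟨c, hc⟩ := Ideal.exists_pow_inf_eq_pow_smul I (LinearMap.ker φ)
  have hmem : ∀ l, ∑ k, f k * s l k = 0 := fun l => by
    rw [← hφ, ← LinearMap.mem_ker, ← hs]
    exact Submodule.subset_span (Set.mem_range_self l)
  have key : ∀ (i : ℕ) (v : Fin n → R), φ v = 0 → (∀ k, v k ∈ I ^ (i + c)) →
      ∃ z : Fin p → R, v = ∑ l, z l • s l ∧ ∀ l, z l ∈ I ^ i := by
    intro i v hv hvi
    have h1 : v ∈ (I ^ i • LinearMap.ker φ : Submodule R (Fin n → R)) := by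
      have h2 : v ∈ (I ^ (i + c) • ⊤ ⊓ LinearMap.ker φ : Submodule R (Fin n → R)) :=
        ⟨mem_pow_smul_top_pi.2 hvi, hv⟩
      rw [hc _ (Nat.le_add_left c i), Nat.add_sub_cancel] at h2
      exact Submodule.smul_mono le_rfl inf_le_right h2
    rw [← hs, Submodule.mem_ideal_smul_span_iff_exists_sum] at h1
    obtain ⟨a, ha, rfl⟩ := h1
    exact ⟨a, by simp [Finsupp.sum_fintype], ha⟩
  refine ⟨p, c, s, hmem, fun v hv => ?_⟩
  suffices h : ∃ z : Fin p → R, v = ∑ l, z l • s l ∧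
      ∀ i, (∀ k, v k ∈ I ^ (i + c)) → ∀ l, z l ∈ I ^ i by
    obtain ⟨z, hz, hz'⟩ := h
    refine ⟨z, fun k => ?_, hz'⟩
    rw [hz]
    simp [mul_comm]
  rw [← hφ] at hv
  by_cases hv0 : v = 0
  · exact ⟨0, by simp [hv0], by simp⟩
  classical
  -- The same `z` must work for all `i`. Since `v ≠ 0` and `R` is separated, there is a largest `i`
  -- with `v ∈ I ^ (i + c)`; a `z` chosen for it serves all smaller ones. If there is no such `i`,
  -- any `z` will do.
  obtain ⟨N, hN⟩ : ∃ N, ¬ ∀ k, v k ∈ I ^ N := by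
    by_contra! h
    refine hv0 (funext fun k => eq_zero_of_forall_mem (I := I) fun i => ?_)
    simpa using h i k
  have hanti : ∀ {i j}, i ≤ j → (∀ k, v k ∈ I ^ j) → ∀ k, v k ∈ I ^ i :=
    fun hij h k => Ideal.pow_le_pow_right hij (h k)
  by_cases h0 : ∀ k, v k ∈ I ^ (0 + c)
  · have h1 := Nat.findGreatest_spec (P := fun i => ∀ k, v k ∈ I ^ (i + c)) (Nat.zero_le N) h0
    obtain ⟨z, hz, hzi⟩ := key _ v hv h1
    refine ⟨z, hz, fun i hi l => Ideal.pow_le_pow_right ?_ (hzi l)⟩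
    refine Nat.le_findGreatest ?_ hi
    by_contra! hlt
    exact hN (hanti (by omega) hi)
  · have h1 : v ∈ LinearMap.ker φ := hv
    rw [← hs, Submodule.mem_span_range_iff_exists_fun] at h1
    obtain ⟨z, hz⟩ := h1
    exact ⟨z, hz.symm, fun i hi => absurd (hanti (by omega) hi) h0⟩

theorem linearCombination_mem {B : Type*} (c : B → M) {a : B →₀ R} {J : Ideal R}
    (ha : ∀ b, a b ∈ J) : Finsupp.linearCombination R c a ∈ (J • ⊤ : Submodule R M) := by
  rw [Finsupp.linearCombination_apply]
  exact sum_mem fun b _ => Submodule.smul_mem_smul (ha b) Submodule.mem_top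

variable (I) in

/-- Pairs `(x, r)` such that `x = ∑ r b • c b` in the `I`-adic topology. -/
def coordinates {B : Type*} (c : B → M) : Submodule R (M × (B → R)) where
  carrier := {y | ∀ n : ℕ, ∃ p : B →₀ R, (∀ b, y.2 b - p b ∈ I ^ n) ∧
    y.1 - Finsupp.linearCombination R c p ∈ (I ^ n • ⊤ : Submodule R M)}
  zero_mem' n := ⟨0, by simp, by simp⟩
  add_mem' {y z} hy hz n := by
    obtain ⟨p, hp, hp'⟩ := hy n
    obtain ⟨q, hq, hq'⟩ := hz n
    refine ⟨p + q, fun b => ?_, ?_⟩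
    · convert add_mem (hp b) (hq b) using 1
      simp only [Prod.snd_add, Pi.add_apply, Finsupp.add_apply]
      ring
    · convert add_mem hp' hq' using 1
      simp only [Prod.fst_add, map_add]
      abel
  smul_mem' t y hy n := by
    obtain ⟨p, hp, hp'⟩ := hy n
    refine ⟨t • p, fun b => ?_, ?_⟩
    · convert Ideal.mul_mem_left _ t (hp b) using 1
      simp [mul_sub]
    · convert Submodule.smul_mem _ t hp' using 1
      simp [smul_sub]

theorem coordinates_fst_eq_zero {B : Type*} {c : B → M} [IsHausdorff I M] {x : M}
    (h : (x, 0) ∈ coordinates I c) : x = 0 := by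
  refine eq_zero_of_forall_mem (I := I) fun n => ?_
  obtain ⟨p, hp, hp'⟩ := h n
  have := linearCombination_mem c (a := p) (J := I ^ n) fun b => by simpa using hp b
  simpa using add_mem hp' this

theorem coordinates_finite {B : Type*} {c : B → M} {y : M × (B → R)}
    (h : y ∈ coordinates I c) (n : ℕ) : {b | y.2 b ∉ I ^ n}.Finite := by
  obtain ⟨p, hp, -⟩ := h n
  refine p.support.finite_toSet.subset fun b hb => ?_
  rw [Finset.mem_coe, Finsupp.mem_support_iff]
  intro h0
  exact hb (by simpa [h0] using hp b)

theorem exists_coordinates_of_finite {B : Type*} (c : B → M) [IsPrecomplete I M] {r : B → R}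
    (h : ∀ n, {b | r b ∉ I ^ n}.Finite) : ∃ x, (x, r) ∈ coordinates I c := by
  classical
  let p : ℕ → B →₀ R := fun n => Finsupp.onFinset (h n).toFinset
    (fun b => if r b ∈ I ^ n then 0 else r b) fun b hb => by
      simp only [ne_eq, ite_eq_left_iff, not_forall] at hb
      simpa using hb.1
  have hp : ∀ n b, r b - p n b ∈ I ^ n := by
    intro n b
    simp only [p, Finsupp.onFinset_apply]
    split_ifs with hb
    · simpa using hb
    · simp
  obtain ⟨x, hx⟩ := exists_limit (I := I) (fun n => Finsupp.linearCombination R c (p n)) fun n => by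
    rw [← map_sub]
    refine linearCombination_mem c fun b => ?_
    have := sub_mem (hp n b) (Ideal.pow_le_pow_right (Nat.le_succ n) (hp (n + 1) b))
    simpa using this
  exact ⟨x, fun n => ⟨p n, hp n, hx n⟩⟩

/-- A complete module `M` such that the homomorphisms
`I ^ i / I ^ (i + 1) ⊗ M / I M → I ^ i M / I ^ (i + 1) M` are injective is flat. -/
theorem flat_of_coeff_mem [IsNoetherianRing R] [I.IsMaximal] [IsAdicComplete I R]
    [IsAdicComplete I M]
    (h : ∀ (i r : ℕ) (e : Fin r → R), IsGrBasis I i e → ∀ x : Fin r → M,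
      ∑ k, e k • x k ∈ (I ^ (i + 1) • ⊤ : Submodule R M) →
        ∀ k, x k ∈ (I • ⊤ : Submodule R M)) : Module.Flat R M := by
  classical
  let _ : Field (R ⧸ I) := Ideal.Quotient.field I
  let G := M ⧸ (I • ⊤ : Submodule R M)
  let β := Module.Basis.ofVectorSpace (R ⧸ I) G
  let B := Module.Basis.ofVectorSpaceIndex (R ⧸ I) G
  -- The lifts `c` of a basis of `M / I M` form a topological basis of `M`: every element is a
  -- unique convergent sum `∑ r_b c_b` with `r_b → 0`. Flatness is then checked on coordinates.
  choose c hc using fun b => Submodule.Quotient.mk_surjective _ (β b)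
  let L : (B →₀ R) →ₗ[R] M := Finsupp.linearCombination R c
  have hL : ∀ a : B →₀ R, (Submodule.Quotient.mk (L a) : G) =
      Finsupp.linearCombination (R ⧸ I) β (a.mapRange (Ideal.Quotient.mk I) (map_zero _)) := by
    intro a
    induction a using Finsupp.induction_linear with
    | zero => simp
    | add f g hf hg =>
      rw [map_add, Submodule.Quotient.mk_add, hf, hg, Finsupp.mapRange_add (map_add _), map_add]
    | single b r =>
      simp only [L, Finsupp.linearCombination_single, Finsupp.mapRange_single, ← hc b]
      rfl
  have gen0 : ∀ x, ∃ a, x - L a ∈ (I • ⊤ : Submodule R M) := by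
    intro x
    obtain ⟨a, ha⟩ := Finsupp.mapRange_surjective (α := B) (Ideal.Quotient.mk I) (map_zero _)
      Ideal.Quotient.mk_surjective (β.repr (Submodule.Quotient.mk x))
    refine ⟨a, ?_⟩
    rw [← Submodule.Quotient.eq, hL, ha, β.linearCombination_repr]
  have ind0 : ∀ a, L a ∈ (I • ⊤ : Submodule R M) → ∀ b, a b ∈ I := by
    intro a ha b
    rw [← Submodule.Quotient.mk_eq_zero, hL] at ha
    have := linearIndependent_iff.1 β.linearIndependent _ ha
    have := DFunLike.congr_fun this b
    exact Ideal.Quotient.eq_zero_iff_mem.1 this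
  -- Coordinates inherit the order of the element. In the induction step the coefficients, already
  -- in `I ^ i`, are expanded in a graded basis `e`, and the hypothesis `h` pushes the expansion
  -- coefficients into `I`.
  have ind : ∀ (i : ℕ) (a : B →₀ R), L a ∈ (I ^ i • ⊤ : Submodule R M) → ∀ b, a b ∈ I ^ i := by
    intro i
    induction i with
    | zero => simp
    | succ i ih =>
      intro a ha
      have hai := ih a (mem_smul_top_of_succ ha)
      obtain ⟨r, e, he⟩ := exists_isGrBasis I i
      choose! γ hγ using he.gen
      -- The expansion of `0` is forced to be `0`, so that applying it to coefficients preserves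
      -- finite support.
      let δ : R → Fin r → R := fun x => if x = 0 then 0 else γ x
      have hδ : ∀ x ∈ I ^ i, x - ∑ k, δ x k * e k ∈ I ^ (i + 1) := by
        intro x hx
        simp only [δ]
        split_ifs with h0
        · simp [h0]
        · exact hγ x hx
      let A : Fin r → B →₀ R := fun k => a.mapRange (fun x => δ x k) (by simp [δ])
      have hrest : ∀ b, (a - ∑ k, e k • A k) b ∈ I ^ (i + 1) := by
        intro b
        simpa [A, Finsupp.finsetSum_apply, mul_comm] using hδ (a b) (hai b)
      have hsum : ∑ k, e k • L (A k) ∈ (I ^ (i + 1) • ⊤ : Submodule R M) := by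
        have := sub_mem ha (linearCombination_mem c hrest)
        simpa [L] using this
      have hA := h i r e he _ hsum
      intro b
      have h1 := hrest b
      have h2 : ∑ k, e k * A k b ∈ I ^ (i + 1) := sum_mem fun k _ => by
        rw [pow_succ]
        exact Ideal.mul_mem_mul (he.mem k) (ind0 _ (hA k) b)
      simpa [Finsupp.finsetSum_apply] using add_mem h1 h2
  have gen : ∀ (i : ℕ) (x : M), x ∈ (I ^ i • ⊤ : Submodule R M) →
      ∃ a : B →₀ R, (∀ b, a b ∈ I ^ i) ∧ x - L a ∈ (I ^ (i + 1) • ⊤ : Submodule R M) := by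
    intro i x hx
    obtain ⟨r, e, he⟩ := exists_isGrBasis I i
    obtain ⟨y, hy⟩ := he.exists_sum hx
    choose a ha using fun k => gen0 (y k)
    refine ⟨∑ k, e k • a k, fun b => ?_, ?_⟩
    · simp only [Finsupp.finsetSum_apply, Finsupp.smul_apply, smul_eq_mul]
      exact sum_mem fun k _ => Ideal.mul_mem_right _ _ (he.mem k)
    · have := add_mem hy (he.sum_mem (y := fun k => y k - L (a k)) 1 (by simpa using ha))
      simpa [smul_sub] using this
  have exists_coord : ∀ x : M, ∃ r, (x, r) ∈ coordinates I c := by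
    intro x
    choose a ha haL using fun (i : ℕ) (x : (I ^ i • ⊤ : Submodule R M)) => gen i x x.2
    let y : ∀ n : ℕ, (I ^ n • ⊤ : Submodule R M) :=
      fun n => Nat.rec ⟨x, by simp⟩ (fun j y => ⟨_, haL j y⟩) n
    let p : ℕ → B →₀ R := fun n => ∑ j ∈ Finset.range n, a j (y j)
    have hy : ∀ n, x - L (p n) = (y n).1 := by
      intro n
      induction n with
      | zero => simp [y, p]
      | succ n ih =>
        have : p (n + 1) = p n + a n (y n) := Finset.sum_range_succ _ _
        rw [this, map_add, ← sub_sub, ih]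
    choose r hr using fun b => exists_limit (I := I) (fun n => p n b) fun n => by
      have : p (n + 1) = p n + a n (y n) := Finset.sum_range_succ _ _
      simpa [this] using ha n (y n) b
    refine ⟨r, fun n => ⟨p n, fun b => by simpa using hr b n, ?_⟩⟩
    change x - L (p n) ∈ _
    rw [hy]
    exact (y n).2
  have snd_eq_zero : ∀ r : B → R, ((0 : M), r) ∈ coordinates I c → r = 0 := by
    intro r hr
    funext b
    refine eq_zero_of_forall_mem (I := I) fun n => ?_
    obtain ⟨p, hp, hp'⟩ := hr n
    have h1 := ind n p (by simpa [L] using hp') b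
    simpa using add_mem (hp b) h1
  refine Module.Flat.of_forall_isTrivialRelation fun {n f x} hx => ?_
  choose r hr using fun k => exists_coord (x k)
  have hr0 : ∀ b, ∑ k, f k * r k b = 0 := by
    intro b
    have h1 : ∑ k, f k • (x k, r k) ∈ coordinates I c :=
      sum_mem fun k _ => Submodule.smul_mem _ _ (hr k)
    have h2 : ∑ k, f k • (x k, r k) = (0, ∑ k, f k • r k) := by
      ext1
      · simpa [Prod.fst_sum] using hx
      · simp [Prod.snd_sum]
    rw [h2] at h1
    simpa using congr_fun (snd_eq_zero _ h1) b
  -- The coordinates at each `b` satisfy the relation `f` over `R`, hence are combinations of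
  -- finitely many syzygies `s`, the same for all `b`. The Artin–Rees shift `d` makes the
  -- coefficients `z b` tend to zero along `B`, so they are coordinates of elements `y l` of `M`.
  obtain ⟨p, d, s, hs, hsz⟩ := exists_syzygies (I := I) f
  choose z hz hzd using fun b => hsz (fun k => r k b) (hr0 b)
  choose y hy using fun l : Fin p => exists_coordinates_of_finite (I := I) c (r := fun b => z b l)
    fun i => by
      refine (Set.finite_iUnion fun k => coordinates_finite (hr k) (i + d)).subset fun b hb => ?_
      rw [Set.mem_iUnion]
      by_contra! hcon
      exact hb (hzd b i (fun k => by simpa using hcon k) l)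
  refine ⟨p, fun k l => s l k, y, fun k => ?_, hs⟩
  rw [← sub_eq_zero]
  refine coordinates_fst_eq_zero (I := I) (c := c) ?_
  have h1 : (x k, r k) - ∑ l, s l k • (y l, fun b => z b l) ∈ coordinates I c :=
    sub_mem (hr k) (sum_mem fun l _ => Submodule.smul_mem _ _ (hy l))
  convert h1 using 1
  ext1
  · simp [Prod.fst_sum]
  · funext b
    simp [Prod.snd_sum, hz]

end Flat

end Deformation

end

noncomputable section

namespace Deformation

/-! ### Algebras that are commutative modulo an ideal -/

section Algebras

variable {R : Type*} [CommRing R] {I : Ideal R}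

section

variable {A : Type*} [Ring A] [Algebra R A]

theorem mul_mem_smul_top_left (a : A) {i : ℕ} {x : A} (hx : x ∈ (I ^ i • ⊤ : Submodule R A)) :
    a * x ∈ (I ^ i • ⊤ : Submodule R A) := by
  induction hx using Submodule.smul_induction_on' with
  | smul r hr m _ =>
    rw [mul_smul_comm]
    exact Submodule.smul_mem_smul hr Submodule.mem_top
  | add x _ y _ hx hy => rw [mul_add]; exact add_mem hx hy

theorem mul_mem_smul_top_right (a : A) {i : ℕ} {x : A} (hx : x ∈ (I ^ i • ⊤ : Submodule R A)) :
    x * a ∈ (I ^ i • ⊤ : Submodule R A) := by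
  induction hx using Submodule.smul_induction_on' with
  | smul r hr m _ =>
    rw [smul_mul_assoc]
    exact Submodule.smul_mem_smul hr Submodule.mem_top
  | add x _ y _ hx hy => rw [add_mul]; exact add_mem hx hy

theorem map_mem_smul_top {M N : Type*} [AddCommGroup M] [Module R M] [AddCommGroup N] [Module R N]
    (f : M →ₗ[R] N) {i : ℕ} {x : M} (hx : x ∈ (I ^ i • ⊤ : Submodule R M)) :
    f x ∈ (I ^ i • ⊤ : Submodule R N) := by
  induction hx using Submodule.smul_induction_on' with
  | smul r hr m _ =>
    rw [map_smul]
    exact Submodule.smul_mem_smul hr Submodule.mem_top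
  | add x _ y _ hx hy => rw [map_add]; exact add_mem hx hy

theorem map_sub_mem_smul_top {B : Type*} [Ring B] [Algebra R B] (f : A →ₐ[R] B) {i : ℕ} {x : A}
    (hx : x ∈ (I ^ i • ⊤ : Submodule R A)) : f x ∈ (I ^ i • ⊤ : Submodule R B) :=
  map_mem_smul_top f.toLinearMap hx

theorem mul_mem_smul_top {i j : ℕ} {x y : A} (hx : x ∈ (I ^ i • ⊤ : Submodule R A))
    (hy : y ∈ (I ^ j • ⊤ : Submodule R A)) : x * y ∈ (I ^ (i + j) • ⊤ : Submodule R A) := by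
  induction hx using Submodule.smul_induction_on' with
  | smul r hr m _ =>
    rw [smul_mul_assoc, pow_add, Submodule.mul_smul]
    exact Submodule.smul_mem_smul hr (mul_mem_smul_top_left m hy)
  | add x _ x' _ hx hx' => rw [add_mul]; exact add_mem hx hx'

variable (I A) in

/-- The algebra `A` is commutative modulo `I`. -/
def IsCommMod : Prop := ∀ x y : A, x * y - y * x ∈ (I • ⊤ : Submodule R A)

theorem IsCommMod.commutator_mem (hA : IsCommMod I A) (s : A) {i : ℕ} {x : A}
    (hx : x ∈ (I ^ i • ⊤ : Submodule R A)) :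
    s * x - x * s ∈ (I ^ (i + 1) • ⊤ : Submodule R A) := by
  induction hx using Submodule.smul_induction_on' with
  | smul r hr m _ =>
    rw [mul_smul_comm, smul_mul_assoc, ← smul_sub, pow_succ, Submodule.mul_smul]
    exact Submodule.smul_mem_smul hr (hA s m)
  | add x _ y _ hx hy =>
    convert add_mem hx hy using 1
    rw [mul_add, add_mul]
    abel

/-- The left Ore condition modulo powers of `I`. -/

theorem IsCommMod.exists_ore (hA : IsCommMod I A) (s x : A) (n : ℕ) :
    ∃ y, s ^ n * x - y * s ∈ (I ^ n • ⊤ : Submodule R A) := by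
  induction n with
  | zero => exact ⟨0, by simp⟩
  | succ n ih =>
    obtain ⟨y, hy⟩ := ih
    -- With `ε = s ^ n x - y s`, the new error is `s ε - ε s`, a commutator with an element of `I ^
    -- n A`, so it gains one power of `I`.
    refine ⟨s * y + (s ^ n * x - y * s), ?_⟩
    convert hA.commutator_mem s hy using 1
    rw [pow_succ']
    noncomm_ring

/-- The inverse is the `I`-adic limit of the geometric series. -/
theorem isUnit_one_sub [IsAdicComplete I A] {y : A} (hy : y ∈ (I • ⊤ : Submodule R A)) :
    IsUnit (1 - y) := by
  have hpow : ∀ n, y ^ n ∈ (I ^ n • ⊤ : Submodule R A) := by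
    intro n
    induction n with
    | zero => simp
    | succ n ih =>
      rw [pow_succ y]
      exact mul_mem_smul_top (j := 1) ih (by rwa [pow_one])
  obtain ⟨z, hz⟩ := exists_limit (I := I) (fun n => ∑ k ∈ Finset.range n, y ^ k) fun n => by
    rw [Finset.sum_range_succ_sub_sum]
    exact hpow n
  refine isUnit_iff_exists.2 ⟨z, ?_, ?_⟩
  · rw [← sub_eq_zero]
    refine eq_zero_of_forall_mem (I := I) fun n => ?_
    have h1 := mul_neg_geom_sum y n
    have h2 := sub_mem (mul_mem_smul_top_left (1 - y) (hz n)) (hpow n)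
    rw [mul_sub, h1] at h2
    convert h2 using 1
    abel
  · rw [← sub_eq_zero]
    refine eq_zero_of_forall_mem (I := I) fun n => ?_
    have h1 := geom_sum_mul_neg y n
    have h2 := sub_mem (mul_mem_smul_top_right (1 - y) (hz n)) (hpow n)
    rw [sub_mul, h1] at h2
    convert h2 using 1
    abel

theorem isUnit_of_mul_sub_one_mem [IsAdicComplete I A] {x y : A}
    (h : x * y - 1 ∈ (I • ⊤ : Submodule R A)) (h' : y * x - 1 ∈ (I • ⊤ : Submodule R A)) :
    IsUnit x := by
  have h1 : IsUnit (x * y) := by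
    have := isUnit_one_sub (I := I) (neg_mem h)
    rwa [sub_neg_eq_add, add_sub_cancel] at this
  have h2 : IsUnit (y * x) := by
    have := isUnit_one_sub (I := I) (neg_mem h')
    rwa [sub_neg_eq_add, add_sub_cancel] at this
  obtain ⟨u, hu⟩ := h1
  obtain ⟨v, hv⟩ := h2
  refine isUnit_iff_exists_and_exists.2 ⟨⟨y * ↑u⁻¹, ?_⟩, ⟨↑v⁻¹ * y, ?_⟩⟩
  · rw [← mul_assoc, ← hu, Units.mul_inv]
  · rw [mul_assoc, ← hv, Units.inv_mul]

end

/-! ### Deformations of commutative algebras -/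

section

variable {A C : Type*} [Ring A] [Algebra R A] [CommRing C] [Algebra R C] {π : A →ₐ[R] C}

theorem IsDefMod.isCommMod (hA : IsDefMod I π.toLinearMap) : IsCommMod I A := fun x y => by
  rw [← hA.ker]
  simp [mul_comm]

theorem IsDefMod.isUnit (hA : IsDefMod I π.toLinearMap) {x : A} (hx : IsUnit (π x)) :
    IsUnit x := by
  have := hA.complete
  obtain ⟨u, hu⟩ := hx
  obtain ⟨y, hy⟩ := hA.surj ↑u⁻¹
  replace hy : π y = ↑u⁻¹ := hy
  refine isUnit_of_mul_sub_one_mem (I := I) (y := y) ?_ ?_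
  · rw [← hA.ker]
    simp [hy, ← hu]
  · rw [← hA.ker]
    simp [hy, ← hu]

theorem IsDefMod.map_eq_iff (hA : IsDefMod I π.toLinearMap) {x y : A} :
    π x = π y ↔ x - y ∈ (I ^ 1 • ⊤ : Submodule R A) := by
  rw [pow_one, ← hA.ker]
  simp [sub_eq_zero]

/-- A homomorphism of flat modules that is injective modulo `I` reflects the `I`-adic
filtrations. -/
theorem reflects_smul_top [IsNoetherianRing R] [I.IsMaximal] {M N : Type*} [AddCommGroup M]
    [Module R M] [AddCommGroup N] [Module R N] [Module.Flat R N] (f : M →ₗ[R] N)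
    (hf : ∀ x, f x ∈ (I • ⊤ : Submodule R N) → x ∈ (I • ⊤ : Submodule R M)) {n : ℕ} {x : M}
    (hx : f x ∈ (I ^ n • ⊤ : Submodule R N)) : x ∈ (I ^ n • ⊤ : Submodule R M) := by
  induction n with
  | zero => simp
  | succ n ih =>
    obtain ⟨r, e, he⟩ := exists_isGrBasis I n
    obtain ⟨y, hy⟩ := he.exists_sum (ih (mem_smul_top_of_succ hx))
    -- The leading coefficients of `f x` are the `f (y k)`. Flatness of `N` puts them in `I N`, and
    -- `hf` brings this back to `M`.
    have h1 := sub_mem hx (map_mem_smul_top f hy)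
    simp only [map_sub, sub_sub_cancel, map_sum, map_smul] at h1
    have h2 := he.sum_mem (y := y) 1 fun k => by
      rw [pow_one]
      exact hf _ (he.coeff_mem h1 k)
    simpa using add_mem hy h2

end

/-! ### Fractions -/

section Fractions

variable {A : Type*} [Ring A] [Algebra R A]

variable (I) in

/-- The elements of `E` that are left fractions `χ(s)⁻¹ χ(a)` with `s ∈ S`, modulo `I ^ n`. -/
def fracLevel (hA : IsCommMod I A) {E : Type*} [Ring E] [Algebra R E] (χ : A →ₐ[R] E)
    (S : Submonoid A) (n : ℕ) : Subalgebra R E where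
  carrier := {x | ∃ s ∈ S, ∃ a, χ s * x - χ a ∈ (I ^ n • ⊤ : Submodule R E)}
  algebraMap_mem' r := ⟨1, S.one_mem, algebraMap R A r, by simp⟩
  mul_mem' {x x'} := by
    rintro ⟨s, hs, a, h⟩ ⟨s', hs', a', h'⟩
    -- The Ore condition moves `a` past `s'`: modulo `I ^ n`, `s' ^ n s x x' = s' ^ n a x' = v s' x'
    -- = v a'` (images under `χ` understood).
    obtain ⟨v, hv⟩ := hA.exists_ore s' a n
    refine ⟨s' ^ n * s, S.mul_mem (S.pow_mem hs' n) hs, v * a', ?_⟩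
    have h1 := mul_mem_smul_top_right x' (mul_mem_smul_top_left (χ (s' ^ n)) h)
    have h2 := mul_mem_smul_top_right x' (map_sub_mem_smul_top χ hv)
    have h3 := mul_mem_smul_top_left (χ v) h'
    convert add_mem (add_mem h1 h2) h3 using 1
    simp only [map_sub, map_mul]
    noncomm_ring
  add_mem' {x x'} := by
    rintro ⟨s, hs, a, h⟩ ⟨s', hs', a', h'⟩
    obtain ⟨v, hv⟩ := hA.exists_ore s' s n
    refine ⟨s' ^ n * s, S.mul_mem (S.pow_mem hs' n) hs, s' ^ n * a + v * a', ?_⟩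
    have h1 := mul_mem_smul_top_left (χ (s' ^ n)) h
    have h2 := mul_mem_smul_top_right x' (map_sub_mem_smul_top χ hv)
    have h3 := mul_mem_smul_top_left (χ v) h'
    convert add_mem (add_mem h1 h2) h3 using 1
    simp only [map_sub, map_mul, map_add]
    noncomm_ring

variable (I) in

/-- The elements of `E` that are left fractions `χ(s)⁻¹ χ(a)` with `s ∈ S`, modulo each power
of `I`. -/
def fracClosure (hA : IsCommMod I A) {E : Type*} [Ring E] [Algebra R E] (χ : A →ₐ[R] E)
    (S : Submonoid A) : Subalgebra R E :=
  ⨅ n, fracLevel I hA χ S n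

variable {hA : IsCommMod I A} {E : Type*} [Ring E] [Algebra R E] {χ : A →ₐ[R] E}
  {S : Submonoid A}

theorem mem_fracLevel {n : ℕ} {x : E} : x ∈ fracLevel I hA χ S n ↔
    ∃ s ∈ S, ∃ a, χ s * x - χ a ∈ (I ^ n • ⊤ : Submodule R E) := Iff.rfl

theorem mem_fracClosure {x : E} : x ∈ fracClosure I hA χ S ↔
    ∀ n : ℕ, ∃ s ∈ S, ∃ a, χ s * x - χ a ∈ (I ^ n • ⊤ : Submodule R E) := by
  simp only [fracClosure, Algebra.mem_iInf, mem_fracLevel]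

theorem mem_fracLevel_of_mem {n : ℕ} {x : E} (hx : x ∈ (I ^ n • ⊤ : Submodule R E)) :
    x ∈ fracLevel I hA χ S n := ⟨1, S.one_mem, 0, by simpa using hx⟩

theorem mem_fracClosure_of_forall_sub_mem {x : E} {f : ℕ → E}
    (hf : ∀ n, f n ∈ fracLevel I hA χ S n) (hx : ∀ n, x - f n ∈ (I ^ n • ⊤ : Submodule R E)) :
    x ∈ fracClosure I hA χ S := by
  rw [fracClosure, Algebra.mem_iInf]
  intro n
  have := add_mem (mem_fracLevel_of_mem (hA := hA) (χ := χ) (S := S) (hx n)) (hf n)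
  rwa [sub_add_cancel] at this

theorem map_mem_fracClosure (a : A) : χ a ∈ fracClosure I hA χ S :=
  mem_fracClosure.2 fun _ => ⟨1, S.one_mem, a, by simp⟩

theorem fraction_mem_fracClosure {s : A} (hs : s ∈ S) {a : A} {x : E} (h : χ s * x = χ a) :
    x ∈ fracClosure I hA χ S :=
  mem_fracClosure.2 fun _ => ⟨s, hs, a, by simp [h]⟩

theorem fracClosure_mono {S S' : Submonoid A} (h : S ≤ S') :
    fracClosure I hA χ S ≤ fracClosure I hA χ S' := fun _ hx =>
  mem_fracClosure.2 fun n =>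
    let ⟨s, hs, a, ha⟩ := mem_fracClosure.1 hx n
    ⟨s, h hs, a, ha⟩

end Fractions

/-! ### Localizations of deformations -/

/-- The algebra `B` is, via `φ`, a localization of the deformation `A` at `S`: it is a deformation
of the localization of the commutative algebra `A / I A`, which embeds into this localization. -/
structure IsDefLoc (I : Ideal R) {A C B V : Type*} [Ring A] [Algebra R A] [CommRing C] [Algebra R C]
    [Ring B] [Algebra R B] [CommRing V] [Algebra R V] (πA : A →ₐ[R] C) (πB : B →ₐ[R] V)
    (φ : A →ₐ[R] B) (S : Submonoid A) : Prop where
  left : IsDefMod I πA.toLinearMap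
  right : IsDefMod I πB.toLinearMap
  inj : ∀ a, πB (φ a) = 0 → πA a = 0
  unit : ∀ s ∈ S, IsUnit (πB (φ s))
  frac : ∀ v, ∃ s ∈ S, ∃ a, πB (φ s) * v = πB (φ a)

namespace IsDefLoc

variable {A C B V : Type*} [Ring A] [Algebra R A] [CommRing C] [Algebra R C]
    [Ring B] [Algebra R B] [CommRing V] [Algebra R V] {πA : A →ₐ[R] C} {πB : B →ₐ[R] V}
    {φ : A →ₐ[R] B} {S : Submonoid A}

theorem isUnit (h : IsDefLoc I πA πB φ S) {s : A} (hs : s ∈ S) : IsUnit (φ s) :=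
  h.right.isUnit (h.unit s hs)

theorem reflects [IsNoetherianRing R] [I.IsMaximal] (h : IsDefLoc I πA πB φ S) {n : ℕ} {a : A}
    (ha : φ a ∈ (I ^ n • ⊤ : Submodule R B)) : a ∈ (I ^ n • ⊤ : Submodule R A) := by
  have := h.right.flat
  refine reflects_smul_top φ.toLinearMap (fun x hx => ?_) ha
  rw [← h.left.ker]
  rw [← h.right.ker] at hx
  exact h.inj x hx

/-- For `r • b` with `r ∈ I ^ j` it is enough to write `b` as a fraction modulo `I`. Two fractions
are brought over the denominator `s' * s`: exchanging `s` and `s'` in front of `y ∈ I ^ j B` costs a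
commutator in `I B`, hence a term in `I ^ (j + 1) B`. -/
theorem exists_frac_succ (h : IsDefLoc I πA πB φ S) {j : ℕ} {x : B}
    (hx : x ∈ (I ^ j • ⊤ : Submodule R B)) :
    ∃ s ∈ S, ∃ a, φ s * x - φ a ∈ (I ^ (j + 1) • ⊤ : Submodule R B) := by
  suffices ∃ s ∈ S, ∃ a ∈ (I ^ j • ⊤ : Submodule R A),
      φ s * x - φ a ∈ (I ^ (j + 1) • ⊤ : Submodule R B) from
    let ⟨s, hs, a, _, h⟩ := this
    ⟨s, hs, a, h⟩
  induction hx using Submodule.smul_induction_on' with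
  | smul r hr b _ =>
    obtain ⟨s, hs, a, ha⟩ := h.frac (πB b)
    refine ⟨s, hs, r • a, Submodule.smul_mem_smul hr Submodule.mem_top, ?_⟩
    rw [← map_mul, h.right.map_eq_iff, pow_one] at ha
    rw [mul_smul_comm, map_smul, ← smul_sub, pow_succ, Submodule.mul_smul]
    exact Submodule.smul_mem_smul hr ha
  | add x _ y hy hx' hy' =>
    obtain ⟨s, hs, a, ha, hsa⟩ := hx'
    obtain ⟨s', hs', a', ha', hsa'⟩ := hy'
    refine ⟨s' * s, S.mul_mem hs' hs, s' * a + s * a',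
      add_mem (mul_mem_smul_top_left s' ha) (mul_mem_smul_top_left s ha'), ?_⟩
    have h1 := mul_mem_smul_top_left (φ s') hsa
    have h2 := mul_mem_smul_top_left (φ s) hsa'
    have h3 : (φ s' * φ s - φ s * φ s') * y ∈ (I ^ (j + 1) • ⊤ : Submodule R B) := by
      rw [add_comm j]
      refine mul_mem_smul_top (i := 1) ?_ hy
      rw [pow_one]
      exact h.right.isCommMod _ _
    convert add_mem (add_mem h1 h2) h3 using 1
    simp only [map_mul, map_add]
    noncomm_ring

theorem exists_frac (h : IsDefLoc I πA πB φ S) (n : ℕ) (b : B) :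
    ∃ s ∈ S, ∃ a, φ s * b - φ a ∈ (I ^ n • ⊤ : Submodule R B) := by
  induction n with
  | zero => exact ⟨1, S.one_mem, 0, by simp⟩
  | succ n ih =>
    obtain ⟨s, hs, a, ha⟩ := ih
    obtain ⟨s', hs', a', ha'⟩ := h.exists_frac_succ ha
    refine ⟨s' * s, S.mul_mem hs' hs, s' * a + a', ?_⟩
    convert ha' using 1
    simp only [map_mul, map_add]
    noncomm_ring

/-- An `R`-linear homomorphism that vanishes on `A`, and is compatible with multiplication by
elements of `S`, vanishes. -/
theorem linear_eq_zero (h : IsDefLoc I πA πB φ S) {D : Type*} [Ring D] [Algebra R D]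
    [IsHausdorff I D] (δ : B →ₗ[R] D) (u : A → D) (hu : ∀ s ∈ S, IsUnit (u s))
    (hmul : ∀ s ∈ S, ∀ b, δ (φ s * b) = u s * δ b) (h0 : ∀ a, δ (φ a) = 0) : δ = 0 := by
  ext b
  refine eq_zero_of_forall_mem (I := I) fun n => ?_
  obtain ⟨s, hs, a, ha⟩ := h.exists_frac n b
  have h1 := map_mem_smul_top δ ha
  rw [map_sub, hmul s hs, h0, sub_zero] at h1
  obtain ⟨v, hv⟩ := hu s hs
  rw [← hv] at h1
  simpa using mul_mem_smul_top_left (↑v⁻¹) h1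

theorem algHom_ext (h : IsDefLoc I πA πB φ S) {D : Type*} [Ring D] [Algebra R D]
    [IsHausdorff I D] {f g : B →ₐ[R] D} (hfg : ∀ a, f (φ a) = g (φ a)) : f = g := by
  have := h.linear_eq_zero (f.toLinearMap - g.toLinearMap) (fun a => f (φ a))
    (fun s hs => (h.isUnit hs).map f) (fun s _ b => by simp [hfg, mul_sub])
    (fun a => by simp [hfg])
  ext b
  simpa [sub_eq_zero] using LinearMap.congr_fun this b

theorem prod_mem_smul_top {M N : Type*} [AddCommGroup M] [Module R M] [AddCommGroup N]
    [Module R N] {n : ℕ} {x : M × N} : x ∈ (I ^ n • ⊤ : Submodule R (M × N)) ↔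
      x.1 ∈ (I ^ n • ⊤ : Submodule R M) ∧ x.2 ∈ (I ^ n • ⊤ : Submodule R N) := by
  refine ⟨fun h => ⟨map_mem_smul_top (LinearMap.fst R M N) h,
    map_mem_smul_top (LinearMap.snd R M N) h⟩, fun h => ?_⟩
  have h1 := map_mem_smul_top (LinearMap.inl R M N) h.1
  have h2 := map_mem_smul_top (LinearMap.inr R M N) h.2
  simpa using add_mem h1 h2

/-- The universal property of localizations of deformations. -/

theorem exists_lift [IsNoetherianRing R] [I.IsMaximal] (h : IsDefLoc I πA πB φ S) {D : Type*}
    [Ring D] [Algebra R D] [IsAdicComplete I D] (ψ : A →ₐ[R] D) (hψ : ∀ s ∈ S, IsUnit (ψ s)) :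
    ∃ f : B →ₐ[R] D, ∀ a, f (φ a) = ψ a := by
  -- The lift is constructed through its graph: the closure `G` of the fractions of `A` inside `B ×
  -- D` projects bijectively onto `B`.
  let χ : A →ₐ[R] B × D := φ.prod ψ
  have hA := h.left.isCommMod
  let G := fracClosure I hA χ S
  -- If the first component is zero modulo `I ^ n`, so is the numerator in `A`, because `φ` reflects
  -- the filtration; dividing by the unit `ψ s` shows the same for the second component.
  have hlevel : ∀ n (x : B × D), x ∈ fracLevel I hA χ S n →
      x.1 ∈ (I ^ n • ⊤ : Submodule R B) → x.2 ∈ (I ^ n • ⊤ : Submodule R D) := by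
    rintro n ⟨b, d⟩ ⟨s, hs, a, ha⟩ hb
    obtain ⟨h1, h2⟩ := prod_mem_smul_top.1 ha
    have h3 := sub_mem (mul_mem_smul_top_left (φ s) hb) h1
    have h4 : φ a ∈ (I ^ n • ⊤ : Submodule R B) := by simpa [χ] using h3
    have h5 := add_mem h2 (map_sub_mem_smul_top ψ (h.reflects h4))
    have h6 : ψ s * d ∈ (I ^ n • ⊤ : Submodule R D) := by simpa [χ] using h5
    obtain ⟨v, hv⟩ := hψ s hs
    rw [← hv] at h6
    simpa using mul_mem_smul_top_left (↑v⁻¹) h6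
  have hinj : Function.Injective ((AlgHom.fst R B D).comp G.val) := by
    rw [injective_iff_map_eq_zero]
    rintro ⟨⟨b, d⟩, hx⟩ hb
    replace hb : b = 0 := hb
    subst hb
    have : d = 0 := eq_zero_of_forall_mem (I := I) fun n =>
      hlevel n _ ((Algebra.mem_iInf.1 hx) n) (zero_mem _)
    subst this
    rfl
  have hsurj : Function.Surjective ((AlgHom.fst R B D).comp G.val) := by
    intro b
    have h1 : ∀ n, ∃ d, (b, d) ∈ fracLevel I hA χ S n := by
      intro n
      obtain ⟨s, hs, a, ha⟩ := h.exists_frac n b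
      obtain ⟨v, hv⟩ := hψ s hs
      refine ⟨↑v⁻¹ * ψ a, s, hs, a, prod_mem_smul_top.2 ⟨by simpa [χ] using ha, ?_⟩⟩
      simp [χ, ← hv]
    choose d hd using h1
    -- The second components found at successive levels are compatible by `hlevel`, so they converge
    -- in `D`.
    obtain ⟨x, hx⟩ := exists_limit (I := I) d fun n => by
      have h2 : (b, d (n + 1)) ∈ fracLevel I hA χ S n := by
        obtain ⟨s, hs, a, ha⟩ := hd (n + 1)
        exact ⟨s, hs, a, mem_smul_top_of_succ ha⟩
      exact hlevel n _ (sub_mem h2 (hd n)) (by simp)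
    exact ⟨⟨(b, x), mem_fracClosure_of_forall_sub_mem hd fun n =>
      prod_mem_smul_top.2 ⟨by simp, hx n⟩⟩, rfl⟩
  let ε := AlgEquiv.ofBijective _ ⟨hinj, hsurj⟩
  refine ⟨((AlgHom.snd R B D).comp G.val).comp ε.symm.toAlgHom, fun a => ?_⟩
  have : ε.symm (φ a) = ⟨χ a, map_mem_fracClosure a⟩ := by
    rw [AlgEquiv.symm_apply_eq]
    rfl
  change (ε.symm (φ a)).1.2 = _
  rw [this]
  rfl

end IsDefLoc

end Algebras

end Deformation

end

noncomputable section

namespace Deformation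

/-! ### Fractions inside a larger deformation -/

section Algebras

variable {R : Type*} [CommRing R] {I : Ideal R}

/-- The fractions with denominators in `S` inside a deformation `Q`, in which the elements of `S`
are invertible, form a deformation. -/
theorem isDefMod_of_range_eq_fracClosure [IsNoetherianRing R] [I.IsMaximal] [IsAdicComplete I R]
    {A C Q L B V : Type*} [Ring A] [Algebra R A] [CommRing C] [Algebra R C] [Ring Q] [Algebra R Q]
    [CommRing L] [Algebra R L] [AddCommGroup B] [Module R B] [AddCommGroup V] [Module R V]
    {πA : A →ₐ[R] C} {πQ : Q →ₐ[R] L} {φ : A →ₐ[R] Q} (hA : IsDefMod I πA.toLinearMap)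
    (hQ : IsDefMod I πQ.toLinearMap) (hinj : ∀ a, πQ (φ a) = 0 → πA a = 0) (S : Submonoid A)
    (hS : ∀ s ∈ S, IsUnit (πQ (φ s))) (k : B →ₗ[R] Q) (hk : Function.Injective k)
    (hrange : ∀ q, q ∈ fracClosure I hA.isCommMod φ S ↔ ∃ b, k b = q) (π : B →ₗ[R] V)
    (j : V →ₗ[R] L) (hj : Function.Injective j) (hjπ : ∀ b, j (π b) = πQ (k b))
    (hfrac : ∀ v, ∃ s ∈ S, ∃ a, πQ (φ s) * j v = πQ (φ a)) : IsDefMod I π := by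
  have := hQ.flat
  have := hQ.complete
  have hrefl : ∀ {n : ℕ} {a : A}, φ a ∈ (I ^ n • ⊤ : Submodule R Q) →
      a ∈ (I ^ n • ⊤ : Submodule R A) := fun ha =>
    reflects_smul_top φ.toLinearMap (fun x hx => by
      rw [← hA.ker]
      rw [← hQ.ker] at hx
      exact hinj x hx) ha
  have hdiv : ∀ s ∈ S, ∃ u : Qˣ, φ s = u ∧ ∀ a, ∃ b, k b = ↑u⁻¹ * φ a := by
    intro s hs
    obtain ⟨u, hu⟩ := hQ.isUnit (hS s hs)
    refine ⟨u, hu.symm, fun a => (hrange _).1 (fraction_mem_fracClosure hs (a := a) ?_)⟩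
    rw [← hu, Units.mul_inv_cancel_left]
  -- The filtration induced from `Q` is complete. To see that it is the `I`-adic one, write an
  -- element of `W n` as a fraction: its numerator lies in `I ^ n A`, and dividing the leading
  -- coefficients of the numerator by the denominator stays inside `B`.
  let W : ℕ → Submodule R B := fun n => (I ^ n • ⊤ : Submodule R Q).comap k
  have hW : IsCompleteFiltration I W := by
    refine ⟨fun x hx => hk ?_, fun f hf => ?_, fun n b hb => map_mem_smul_top k hb,
      fun n b hb => mem_smul_top_of_succ hb, fun n b hb => ?_⟩
    · rw [map_zero]
      exact eq_zero_of_forall_mem (I := I) hx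
    · obtain ⟨q, hq⟩ := exists_limit (I := I) (fun n => k (f n)) fun n => by
        rw [← map_sub]
        exact hf n
      have hq' : q ∈ fracClosure I hA.isCommMod φ S :=
        mem_fracClosure_of_forall_sub_mem (fun n =>
          (Algebra.mem_iInf.1 ((hrange _).2 ⟨f n, rfl⟩)) n) hq
      obtain ⟨b, rfl⟩ := (hrange _).1 hq'
      exact ⟨b, fun n => by simpa [W] using hq n⟩
    · obtain ⟨r, e, he⟩ := exists_isGrBasis I n
      obtain ⟨s, hs, a, ha⟩ := mem_fracClosure.1 ((hrange _).2 ⟨b, rfl⟩) (n + 1)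
      have ha' : φ a ∈ (I ^ n • ⊤ : Submodule R Q) := by
        have := sub_mem (mul_mem_smul_top_left (φ s) hb) (mem_smul_top_of_succ ha)
        simpa using this
      obtain ⟨y, hy⟩ := he.exists_sum (hrefl ha')
      obtain ⟨u, hu, hdiv⟩ := hdiv s hs
      choose β hβ using fun l => hdiv (y l)
      rw [Submodule.mem_sup]
      refine ⟨∑ l, e l • β l, by simpa using he.sum_mem (y := β) 0 (by simp),
        b - ∑ l, e l • β l, ?_, by simp⟩
      have h1 := mul_mem_smul_top_left (↑u⁻¹ : Q) (add_mem ha (map_sub_mem_smul_top φ hy))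
      have h2 : k (b - ∑ l, e l • β l) ∈ (I ^ (n + 1) • ⊤ : Submodule R Q) := by
        convert h1 using 1
        simp [hβ, hu, mul_sub, Finset.mul_sum]
      exact h2
  have hW' := hW.eq_smul_top
  have hcomplete := hW.isAdicComplete
  refine ⟨flat_of_coeff_mem (I := I) fun i r e he x hx l => ?_, hcomplete, fun v => ?_, fun b => ?_⟩
  · rw [← pow_one I, ← hW']
    change k (x l) ∈ (I ^ 1 • ⊤ : Submodule R Q)
    rw [pow_one]
    refine he.coeff_mem (x := fun l => k (x l)) ?_ l
    simpa using map_mem_smul_top k hx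
  · obtain ⟨s, hs, a, ha⟩ := hfrac v
    obtain ⟨u, hu, hdiv⟩ := hdiv s hs
    obtain ⟨b, hb⟩ := hdiv a
    refine ⟨b, hj ((hS s hs).mul_left_cancel ?_)⟩
    rw [ha, hjπ, hb, hu, ← map_mul, Units.mul_inv_cancel_left]
  · rw [← hj.eq_iff, map_zero, hjπ, ← pow_one I, ← hW']
    change πQ.toLinearMap (k b) = 0 ↔ k b ∈ (I ^ 1 • ⊤ : Submodule R Q)
    rw [hQ.ker, pow_one]

theorem IsDefMod.smul_eq_zero {M N : Type*} [AddCommGroup M] [Module R M] [AddCommGroup N]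
    [Module R N] {π : M →ₗ[R] N} (h : IsDefMod I π) {r : R} (hr : r ∈ I) (x : N) : r • x = 0 := by
  obtain ⟨y, rfl⟩ := h.surj x
  rw [← map_smul, h.ker]
  exact Submodule.smul_mem_smul hr Submodule.mem_top

/-- `I` annihilates `N`, so the filtration is zero from the first step on. This makes the uniqueness
results for localizations applicable to maps into algebras of functions. -/
theorem IsDefMod.isHausdorff {M N : Type*} [AddCommGroup M] [Module R M] [AddCommGroup N]
    [Module R N] {π : M →ₗ[R] N} (h : IsDefMod I π) : IsHausdorff I N where
  haus' x hx := by
    have h1 : (I • ⊤ : Submodule R N) = ⊥ :=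
      (Submodule.smul_le.2 fun r hr n _ => by simp [h.smul_eq_zero hr]).antisymm bot_le
    simpa [h1] using SModEq.zero.1 (hx 1)

/-- A commutator with a fixed element is a linear map compatible with denominators, so
`linear_eq_zero` spreads its vanishing from `A` to `B`, once in each variable. -/
theorem IsDefLoc.mul_comm {A C B V : Type*} [Ring A] [Algebra R A] [CommRing C] [Algebra R C]
    [Ring B] [Algebra R B] [CommRing V] [Algebra R V] {πA : A →ₐ[R] C} {πB : B →ₐ[R] V}
    {φ : A →ₐ[R] B} {S : Submonoid A} (h : IsDefLoc I πA πB φ S)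
    (hA : ∀ a a' : A, a * a' = a' * a) (b b' : B) : b * b' = b' * b := by
  have := h.right.complete
  have h1 : ∀ (a : A) (b : B), φ a * b = b * φ a := fun a b => by
    have := h.linear_eq_zero (LinearMap.mulLeft R (φ a) - LinearMap.mulRight R (φ a)) φ
      (fun s hs => h.isUnit hs) (fun s _ b => by
        simp only [LinearMap.sub_apply, LinearMap.mulLeft_apply, LinearMap.mulRight_apply,
          mul_sub, ← mul_assoc, ← map_mul, hA a s])
      (fun a' => by simp [← map_mul, hA a a'])
    simpa [sub_eq_zero] using LinearMap.congr_fun this b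
  have := h.linear_eq_zero (LinearMap.mulRight R b' - LinearMap.mulLeft R b') φ
      (fun s hs => h.isUnit hs) (fun s _ b => by
        simp only [LinearMap.sub_apply, LinearMap.mulLeft_apply, LinearMap.mulRight_apply,
          mul_sub, ← mul_assoc, h1 s b'])
      (fun a' => by simp [h1])
  simpa [sub_eq_zero] using LinearMap.congr_fun this b

end Algebras

/-! ### Poisson brackets -/

section Poisson

/-- The defect `f {b, b'} - {f b, f b'}` is linear in each argument, and by the Leibniz rule
multiplication by an element of `φ(A)` passes through it as soon as that element has no defect
against the other argument. So `linear_eq_zero` extends its vanishing from `A` to `B` one argument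
after the other. -/
theorem PoissonBracket.map_br_of_isDefLoc {R A C B V D : Type u} [CommRing R] {I : Ideal R}
    [CommRing A] [Algebra R A] [CommRing C] [Algebra R C] [CommRing B] [Algebra R B] [CommRing V]
    [Algebra R V] {πA : A →ₐ[R] C} {πB : B →ₐ[R] V} {φ : A →ₐ[R] B} {S : Submonoid A}
    (h : IsDefLoc I πA πB φ S) [CommRing D] [Algebra R D] [IsHausdorff I D]
    (P : PoissonBracket R B) (P' : PoissonBracket R D) (f : B →ₐ[R] D)
    (hf : ∀ a a', f (P.br (φ a) (φ a')) = P'.br (f (φ a)) (f (φ a'))) (b b' : B) :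
    f (P.br b b') = P'.br (f b) (f b') := by
  have h1 : ∀ a b, f (P.br (φ a) b) = P'.br (f (φ a)) (f b) := fun a b => by
    have := h.linear_eq_zero (f.toLinearMap ∘ₗ P.br (φ a) - P'.br (f (φ a)) ∘ₗ f.toLinearMap)
      (fun s => f (φ s)) (fun s hs => (h.isUnit hs).map f)
      (fun s _ b => by
        simp only [LinearMap.sub_apply, LinearMap.comp_apply, AlgHom.toLinearMap_apply,
          P.leibniz_right, map_mul, map_add, P'.leibniz_right, hf]
        ring)
      (fun a' => by simp [hf])
    simpa [sub_eq_zero] using LinearMap.congr_fun this b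
  have := h.linear_eq_zero (f.toLinearMap ∘ₗ P.br.flip b' - P'.br.flip (f b') ∘ₗ f.toLinearMap)
      (fun s => f (φ s)) (fun s hs => (h.isUnit hs).map f)
      (fun s _ b => by
        simp only [LinearMap.sub_apply, LinearMap.comp_apply, AlgHom.toLinearMap_apply,
          LinearMap.flip_apply, P.leibniz_left, map_mul, map_add, P'.leibniz_left, h1]
        ring)
      (fun a' => by simp [h1])
  simpa [sub_eq_zero] using LinearMap.congr_fun this b

/-- The zero bracket. -/
def PoissonBracket.zero (R A : Type u) [CommRing R] [CommRing A] [Algebra R A] :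
    PoissonBracket R A where
  br := 0
  antisymm := by simp
  jacobi := by simp
  leibniz_right := by simp
  leibniz_left := by simp

variable {R A C B V : Type u} [CommRing R] {I : Ideal R}
    [CommRing A] [Algebra R A] [CommRing C] [Algebra R C] [CommRing B] [Algebra R B] [CommRing V]
    [Algebra R V] {πA : A →ₐ[R] C} {πB : B →ₐ[R] V} {φ : A →ₐ[R] B} {S : Submonoid A}

theorem isAdicComplete_trivSqZeroExt [IsAdicComplete I B] :
    IsAdicComplete I (TrivSqZeroExt B B) where
  haus' x hx := by
    have h : ∀ n : ℕ, x ∈ (I ^ n • ⊤ : Submodule R (TrivSqZeroExt B B)) := fun n =>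
      SModEq.zero.1 (hx n)
    refine TrivSqZeroExt.ext ?_ ?_
    · exact eq_zero_of_forall_mem (I := I) fun n =>
        (IsDefLoc.prod_mem_smul_top (M := B) (N := B) (x := x) |>.1 (h n)).1
    · exact eq_zero_of_forall_mem (I := I) fun n =>
        (IsDefLoc.prod_mem_smul_top (M := B) (N := B) (x := x) |>.1 (h n)).2
  prec' f hf := by
    have h : ∀ n : ℕ, f (n + 1) - f n ∈ (I ^ n • ⊤ : Submodule R (TrivSqZeroExt B B)) := fun n =>
      SModEq.sub_mem.1 (hf (Nat.le_succ n)).symm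
    obtain ⟨x, hx⟩ := exists_limit (I := I) (fun n => (f n).fst) fun n =>
      (IsDefLoc.prod_mem_smul_top (M := B) (N := B) |>.1 (h n)).1
    obtain ⟨y, hy⟩ := exists_limit (I := I) (fun n => (f n).snd) fun n =>
      (IsDefLoc.prod_mem_smul_top (M := B) (N := B) |>.1 (h n)).2
    exact ⟨(x, y), fun n => (SModEq.sub_mem.2
      ((IsDefLoc.prod_mem_smul_top (M := B) (N := B)).2 ⟨hx n, hy n⟩)).symm⟩

/-- A derivation `δ` along `φ` amounts to the algebra homomorphism `a ↦ φ a + ε δ a` to the dual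
numbers over `B`, which extends to `B` by `exists_lift`. By uniqueness the first component of the
extension is the identity, so the second is a derivation. -/
theorem IsDefLoc.exists_derivation [IsNoetherianRing R] [I.IsMaximal] (h : IsDefLoc I πA πB φ S)
    (δ : A →ₗ[R] B) (hδ : ∀ a a', δ (a * a') = φ a * δ a' + φ a' * δ a) :
    ∃ d : Derivation R B B, ∀ a, d (φ a) = δ a := by
  have := h.right.complete
  have := isAdicComplete_trivSqZeroExt (I := I) (B := B)
  have h1 : δ 1 = 0 := by simpa using hδ 1 1
  let ψ : A →ₐ[R] TrivSqZeroExt B B := AlgHom.ofLinearMap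
    (LinearMap.prod φ.toLinearMap δ : A →ₗ[R] B × B)
    (TrivSqZeroExt.ext (map_one φ) h1) (fun a a' => TrivSqZeroExt.ext (map_mul φ a a') (by
      change δ (a * a') = φ a • δ a' + MulOpposite.op (φ a') • δ a
      rw [hδ, smul_eq_mul, op_smul_eq_smul, smul_eq_mul]))
  obtain ⟨f, hf⟩ := h.exists_lift ψ fun s hs => TrivSqZeroExt.isUnit_iff_isUnit_fst.2 (h.isUnit hs)
  have hfst : ∀ b, (f b).fst = b := fun b => by
    have : (TrivSqZeroExt.fstHom R B B).comp f = AlgHom.id R B :=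
      h.algHom_ext fun a => by
        simp only [AlgHom.comp_apply, hf]
        rfl
    exact DFunLike.congr_fun this b
  refine ⟨Derivation.mk' ((TrivSqZeroExt.sndHom B B).restrictScalars R ∘ₗ f.toLinearMap)
    fun b b' => ?_, fun a => ?_⟩
  · change (f (b * b')).snd = b • (f b').snd + b' • (f b).snd
    rw [map_mul, TrivSqZeroExt.snd_mul, hfst, hfst, op_smul_eq_smul]
  · change (f (φ a)).snd = _
    rw [hf]
    rfl

theorem IsDefLoc.derivation_ext (h : IsDefLoc I πA πB φ S) {d d' : Derivation R B B}
    (hd : ∀ a, d (φ a) = d' (φ a)) : d = d' := by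
  have := h.right.complete
  have := h.linear_eq_zero (d - d' : Derivation R B B).toLinearMap φ (fun s hs => h.isUnit hs)
    (fun s _ b => by
      simp only [Derivation.coeFn_coe, Derivation.leibniz,
        Derivation.sub_apply, smul_eq_mul, hd, sub_self]
      simp) (fun a => by simp [hd])
  ext b
  simpa [sub_eq_zero] using LinearMap.congr_fun this b

/-- A Poisson bracket on a deformation extends to its localizations. -/

theorem IsDefLoc.exists_poissonBracket [IsNoetherianRing R] [I.IsMaximal]
    (h : IsDefLoc I πA πB φ S) (P : PoissonBracket R A) :
    ∃ P' : PoissonBracket R B, ∀ a a', P'.br (φ a) (φ a') = φ (P.br a a') := by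
  have := h.right.complete
  -- `D a` is the derivation `{φ a, ·}` of `B`. The second argument is now general; `E` below makes
  -- the first one general too.
  choose D hD using fun a => h.exists_derivation (φ.toLinearMap ∘ₗ P.br a) fun a' a'' => by
    simp only [LinearMap.comp_apply, AlgHom.toLinearMap_apply, P.leibniz_right, map_add, map_mul]
    ring
  simp only [LinearMap.comp_apply, AlgHom.toLinearMap_apply] at hD
  have Dadd : ∀ a a', D (a + a') = D a + D a' := fun a a' =>
    h.derivation_ext fun x => by simp [hD]
  have Dsmul : ∀ (r : R) a, D (r • a) = r • D a := fun r a =>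
    h.derivation_ext fun x => by simp [hD]
  have Dmul : ∀ a a', D (a * a') = φ a • D a' + φ a' • D a := fun a a' =>
    h.derivation_ext fun x => by
      simp only [hD, P.leibniz_left, map_add, map_mul, Derivation.add_apply, Derivation.smul_apply,
        smul_eq_mul]
      ring
  -- `E b` is the derivation `{·, b}`, which extends `a ↦ D a b`.
  choose E hE using fun b => h.exists_derivation
    { toFun := fun a => D a b
      map_add' := fun a a' => by simp [Dadd]
      map_smul' := fun r a => by simp [Dsmul] } fun a a' => by simp [Dmul]
  simp only [LinearMap.coe_mk, AddHom.coe_mk] at hE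
  have Eadd : ∀ b b', E (b + b') = E b + E b' := fun b b' =>
    h.derivation_ext fun x => by simp [hE]
  have Esmul : ∀ (r : R) b, E (r • b) = r • E b := fun r b =>
    h.derivation_ext fun x => by simp [hE]
  have Emul : ∀ b b', E (b * b') = b • E b' + b' • E b := fun b b' =>
    h.derivation_ext fun x => by simp [hE]
  -- `F b` is `{b, ·}`. Since it is again a derivation, antisymmetry `E b = - F b` may be tested on
  -- `A`.
  let F : B → Derivation R B B := fun b => Derivation.mk'
    { toFun := fun x => E x b
      map_add' := fun a a' => by simp [Eadd]
      map_smul' := fun r a => by simp [Esmul] } fun a a' => by simp [Emul]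
  have hF : ∀ b x, F b x = E x b := fun _ _ => rfl
  have hEφ : ∀ a, E (φ a) = - D a := fun a => h.derivation_ext fun x => by
    rw [hE, hD, P.antisymm, Derivation.neg_apply, hD, map_neg]
  have hEF : ∀ b, E b = - F b := fun b => h.derivation_ext fun a => by
    rw [hE, Derivation.neg_apply, hF, hEφ, Derivation.neg_apply, neg_neg]
  let br : B →ₗ[R] B →ₗ[R] B := LinearMap.mk₂ R (fun x b => E b x) (fun x y b => by simp)
    (fun r x b => by simp) (fun x b b' => by simp [Eadd]) (fun r x b => by simp [Esmul])
  have hbr : ∀ x b, br x b = E b x := fun _ _ => rfl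
  have hbrφ : ∀ a a', br (φ a) (φ a') = φ (P.br a a') := fun a a' => by rw [hbr, hE, hD]
  have anti : ∀ a b, br a b = - br b a := fun a b => by
    rw [hbr, hbr, hEF, Derivation.neg_apply, hF]
  have lr : ∀ a b c, br a (b * c) = br a b * c + b * br a c := fun a b c => by
    simp only [hbr, Emul, Derivation.add_apply, Derivation.smul_apply, smul_eq_mul]
    ring
  have ll : ∀ a b c, br (a * b) c = a * br b c + br a c * b := fun a b c => by
    simp only [hbr, Derivation.leibniz, smul_eq_mul]
    ring
  -- The Jacobiator is a derivation in its last argument and cyclically symmetric, so its vanishing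
  -- on `A` spreads to the three arguments in turn.
  let J : B → B → B →ₗ[R] B := fun b c =>
    br.flip (br b c) + br b ∘ₗ br c + br c ∘ₗ br.flip b
  have hJ : ∀ a b c, J b c a = br a (br b c) + br b (br c a) + br c (br a b) := fun _ _ _ => rfl
  have Jmul : ∀ a a' b c, J b c (a * a') = a * J b c a' + a' * J b c a := fun a a' b c => by
    simp only [hJ, lr, ll, map_add]
    rw [anti a b, anti a' b, map_neg, map_neg]
    ring
  have Jcyc : ∀ a b c, J b c a = J c a b := fun a b c => by
    simp only [hJ]
    abel
  have key : ∀ b c, (∀ a, J b c (φ a) = 0) → ∀ x, J b c x = 0 := fun b c h0 x => by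
    have := h.linear_eq_zero (J b c) φ (fun s hs => h.isUnit hs)
      (fun s _ b => by simp [Jmul, h0]) h0
    rw [this, LinearMap.zero_apply]
  have J1 : ∀ a b x, J (φ a) (φ b) x = 0 := fun a b => key _ _ fun c => by
    simp only [hJ, hbrφ]
    rw [← map_add, ← map_add, P.jacobi, map_zero]
  have J2 : ∀ a b x, J (φ a) b x = 0 := fun a b => key _ _ fun c => by
    rw [← Jcyc, ← J1 c a b]
  have J3 : ∀ a b x, J a b x = 0 := fun a b => key _ _ fun c => by
    rw [Jcyc, Jcyc, ← J2 c a b, Jcyc, Jcyc, Jcyc]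
  exact ⟨⟨br, anti, fun a b c => by rw [← hJ, J3], lr, ll⟩, hbrφ⟩

end Poisson

end Deformation

end

noncomputable section

namespace Deformation

/-! ### The generic localization of a deformation -/

section Generic

variable {R : Type u} [CommRing R] {I : Ideal R} {A C : Type u} [Ring A] [Algebra R A] [CommRing C]
  [Algebra R C] {π : A →ₐ[R] C}

variable (I A) in

/-- The two-sided ideal `I ^ n A` of `A`. -/
def powIdeal (n : ℕ) : Ideal A where
  carrier := (I ^ n • ⊤ : Submodule R A)
  add_mem' := add_mem
  zero_mem' := zero_mem _
  smul_mem' a _ hx := mul_mem_smul_top_left a hx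

instance (n : ℕ) : (powIdeal I A n).IsTwoSided := ⟨fun b hx => mul_mem_smul_top_right b hx⟩

/-- Multiplication by `s` is injective on the domain `C`, that is, modulo `I`; by flatness it then
reflects the whole filtration. So `s` is regular in every `A / I ^ n A`. -/
theorem mul_mem_smul_top_cancel [IsNoetherianRing R] [I.IsMaximal] [IsDomain C]
    (hA : IsDefMod I π.toLinearMap) {n : ℕ} {x s : A} (hs : π s ≠ 0)
    (h : x * s ∈ (I ^ n • ⊤ : Submodule R A)) : x ∈ (I ^ n • ⊤ : Submodule R A) := by
  have := hA.flat
  refine reflects_smul_top (LinearMap.mulRight R s) (fun x hx => ?_) h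
  rw [← hA.ker] at hx ⊢
  simpa [hs] using hx

theorem mul_mem_smul_top_cancel_left [IsNoetherianRing R] [I.IsMaximal] [IsDomain C]
    (hA : IsDefMod I π.toLinearMap) {n : ℕ} {x s : A} (hs : π s ≠ 0)
    (h : s * x ∈ (I ^ n • ⊤ : Submodule R A)) : x ∈ (I ^ n • ⊤ : Submodule R A) := by
  have := hA.flat
  refine reflects_smul_top (LinearMap.mulLeft R s) (fun x hx => ?_) h
  rw [← hA.ker] at hx ⊢
  simpa [hs] using hx

variable (π) in

/-- The elements of `A` that are non-zero in `C`. -/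
abbrev genericSubmonoid [IsDomain C] : Submonoid A := (nonZeroDivisors C).comap π

theorem mem_genericSubmonoid [IsDomain C] {s : A} : s ∈ genericSubmonoid π ↔ π s ≠ 0 := by
  simp [genericSubmonoid]

/-- The ring of fractions of `A / I ^ n A`. -/

theorem exists_fractions_mod_pow [IsNoetherianRing R] [I.IsMaximal] [IsDomain C]
    (hA : IsDefMod I π.toLinearMap) {L : Type u} [CommRing L] [Algebra R L] (ψ : A →ₐ[R] L)
    (hψ : ∀ s, π s ≠ 0 → IsUnit (ψ s)) (n : ℕ) :
    ∃ (Q : AlgCat.{u} R) (f : A →ₐ[R] Q), (∀ a, f a = 0 ↔ a ∈ (I ^ n • ⊤ : Submodule R A)) ∧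
      (∀ s, π s ≠ 0 → IsUnit (f s)) ∧ (∀ q, ∃ s, π s ≠ 0 ∧ ∃ a, f s * q = f a) ∧
      ((∀ a ∈ (I ^ n • ⊤ : Submodule R A), ψ a = 0) → ∃ g : Q →ₐ[R] L, ∀ a, g (f a) = ψ a) := by
  let q : A →ₐ[R] A ⧸ powIdeal I A n := Ideal.Quotient.mkₐ R (powIdeal I A n)
  have hq : ∀ a, q a = 0 ↔ a ∈ (I ^ n • ⊤ : Submodule R A) := fun a =>
    Ideal.Quotient.eq_zero_iff_mem
  have hqs : Function.Surjective q := Ideal.Quotient.mkₐ_surjective R _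
  let S : Submonoid (A ⧸ powIdeal I A n) := (genericSubmonoid π).map q
  have hS : ∀ {s}, π s ≠ 0 → q s ∈ S := fun hs => ⟨_, mem_genericSubmonoid.2 hs, rfl⟩
  -- Denominators are regular, so cancellation needs no extra factor; the left Ore condition modulo
  -- `I ^ n` holds with the denominator `s ^ n`.
  have ore : Nonempty (OreLocalization.OreSet S) := by
    rw [OreLocalization.nonempty_oreSet_iff]
    constructor
    · rintro x y ⟨_, ⟨s, hs, rfl⟩⟩ h
      refine ⟨1, ?_⟩
      obtain ⟨x, rfl⟩ := hqs x
      obtain ⟨y, rfl⟩ := hqs y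
      have hs' : π s ≠ 0 := mem_genericSubmonoid.1 hs
      simp only at h
      rw [← sub_eq_zero, ← sub_mul, ← map_sub, ← map_mul, hq] at h
      have := mul_mem_smul_top_cancel hA hs' h
      rw [← hq, map_sub, sub_eq_zero] at this
      rw [this]
    · rintro x ⟨_, ⟨s, hs, rfl⟩⟩
      obtain ⟨x, rfl⟩ := hqs x
      obtain ⟨y, hy⟩ := hA.isCommMod.exists_ore s x n
      refine ⟨q y, ⟨q (s ^ n), s ^ n, Submonoid.pow_mem _ hs n, rfl⟩, ?_⟩
      rw [← hq, map_sub, sub_eq_zero, map_mul, map_mul] at hy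
      exact hy
  obtain ⟨_⟩ := ore
  let ν : (A ⧸ powIdeal I A n) →ₐ[R] OreLocalization S (A ⧸ powIdeal I A n) :=
    { OreLocalization.numeratorRingHom with commutes' := fun _ => rfl }
  have hν : ∀ x, ν x = OreLocalization.numeratorHom x := fun _ => rfl
  have hinj : Function.Injective ν := OreLocalization.numeratorHom_inj (by
    rintro _ ⟨s, hs, rfl⟩ x hx
    obtain ⟨x, rfl⟩ := hqs x
    rw [← map_mul q, hq] at hx
    exact (hq x).2 (mul_mem_smul_top_cancel_left hA (mem_genericSubmonoid.1 hs) hx))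
  refine ⟨AlgCat.of R (OreLocalization S (A ⧸ powIdeal I A n)), ν.comp q, fun a => ?_,
    fun s hs => ?_, fun x => ?_, fun h0 => ?_⟩
  · rw [← hq]
    exact map_eq_zero_iff ν hinj
  · exact OreLocalization.numerator_isUnit ⟨q s, hS hs⟩
  · induction x using OreLocalization.ind with
    | _ r s =>
      obtain ⟨_, ⟨s, hs, rfl⟩⟩ := s
      obtain ⟨r, rfl⟩ := hqs r
      refine ⟨s, mem_genericSubmonoid.1 hs, r, ?_⟩
      change OreLocalization.numeratorHom _ * _ = OreLocalization.numeratorHom _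
      rw [OreLocalization.numeratorHom_apply, OreLocalization.numeratorHom_apply]
      exact OreLocalization.mul_cancel (s := ⟨q s, hS (mem_genericSubmonoid.1 hs)⟩)
  · let ψ' : (A ⧸ powIdeal I A n) →ₐ[R] L := Ideal.Quotient.liftₐ _ ψ h0
    have hψ' : ∀ a, ψ' (q a) = ψ a := fun a => rfl
    have hu : ∀ s : S, IsUnit (ψ' s) := by
      rintro ⟨_, ⟨s, hs, rfl⟩⟩
      exact hψ s (mem_genericSubmonoid.1 hs)
    let fS : S →* Lˣ := IsUnit.liftRight (ψ'.toMonoidHom.comp S.subtype) hu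
    let g := OreLocalization.universalHom (ψ' : (A ⧸ powIdeal I A n) →+* L) fS
      (fun s => (IsUnit.coe_liftRight (ψ'.toMonoidHom.comp S.subtype) hu s).symm)
    have hg : ∀ x, g (ν x) = ψ' x := fun x => OreLocalization.universalHom_commutes _ _ _
    refine ⟨{ g with commutes' := fun r => ?_ }, fun a => hg (q a)⟩
    change g (ν (algebraMap R _ r)) = _
    rw [hg, AlgHom.commutes]

/-- A deformation of an integral domain has a localization that is a deformation of the fraction
field. -/
theorem exists_generic_localization [IsNoetherianRing R] [I.IsMaximal] [IsAdicComplete I R]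
    [IsDomain C] (hA : IsDefMod I π.toLinearMap) {L : Type u} [CommRing L] [Algebra R L]
    (ι : C →ₐ[R] L) (hι : Function.Injective ι) (hunit : ∀ c ≠ 0, IsUnit (ι c))
    (hfrac : ∀ x, ∃ s ≠ 0, ∃ c, ι s * x = ι c) :
    ∃ (Q : AlgCat.{u} R) (πQ : Q →ₐ[R] L) (φ : A →ₐ[R] Q), (∀ a, πQ (φ a) = ι (π a)) ∧
      IsDefLoc I π πQ φ (genericSubmonoid π) := by
  have hflat := hA.flat
  choose Q f hf hunitf hfracf hg using exists_fractions_mod_pow hA (ι.comp π)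
    fun s hs => hunit _ hs
  obtain ⟨g, hg⟩ := hg 1 fun a ha => by
    rw [pow_one, ← hA.ker] at ha
    rw [AlgHom.comp_apply, ← AlgHom.toLinearMap_apply π, ha, map_zero]
  have key : ∀ (n : ℕ) {s t : A}, π s ≠ 0 → π t ≠ 0 → ∃ u v, π u ≠ 0 ∧
      (∀ m ≤ n, f m u * f m s = f m v * f m t) := by
    intro n s t hs ht
    obtain ⟨v, hv⟩ := hA.isCommMod.exists_ore t s n
    refine ⟨t ^ n, v, by simp [ht], fun m hm => ?_⟩
    rw [← sub_eq_zero, ← map_mul, ← map_mul, ← map_sub, hf]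
    exact smul_top_anti hm hv
  -- This plays the role of the inverse limit of the `Q n`, without transition homomorphisms: up to
  -- each level `n`, a single fraction represents all components.
  let P : Subalgebra R (∀ n, Q n) :=
    { carrier := {x | ∀ n, ∃ s, π s ≠ 0 ∧ ∃ a, ∀ m ≤ n, f m s * x m = f m a}
      algebraMap_mem' := fun r n => ⟨1, by simp, algebraMap R A r, fun m _ => by simp⟩
      mul_mem' := by
        intro x y hx hy n
        obtain ⟨s, hs, a, ha⟩ := hx n
        obtain ⟨t, ht, b, hb⟩ := hy n
        obtain ⟨v, hv⟩ := hA.isCommMod.exists_ore t a n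
        refine ⟨t ^ n * s, by simp [hs, ht], v * b, fun m hm => ?_⟩
        have h1 : f m (t ^ n) * f m a = f m v * f m t := by
          rw [← sub_eq_zero, ← map_mul, ← map_mul, ← map_sub, hf]
          exact smul_top_anti hm hv
        rw [Pi.mul_apply, map_mul, mul_assoc, ← mul_assoc (f m s), ha m hm, ← mul_assoc, h1,
          mul_assoc, hb m hm, map_mul]
      add_mem' := by
        intro x y hx hy n
        obtain ⟨s, hs, a, ha⟩ := hx n
        obtain ⟨t, ht, b, hb⟩ := hy n
        obtain ⟨v, hv⟩ := hA.isCommMod.exists_ore t s n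
        refine ⟨t ^ n * s, by simp [hs, ht], t ^ n * a + v * b, fun m hm => ?_⟩
        have h1 : f m (t ^ n) * f m s = f m v * f m t := by
          rw [← sub_eq_zero, ← map_mul, ← map_mul, ← map_sub, hf]
          exact smul_top_anti hm hv
        rw [Pi.add_apply, mul_add, map_mul]
        nth_rw 2 [h1]
        rw [mul_assoc, ha m hm, mul_assoc, hb m hm, map_add, map_mul, map_mul] }
  have hP : ∀ (x : P) n, ∃ s, π s ≠ 0 ∧ ∃ a, ∀ m ≤ n, f m s * x.1 m = f m a := fun x => x.2
  have hdiv : ∀ s, π s ≠ 0 → ∀ a, ∃ x : P, ∀ m, f m s * x.1 m = f m a := fun s hs a =>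
    ⟨⟨fun m => ↑(hunitf m s hs).unit⁻¹ * f m a, fun n => ⟨s, hs, a, fun m _ => by
      rw [← mul_assoc, IsUnit.mul_val_inv, one_mul]⟩⟩, fun m => by
      rw [← mul_assoc, IsUnit.mul_val_inv, one_mul]⟩
  have hcommon : ∀ (n : ℕ) {r : ℕ} (x : Fin r → P), ∃ s, π s ≠ 0 ∧ ∃ a : Fin r → A,
      ∀ k, ∀ m ≤ n, f m s * (x k).1 m = f m (a k) := by
    intro n r
    induction r with
    | zero => exact fun x => ⟨1, by simp, Fin.elim0, fun k => k.elim0⟩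
    | succ r ih =>
      intro x
      obtain ⟨s, hs, a, ha⟩ := ih (fun k => x k.succ)
      obtain ⟨t, ht, b, hb⟩ := hP (x 0) n
      obtain ⟨u, v, hu, huv⟩ := key n ht hs
      refine ⟨u * t, by simp [hu, ht], Fin.cons (u * b) fun k => v * a k, fun k m hm => ?_⟩
      refine Fin.cases ?_ (fun k => ?_) k
      · rw [map_mul, mul_assoc, hb m hm, Fin.cons_zero, map_mul]
      · rw [map_mul, huv m hm, mul_assoc, ha k m hm, Fin.cons_succ, map_mul]
  let ev : ∀ n, P →ₐ[R] Q n := fun n => (Pi.evalAlgHom R (fun n => Q n) n).comp P.val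
  have hev : ∀ n x, ev n x = x.1 n := fun _ _ => rfl
  let φ : A →ₐ[R] P := (AlgHom.pi f).codRestrict P
    fun a n => ⟨1, by simp, a, fun m _ => by simp⟩
  have hφ : ∀ n a, ev n (φ a) = f n a := fun _ _ => rfl
  have hcancel : ∀ {n s} {x y : Q n}, π s ≠ 0 → f n s * x = f n s * y → x = y :=
    fun hs h => (hunitf _ _ hs).mul_left_cancel h
  -- Vanishing at level `n` means that the numerator lies in `I ^ n A`, so the components at lower
  -- levels vanish as well.
  have hle : ∀ {n x}, ev n x = 0 → ∀ m ≤ n, ev m x = 0 := by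
    intro n x hx m hm
    obtain ⟨s, hs, a, ha⟩ := hP x n
    have h1 := ha n le_rfl
    rw [← hev, hx, mul_zero, eq_comm, hf] at h1
    refine hcancel hs ?_
    rw [hev, ha m hm, mul_zero, hf]
    exact smul_top_anti hm h1
  let W : ℕ → Submodule R P := fun n => LinearMap.ker (ev n).toLinearMap
  have hWmem : ∀ {n x}, x ∈ W n ↔ ev n x = 0 := Iff.rfl
  have hW : IsCompleteFiltration I W := by
    refine ⟨fun x hx => Subtype.ext (funext hx), fun F hF => ?_, fun n => ?_,
      fun n x hx => hle hx n (Nat.le_succ n), fun n x hx => ?_⟩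
    · have hanti : ∀ m k, ev m (F (m + k)) = ev m (F m) := by
        intro m k
        induction k with
        | zero => rfl
        | succ k ih =>
          have := hle (hF (m + k)) m (Nat.le_add_right m k)
          rw [map_sub, sub_eq_zero] at this
          rw [← ih, ← this]
          rfl
      have hanti' : ∀ m n, m ≤ n → ev m (F n) = ev m (F m) := fun m n h => by
        obtain ⟨k, rfl⟩ := Nat.exists_eq_add_of_le h
        exact hanti m k
      refine ⟨⟨fun n => ev n (F n), fun n => ?_⟩, fun n => ?_⟩
      · obtain ⟨s, hs, a, ha⟩ := hP (F n) n
        exact ⟨s, hs, a, fun m hm => by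
          change f m s * ev m (F m) = _
          rw [← hanti' m n hm, hev, ha m hm]⟩
      · rw [hWmem, map_sub, sub_eq_zero]
        rfl
    · refine Submodule.smul_le.2 fun r hr x _ => ?_
      obtain ⟨s, hs, a, ha⟩ := hP x n
      refine hcancel hs ?_
      change f n s * ev n (r • x) = _
      rw [map_smul, mul_smul_comm, hev, ha n le_rfl, mul_zero, ← map_smul, hf]
      exact Submodule.smul_mem_smul hr Submodule.mem_top
    · obtain ⟨r, e, he⟩ := exists_isGrBasis I n
      obtain ⟨s, hs, a, ha⟩ := hP x (n + 1)
      have h1 := ha n (Nat.le_succ n)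
      rw [← hev, hWmem.1 hx, mul_zero, eq_comm, hf] at h1
      obtain ⟨y, hy⟩ := he.exists_sum h1
      choose β hβ using fun k => hdiv s hs (y k)
      rw [Submodule.mem_sup]
      refine ⟨∑ k, e k • β k, by simpa using he.sum_mem (y := β) 0 (by simp),
        x - ∑ k, e k • β k, ?_, by simp⟩
      rw [hWmem]
      refine hcancel hs ?_
      have hβ' : ∀ k, f (n + 1) s * ev (n + 1) (β k) = f (n + 1) (y k) := fun k => hβ k _
      rw [map_sub, map_sum, mul_sub, Finset.mul_sum, hev _ x, ha _ le_rfl, mul_zero]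
      simp only [map_smul, mul_smul_comm, hβ']
      rw [← hf, map_sub, map_sum] at hy
      simpa only [map_smul] using hy
  have hWeq := hW.eq_smul_top
  have hcomplete := hW.isAdicComplete
  -- With a common denominator, the statement becomes one about the numerators, where flatness of
  -- `A` gives it.
  have hcoeff : ∀ (n r : ℕ) (e : Fin r → R), IsGrBasis I n e → ∀ x : Fin r → P,
      ∑ k, e k • x k ∈ (I ^ (n + 1) • ⊤ : Submodule R P) →
        ∀ k, x k ∈ (I • ⊤ : Submodule R P) := by
    intro n r e he x hx k
    rw [← pow_one I, ← hWeq, hWmem]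
    rw [← hWeq, hWmem] at hx
    obtain ⟨s, hs, a, ha⟩ := hcommon (n + 1) x
    have h1 : ∑ k, e k • a k ∈ (I ^ (n + 1) • ⊤ : Submodule R A) := by
      rw [← hf, map_sum]
      have ha' : ∀ k, f (n + 1) s * ev (n + 1) (x k) = f (n + 1) (a k) :=
        fun k => ha k _ le_rfl
      have := congrArg (f (n + 1) s * ·) hx
      simp only [map_sum, Finset.mul_sum, map_smul, mul_smul_comm, mul_zero, ha'] at this
      simpa only [map_smul] using this
    have h2 := he.coeff_mem h1 k
    refine hcancel hs ?_
    rw [hev, ha k 1 (by omega), mul_zero, hf, pow_one]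
    exact h2
  -- `Q 1` embeds in `L`, so the kernel of the augmentation of `P` is `W 1`, which is `I P`.
  have hπinj : ∀ x, g x = 0 → x = 0 := by
    intro x hx
    obtain ⟨s, hs, a, ha⟩ := hfracf 1 x
    have h1 := congrArg g ha
    rw [map_mul, hx, mul_zero, hg, AlgHom.comp_apply, eq_comm, map_eq_zero_iff ι hι] at h1
    refine hcancel hs ?_
    rw [ha, mul_zero, hf, pow_one, ← hA.ker]
    exact h1
  refine ⟨AlgCat.of R P, g.comp (ev 1), φ, fun a => ?_, hA,
    ⟨flat_of_coeff_mem hcoeff, hcomplete, fun x => ?_, fun x => ?_⟩, fun a ha => ?_,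
    fun s hs => ?_, fun x => ?_⟩
  · change g (ev 1 (φ a)) = _
    rw [hφ, hg]
    rfl
  · obtain ⟨s, hs, c, hc⟩ := hfrac x
    obtain ⟨s, rfl⟩ := hA.surj s
    obtain ⟨a, rfl⟩ := hA.surj c
    obtain ⟨y, hy⟩ := hdiv s hs a
    refine ⟨y, (hunit _ hs).mul_left_cancel (Eq.trans ?_ hc.symm)⟩
    have := congrArg g (hy 1)
    rwa [map_mul, hg, hg] at this
  · change g (ev 1 x) = 0 ↔ _
    rw [← pow_one I, ← hWeq, hWmem]
    exact ⟨hπinj _, fun h => by rw [h, map_zero]⟩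
  · change g (ev 1 (φ a)) = 0 at ha
    rw [hφ, hg, AlgHom.comp_apply, map_eq_zero_iff ι hι] at ha
    exact ha
  · change IsUnit (g (ev 1 (φ s)))
    rw [hφ, hg]
    exact hunit _ (mem_genericSubmonoid.1 hs)
  · obtain ⟨s, hs, c, hc⟩ := hfrac x
    obtain ⟨s, rfl⟩ := hA.surj s
    obtain ⟨a, rfl⟩ := hA.surj c
    refine ⟨s, mem_genericSubmonoid.2 hs, a, ?_⟩
    change g (ev 1 (φ s)) * x = g (ev 1 (φ a))
    rw [hφ, hφ, hg, hg]
    exact hc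

end Generic

end Deformation

end

noncomputable section
namespace Deformation

/-- Applied with `f : m ↦ 1 ⊗ m` from `M` to `K ⊗ M`, this reads off from `M → N` whether `K ⊗ M →
N` is an isomorphism. -/
theorem bijective_iff_of_factorization {M T N : Type*} [AddCommGroup M] [AddCommGroup T]
    [AddCommGroup N] (f : M →+ T) (g : T →+ N) (h : M →+ N) (hf : Function.Surjective f)
    (hgf : ∀ m, g (f m) = h m) {S : M → Prop} (hS : ∀ m, f m = 0 ↔ S m) :
    Function.Bijective g ↔ Function.Surjective h ∧ ∀ m, h m = 0 ↔ S m := by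
  constructor
  · refine fun hg => ⟨fun n => ?_, fun m => ?_⟩
    · obtain ⟨t, rfl⟩ := hg.2 n
      obtain ⟨m, rfl⟩ := hf t
      exact ⟨m, (hgf m).symm⟩
    · rw [← hgf, ← hS, map_eq_zero_iff g hg.1]
  · rintro ⟨hs, hk⟩
    refine ⟨(injective_iff_map_eq_zero g).2 fun t ht => ?_, fun n => ?_⟩
    · obtain ⟨m, rfl⟩ := hf t
      rwa [hS, ← hk, ← hgf]
    · obtain ⟨m, rfl⟩ := hs n
      exact ⟨f m, hgf m⟩

/-! ### Tensoring with a cyclic module -/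

section Tensor

variable {R : Type*} [CommRing R] {N M : Type*} [AddCommGroup N] [Module R N] [AddCommGroup M]
  [Module R M] {n₀ : N} {J : Ideal R}

open scoped TensorProduct

theorem exists_one_tmul (hs : ∀ n : N, ∃ r : R, n = r • n₀) (t : N ⊗[R] M) :
    ∃ m : M, t = n₀ ⊗ₜ[R] m := by
  induction t with
  | zero => exact ⟨0, by simp⟩
  | tmul n m =>
    obtain ⟨r, rfl⟩ := hs n
    exact ⟨r • m, by rw [TensorProduct.smul_tmul]⟩
  | add x y hx hy =>
    obtain ⟨m, rfl⟩ := hx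
    obtain ⟨m', rfl⟩ := hy
    exact ⟨m + m', by rw [TensorProduct.tmul_add]⟩

/-- `N` is cyclic with annihilator `J`, so `N ⊗ M` is `M / J M`. It is used both for `N = R ⧸ I ^ (i
+ 1)` and for `N = K`. -/
theorem one_tmul_eq_zero_iff (hs : ∀ n : N, ∃ r : R, n = r • n₀)
    (hJ : ∀ r : R, r • n₀ = 0 ↔ r ∈ J) (m : M) :
    n₀ ⊗ₜ[R] m = 0 ↔ m ∈ (J • ⊤ : Submodule R M) := by
  have hk : LinearMap.ker (LinearMap.toSpanSingleton R N n₀) = J := by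
    ext r; simpa using hJ r
  have hsurj : Function.Surjective (LinearMap.toSpanSingleton R N n₀) := fun n => by
    obtain ⟨r, rfl⟩ := hs n
    exact ⟨r, rfl⟩
  let e : (R ⧸ J) ≃ₗ[R] N :=
    (Submodule.quotEquivOfEq _ _ hk.symm).trans (LinearMap.quotKerEquivOfSurjective _ hsurj)
  have he : n₀ = e (Ideal.Quotient.mk J 1) := by
    change n₀ = LinearMap.toSpanSingleton R N n₀ 1
    simp
  have h1 : n₀ ⊗ₜ[R] m = (e.rTensor M) (Ideal.Quotient.mk J 1 ⊗ₜ[R] m) := by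
    rw [he]; rfl
  rw [h1, LinearEquiv.map_eq_zero_iff,
    ← LinearEquiv.map_eq_zero_iff (TensorProduct.quotTensorEquivQuotSMul M J),
    TensorProduct.quotTensorEquivQuotSMul_mk_tmul, one_smul]
  exact Submodule.Quotient.mk_eq_zero _

end Tensor

/-! ### Tensoring with the residue field -/

section Modules

variable {K R : Type u} [Field K] [CommRing R] [Algebra K R] [IsParameterAlgebra K R]

theorem augmentation_surjective : Function.Surjective (augmentation K R) := by
  have : IsLocalRing R := IsParameterAlgebra.isLocalRing K
  unfold augmentation
  simp only [RingHom.coe_comp]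
  exact (RingEquiv.surjective _).comp (IsLocalRing.residue_surjective)

theorem augmentation_eq_zero_iff (r : R) : augmentation K R r = 0 ↔ r ∈ paramIdeal K R := by
  have : IsLocalRing R := IsParameterAlgebra.isLocalRing K
  unfold augmentation
  simp only [RingHom.coe_comp, Function.comp_apply]
  rw [← IsLocalRing.residue_eq_zero_iff]
  exact (RingEquiv.map_eq_zero_iff (RingEquiv.ofBijective (algebraMap K (IsLocalRing.ResidueField R))
    IsParameterAlgebra.residue_bijective).symm)

theorem exists_one_tmul_extendScalars (M : ModuleCat.{u} R)
    (t : (ModuleCat.extendScalars (augmentation K R)).obj M) :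
    ∃ m : M, t = ((ModuleCat.extendRestrictScalarsAdj (augmentation K R)).unit.app M).hom m := by
  let _ : Module R K := Module.compHom K (augmentation K R)
  exact exists_one_tmul (R := R) (N := K) (M := M) (n₀ := 1) (fun k => by
    obtain ⟨r, rfl⟩ := augmentation_surjective (K := K) (R := R) k
    exact ⟨r, (mul_one _).symm⟩) t

theorem unit_extendScalars_eq_zero_iff (M : ModuleCat.{u} R) (m : M) :
    ((ModuleCat.extendRestrictScalarsAdj (augmentation K R)).unit.app M).hom m = 0 ↔
      m ∈ (paramIdeal K R • ⊤ : Submodule R M) := by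
  let _ : Module R K := Module.compHom K (augmentation K R)
  exact one_tmul_eq_zero_iff (R := R) (N := K) (M := M) (n₀ := 1) (fun k => by
    obtain ⟨r, rfl⟩ := augmentation_surjective (K := K) (R := R) k
    exact ⟨r, (mul_one _).symm⟩) (fun r => by
      rw [← augmentation_eq_zero_iff]
      exact iff_of_eq (congrArg (· = 0) (mul_one _))) m

variable {M : ModuleCat.{u} R} {N : ModuleCat.{u} K}
    (φ : M ⟶ (ModuleCat.restrictScalars (augmentation K R)).obj N)

theorem unit_inducedHom (m : M) :
    (inducedHom R φ).hom
      (((ModuleCat.extendRestrictScalarsAdj (augmentation K R)).unit.app M).hom m) = φ.hom m := by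
  have := (ModuleCat.extendRestrictScalarsAdj (augmentation K R)).homEquiv_unit M N (inducedHom R φ)
  unfold inducedHom at this ⊢
  rw [Equiv.apply_symm_apply] at this
  exact (congrArg (fun g => g.hom m) this).symm

theorem isDeformationModule_iff :
    IsDeformationModule R φ ↔ IsDefMod (paramIdeal K R) φ.hom := by
  have key : IsIso (inducedHom R φ) ↔ Function.Surjective φ.hom ∧
      ∀ x, φ.hom x = 0 ↔ x ∈ (paramIdeal K R • ⊤ : Submodule R M) := by
    rw [ConcreteCategory.isIso_iff_bijective]
    let f : M →+ (ModuleCat.extendScalars (augmentation K R)).obj M :=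
      ((ModuleCat.extendRestrictScalarsAdj (augmentation K R)).unit.app M).hom.toAddMonoidHom
    let g : (ModuleCat.extendScalars (augmentation K R)).obj M →+ N :=
      (inducedHom R φ).hom.toAddMonoidHom
    let h : M →+ N := φ.hom.toAddMonoidHom
    have hf : Function.Surjective f := fun t => by
      obtain ⟨m, hm⟩ := exists_one_tmul_extendScalars M t
      exact ⟨m, hm.symm⟩
    have hgf : ∀ m, g (f m) = h m := fun m => unit_inducedHom φ m
    have h0 : ∀ m, f m = 0 ↔ m ∈ (paramIdeal K R • ⊤ : Submodule R M) := fun m =>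
      unit_extendScalars_eq_zero_iff M m
    exact bijective_iff_of_factorization f g h hf hgf h0
  exact ⟨fun h => ⟨h.flat, h.complete, (key.1 h.isIso).1, (key.1 h.isIso).2⟩,
    fun h => ⟨h.flat, h.complete, key.2 ⟨h.surj, h.ker⟩⟩⟩

end Modules

/-! ### Sheaves of modules -/

section Presheaf

variable {R : Type u} [CommRing R] {X : TopCat.{u}}

/-- The restriction of sections of a presheaf of modules. -/
def res (F : TopCat.Presheaf (ModuleCat.{u} R) X) {U V : Opens X} (h : V ≤ U) :
    F.obj (op U) →ₗ[R] F.obj (op V) :=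
  (F.map (homOfLE h).op).hom

variable {F G : TopCat.Presheaf (ModuleCat.{u} R) X} {U V W : Opens X}

@[simp]

theorem res_res (h : V ≤ U) (h' : W ≤ V) (a : F.obj (op U)) :
    res F h' (res F h a) = res F (h'.trans h) a := by
  unfold res
  rw [← LinearMap.comp_apply, ← ModuleCat.hom_comp, ← F.map_comp]
  rfl

@[simp]

theorem res_self (h : U ≤ U) (a : F.obj (op U)) : res F h a = a := by
  have : F.map (homOfLE h).op = 𝟙 _ := F.map_id (op U)
  unfold res
  rw [this]
  rfl

theorem app_res (f : F ⟶ G) (h : V ≤ U) (a : F.obj (op U)) :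
    (f.app (op V)).hom (res F h a) = res G h ((f.app (op U)).hom a) :=
  congrArg (fun g => g.hom a) (f.naturality (homOfLE h).op)

theorem section_ext (hF : TopCat.Presheaf.IsSheaf F) {a b : F.obj (op U)}
    (h : ∀ x ∈ U, ∃ (V : Opens X) (hV : V ≤ U), x ∈ V ∧ res F hV a = res F hV b) : a = b := by
  choose V hV hx hab using fun x : U => h x x.2
  exact TopCat.Sheaf.eq_of_locally_eq' ⟨F, hF⟩ V U (fun x => homOfLE (hV x))
    (fun x hxU => Opens.mem_iSup.2 ⟨⟨x, hxU⟩, hx ⟨x, hxU⟩⟩) a b hab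

theorem exists_glue (hF : TopCat.Presheaf.IsSheaf F) {ι : Type*} (V : ι → Opens X)
    (hV : ∀ i, V i ≤ U) (hcov : ∀ x ∈ U, ∃ i, x ∈ V i) (s : ∀ i, F.obj (op (V i)))
    (hs : ∀ i j, res F (inf_le_left : V i ⊓ V j ≤ V i) (s i) =
      res F (inf_le_right : V i ⊓ V j ≤ V j) (s j)) :
    ∃ a : F.obj (op U), ∀ i, res F (hV i) a = s i := by
  obtain ⟨a, ha, -⟩ := TopCat.Sheaf.existsUnique_gluing' ⟨F, hF⟩ V U (fun i => homOfLE (hV i))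
    (fun x hx => Opens.mem_iSup.2 (hcov x hx)) s hs
  exact ⟨a, ha⟩

/-- Gluing of sections that are only determined locally, by a property that is compatible
with restriction and determines a section uniquely. -/
theorem exists_glue_of_unique (hF : TopCat.Presheaf.IsSheaf F)
    (P : ∀ V : Opens X, V ≤ U → F.obj (op V) → Prop)
    (hres : ∀ {V W : Opens X} (hV : V ≤ U) (h : W ≤ V) (a : F.obj (op V)), P V hV a →
      P W (h.trans hV) (res F h a))
    (huniq : ∀ {V : Opens X} (hV : V ≤ U) (a b : F.obj (op V)), P V hV a → P V hV b → a = b)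
    (hex : ∀ x ∈ U, ∃ (V : Opens X) (hV : V ≤ U), x ∈ V ∧ ∃ a, P V hV a) :
    ∃ a : F.obj (op U), ∀ (V : Opens X) (hV : V ≤ U) (b), P V hV b → res F hV a = b := by
  choose V hV hx s hs using fun x : U => hex x x.2
  obtain ⟨a, ha⟩ := exists_glue hF V hV (fun x hxU => ⟨⟨x, hxU⟩, hx ⟨x, hxU⟩⟩) s fun i j =>
    huniq (inf_le_left.trans (hV i)) _ _ (hres (hV i) _ _ (hs i)) (hres (hV j) _ _ (hs j))
  refine ⟨a, fun W hW b hb => section_ext hF fun x hx' => ⟨V ⟨x, hW hx'⟩ ⊓ W, inf_le_right,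
    ⟨hx _, hx'⟩, huniq (inf_le_right.trans hW) _ _ ?_ (hres hW _ _ hb)⟩⟩
  rw [res_res, ← res_res (hV ⟨x, hW hx'⟩) inf_le_left, ha]
  exact hres (hV _) _ _ (hs _)

theorem toSheafify_locally_surjective (t : (sheafify (Opens.grothendieckTopology X) F).obj (op U))
    {x : X} (hx : x ∈ U) : ∃ (V : Opens X) (h : V ≤ U), x ∈ V ∧ ∃ s : F.obj (op V),
      ((toSheafify (Opens.grothendieckTopology X) F).app (op V)).hom s = res _ h t := by
  obtain ⟨V, f, ⟨s, hs⟩, hxV⟩ := Presheaf.imageSieve_mem (Opens.grothendieckTopology X)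
    (toSheafify (Opens.grothendieckTopology X) F) t x hx
  exact ⟨V, f.le, hxV, s, hs⟩

theorem toSheafify_locally_injective {s : F.obj (op U)}
    (h : ((toSheafify (Opens.grothendieckTopology X) F).app (op U)).hom s = 0)
    {x : X} (hx : x ∈ U) : ∃ (V : Opens X) (h : V ≤ U), x ∈ V ∧ res F h s = 0 := by
  obtain ⟨V, f, hf, hxV⟩ := Presheaf.equalizerSieve_mem (Opens.grothendieckTopology X)
    (toSheafify (Opens.grothendieckTopology X) F) s 0 (h.trans (map_zero _).symm) x hx
  exact ⟨V, f.le, hxV, hf.trans (map_zero _)⟩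

end Presheaf

end Deformation
end

noncomputable section
namespace Deformation

/-! ### The local adic filtration and truncations of a sheaf -/

section Sheaves

variable {R : Type u} [CommRing R] {X : TopCat.{u}} (I : Ideal R)
  (F : TopCat.Presheaf (ModuleCat.{u} R) X)

/-- The sections of `F` that are locally in `I ^ n F`. -/
def locPow (n : ℕ) (U : Opens X) : Submodule R (F.obj (op U)) where
  carrier := {a | ∀ x ∈ U, ∃ (V : Opens X) (h : V ≤ U), x ∈ V ∧
    res F h a ∈ (I ^ n • ⊤ : Submodule R (F.obj (op V)))}
  zero_mem' := fun x hx => ⟨U, le_rfl, hx, by simp⟩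
  add_mem' := fun {a b} ha hb x hx => by
    obtain ⟨V, hV, hxV, ha⟩ := ha x hx
    obtain ⟨W, hW, hxW, hb⟩ := hb x hx
    refine ⟨V ⊓ W, inf_le_left.trans hV, ⟨hxV, hxW⟩, ?_⟩
    rw [map_add]
    have ha' := map_mem_smul_top (res F (inf_le_left : V ⊓ W ≤ V)) ha
    have hb' := map_mem_smul_top (res F (inf_le_right : V ⊓ W ≤ W)) hb
    rw [res_res] at ha' hb'
    exact add_mem ha' hb'
  smul_mem' := fun r a ha x hx => by
    obtain ⟨V, hV, hxV, ha⟩ := ha x hx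
    exact ⟨V, hV, hxV, by rw [map_smul]; exact Submodule.smul_mem _ _ ha⟩

variable {I F} {U V W : Opens X}

theorem le_locPow (n : ℕ) : (I ^ n • ⊤ : Submodule R (F.obj (op U))) ≤ locPow I F n U :=
  fun a ha _ hx => ⟨U, le_rfl, hx, by rwa [res_self]⟩

theorem res_mem_locPow {n : ℕ} (h : V ≤ U) {a : F.obj (op U)} (ha : a ∈ locPow I F n U) :
    res F h a ∈ locPow I F n V := fun x hx => by
  obtain ⟨W, hW, hxW, ha⟩ := ha x (h hx)
  refine ⟨W ⊓ V, inf_le_right, ⟨hxW, hx⟩, ?_⟩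
  have := map_mem_smul_top (res F (inf_le_left : W ⊓ V ≤ W)) ha
  rwa [res_res] at this ⊢

theorem mem_locPow_of_locally {n : ℕ} {a : F.obj (op U)}
    (h : ∀ x ∈ U, ∃ (V : Opens X) (hV : V ≤ U), x ∈ V ∧ res F hV a ∈ locPow I F n V) :
    a ∈ locPow I F n U := fun x hx => by
  obtain ⟨V, hV, hxV, h⟩ := h x hx
  obtain ⟨W, hW, hxW, h⟩ := h x hxV
  exact ⟨W, hW.trans hV, hxW, by rwa [res_res] at h⟩

theorem locPow_zero (a : F.obj (op U)) : a ∈ locPow I F 0 U :=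
  le_locPow 0 (by simp)

theorem locPow_anti {m n : ℕ} (h : m ≤ n) : locPow I F n U ≤ locPow I F m U :=
  fun _ ha x hx => by
    obtain ⟨V, hV, hxV, ha⟩ := ha x hx
    exact ⟨V, hV, hxV, smul_top_anti h ha⟩

theorem smul_mem_locPow {i j : ℕ} {e : R} (he : e ∈ I ^ i) {a : F.obj (op U)}
    (ha : a ∈ locPow I F j U) : e • a ∈ locPow I F (i + j) U := fun x hx => by
  obtain ⟨V, hV, hxV, ha⟩ := ha x hx
  refine ⟨V, hV, hxV, ?_⟩
  rw [map_smul, pow_add, Submodule.mul_smul]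
  exact Submodule.smul_mem_smul he ha

/-! ### The canonical homomorphisms to the truncations -/

variable (I F) in

theorem trunc_isSheaf (i : ℕ) : TopCat.Presheaf.IsSheaf (trunc I F i) :=
  ((presheafToSheaf (Opens.grothendieckTopology X) (ModuleCat.{u} R)).obj (truncPre I F i)).property

variable (I F U) in

/-- The canonical homomorphism from sections of `F` to sections of `R_i ⊗ F`. -/
def toTr (i : ℕ) : F.obj (op U) →ₗ[R] (trunc I F i).obj (op U) :=
  ((toTrunc I F i).app (op U)).hom

variable (I F U) in

/-- The transition homomorphism from sections of `R_{i+1} ⊗ F` to sections of `R_i ⊗ F`. -/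
def trMap (i : ℕ) : (trunc I F (i + 1)).obj (op U) →ₗ[R] (trunc I F i).obj (op U) :=
  ((truncMap I F i).app (op U)).hom

theorem toTr_res (i : ℕ) (h : V ≤ U) (a : F.obj (op U)) :
    toTr I F V i (res F h a) = res _ h (toTr I F U i a) :=
  app_res _ h a

theorem trMap_res (i : ℕ) (h : V ≤ U) (a : (trunc I F (i + 1)).obj (op U)) :
    trMap I F V i (res _ h a) = res _ h (trMap I F U i a) :=
  app_res _ h a

theorem trMap_toTr (i : ℕ) (a : F.obj (op U)) :
    trMap I F U i (toTr I F U (i + 1) a) = toTr I F U i a := by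
  exact (congrArg (fun f => (f.app (op U)).hom (((toTruncPre I F (i + 1)).app (op U)).hom a))
    (toSheafify_naturality (Opens.grothendieckTopology X) (truncPreMap I F i))).symm

theorem exists_toTr (i : ℕ) (t : (trunc I F i).obj (op U)) {x : X} (hx : x ∈ U) :
    ∃ (V : Opens X) (h : V ≤ U), x ∈ V ∧ ∃ a, toTr I F V i a = res _ h t := by
  obtain ⟨V, h, hxV, s, hs⟩ := toSheafify_locally_surjective t hx
  obtain ⟨a, rfl⟩ := exists_one_tmul (R := R) (N := R ⧸ I ^ (i + 1)) (M := F.obj (op V))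
    (n₀ := 1) (fun n => by
      obtain ⟨r, rfl⟩ := Ideal.Quotient.mk_surjective n
      exact ⟨r, (mul_one _).symm⟩) s
  exact ⟨V, h, hxV, a, hs⟩

theorem toTruncPre_eq_zero_iff (i : ℕ) (a : F.obj (op U)) :
    ((toTruncPre I F i).app (op U)).hom a = 0 ↔
      a ∈ (I ^ (i + 1) • ⊤ : Submodule R (F.obj (op U))) :=
  one_tmul_eq_zero_iff (R := R) (N := R ⧸ I ^ (i + 1)) (M := F.obj (op U))
    (n₀ := 1) (fun n => by
      obtain ⟨r, rfl⟩ := Ideal.Quotient.mk_surjective n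
      exact ⟨r, (mul_one _).symm⟩) (fun r => by
      rw [← Ideal.Quotient.eq_zero_iff_mem]
      exact iff_of_eq (congrArg (· = 0) (mul_one (Ideal.Quotient.mk (I ^ (i + 1)) r)))) a

/-- Sheafification kills exactly the sections that vanish locally, and before sheafification the
kernel is `I ^ (i + 1)` times the sections. The shift by one comes from `R_i = R / I ^ (i + 1)`. -/
theorem toTr_eq_zero_iff (i : ℕ) (a : F.obj (op U)) :
    toTr I F U i a = 0 ↔ a ∈ locPow I F (i + 1) U := by
  constructor
  · intro h x hx
    obtain ⟨V, hV, hxV, h⟩ := toSheafify_locally_injective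
      (F := truncPre I F i) (s := ((toTruncPre I F i).app (op U)).hom a) h hx
    refine ⟨V, hV, hxV, ?_⟩
    rwa [← toTruncPre_eq_zero_iff, app_res]
  · intro h
    refine section_ext (trunc_isSheaf I F i) fun x hx => ?_
    obtain ⟨V, hV, hxV, h⟩ := h x hx
    refine ⟨V, hV, hxV, ?_⟩
    rw [← toTruncPre_eq_zero_iff] at h
    rw [← toTr_res, map_zero]
    exact (congrArg ((toSheafify _ (truncPre I F i)).app (op V)).hom h).trans (map_zero _)

theorem toTr_eq_iff (i : ℕ) {a b : F.obj (op U)} :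
    toTr I F U i a = toTr I F U i b ↔ a - b ∈ locPow I F (i + 1) U := by
  rw [← toTr_eq_zero_iff, map_sub, sub_eq_zero]

theorem IsAdicallyComplete.eq_zero (hc : IsAdicallyComplete I F) {a : F.obj (op U)}
    (ha : ∀ n, a ∈ locPow I F n U) : a = 0 :=
  (hc (op U) (fun _ => 0) fun _ => map_zero _).unique
    (fun i => (toTr_eq_zero_iff i a).2 (ha _)) fun _ => map_zero _

theorem IsAdicallyComplete.exists_limit (hc : IsAdicallyComplete I F) (f : ℕ → F.obj (op U))
    (hf : ∀ i, f (i + 1) - f i ∈ locPow I F i U) : ∃ a, ∀ i, a - f i ∈ locPow I F i U := by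
  obtain ⟨a, ha, -⟩ := hc (op U) (fun i => toTr I F U i (f (i + 1))) fun i =>
    (trMap_toTr i _).trans ((toTr_eq_iff i).2 (hf _))
  refine ⟨a, fun i => ?_⟩
  cases i with
  | zero => exact locPow_zero _
  | succ i => exact (toTr_eq_iff i).1 (ha i)

/-! ### Deformations of sheaves of modules, in terms of sections -/

variable (I) in

/-- A locally surjective homomorphism `φ : F → N` from a flat sheaf, whose kernel consists of the
sections that are locally in `I F`. -/
structure IsFlatThickening {N : TopCat.Presheaf (ModuleCat.{u} R) X} (φ : F ⟶ N) : Prop where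
  flat : IsFlat F
  locSurj : ∀ {U : Opens X} (n : N.obj (op U)) {x : X}, x ∈ U →
    ∃ (V : Opens X) (h : V ≤ U), x ∈ V ∧ ∃ a, (φ.app (op V)).hom a = res N h n
  ker : ∀ {U : Opens X} (a : F.obj (op U)), (φ.app (op U)).hom a = 0 ↔ a ∈ locPow I F 1 U

variable (I) in

/-- A flat thickening `φ : F → N` whose source is adically complete. -/
structure IsDefSheaf {N : TopCat.Presheaf (ModuleCat.{u} R) X} (φ : F ⟶ N) : Prop extends
    IsFlatThickening I φ where
  complete : IsAdicallyComplete I F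

end Sheaves

/-! ### Deformations of sheaves: tensor products against sections -/

section Comparison

variable {K R : Type u} [Field K] [CommRing R] [Algebra K R] [IsParameterAlgebra K R]
  {X : TopCat.{u}} {F : TopCat.Presheaf (ModuleCat.{u} R) X}
  {N : TopCat.Presheaf (ModuleCat.{u} K) X}
  (hN : Presheaf.IsSheaf (Opens.grothendieckTopology X) N)
  (φ : F ⟶ N ⋙ ModuleCat.restrictScalars (augmentation K R))

/-- The homomorphism of presheaves underlying `inducedSheafHom`. -/
def inducedPreHom : F ⋙ ModuleCat.extendScalars (augmentation K R) ⟶ N :=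
  (((ModuleCat.extendRestrictScalarsAdj (augmentation K R)).whiskerRight
      (Opens X)ᵒᵖ).homEquiv F N).symm φ

theorem inducedPreHom_app (U : (Opens X)ᵒᵖ) :
    (inducedPreHom φ).app U = inducedHom R (φ.app U) := by
  unfold inducedPreHom inducedHom
  rw [Adjunction.homEquiv_counit, Adjunction.homEquiv_counit]
  simp

/-- A morphism of sheaves is an isomorphism exactly when it is locally bijective. The map from a
presheaf to its sheafification is itself locally bijective, so the test can be made before
sheafifying. -/
theorem isIso_inducedSheafHom_iff : IsIso (inducedSheafHom R hN φ) ↔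
    Presheaf.IsLocallyInjective (Opens.grothendieckTopology X) (inducedPreHom φ) ∧
    Presheaf.IsLocallySurjective (Opens.grothendieckTopology X) (inducedPreHom φ) := by
  have hfac : toSheafify (Opens.grothendieckTopology X) (F ⋙ ModuleCat.extendScalars (augmentation K R)) ≫
      inducedSheafHom R hN φ = inducedPreHom φ := toSheafify_sheafifyLift (Opens.grothendieckTopology X) _ hN
  let f : (presheafToSheaf (Opens.grothendieckTopology X) (ModuleCat.{u} K)).obj
    (F ⋙ ModuleCat.extendScalars (augmentation K R)) ⟶ ⟨N, hN⟩ := ⟨inducedSheafHom R hN φ⟩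
  have h1 : IsIso (inducedSheafHom R hN φ) ↔ IsIso f :=
    (isIso_iff_of_reflects_iso f (sheafToPresheaf (Opens.grothendieckTopology X) (ModuleCat.{u} K)))
  have : (Opens.grothendieckTopology X).HasSheafCompose (forget (ModuleCat.{u} K)) :=
    ⟨fun P hP => (Presheaf.isSheaf_iff_isSheaf_comp _ P (forget (ModuleCat.{u} K))).1 hP⟩
  have h2 := Sheaf.isLocallyBijective_iff_isIso f
  rw [h1, ← h2]
  constructor
  · rintro ⟨hi, hs⟩
    have hi' : Presheaf.IsLocallyInjective (Opens.grothendieckTopology X) (inducedSheafHom R hN φ) := hi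
    have hs' : Presheaf.IsLocallySurjective (Opens.grothendieckTopology X) (inducedSheafHom R hN φ) := hs
    rw [← hfac]
    exact ⟨inferInstance, inferInstance⟩
  · rintro ⟨hi, hs⟩
    exact ⟨Presheaf.isLocallyInjective_of_isLocallyInjective_of_isLocallySurjective_fac (Opens.grothendieckTopology X) (inducedPreHom φ) hfac,
      Presheaf.isLocallySurjective_of_isLocallySurjective_fac (Opens.grothendieckTopology X) hfac⟩

/-- The homomorphism `s ↦ 1 ⊗ s` from sections of `F` to sections of `K ⊗ F`. -/
def oneTmul (U : Opens X) : F.obj (op U) →+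
    (F ⋙ ModuleCat.extendScalars (augmentation K R)).obj (op U) :=
  ((ModuleCat.extendRestrictScalarsAdj
    (augmentation K R)).unit.app (F.obj (op U))).hom.toAddMonoidHom

variable (K) in

theorem res_oneTmul {U V : Opens X} (h : V ≤ U) (a : F.obj (op U)) :
    res (F ⋙ ModuleCat.extendScalars (augmentation K R)) h (oneTmul U a) =
      oneTmul V (res F h a) :=
  (congrArg (fun f => f.hom a) ((ModuleCat.extendRestrictScalarsAdj
    (augmentation K R)).unit.naturality (F.map (homOfLE h).op))).symm

variable (K) in

theorem oneTmul_eq_zero_iff {U : Opens X} (a : F.obj (op U)) :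
    oneTmul (K := K) U a = 0 ↔ a ∈ (paramIdeal K R • ⊤ : Submodule R (F.obj (op U))) :=
  unit_extendScalars_eq_zero_iff _ a

theorem inducedPreHom_oneTmul {U : Opens X} (a : F.obj (op U)) :
    ((inducedPreHom φ).app (op U)).hom (oneTmul U a) = (φ.app (op U)).hom a := by
  rw [inducedPreHom_app]
  exact unit_inducedHom _ a

theorem exists_oneTmul {U : Opens X}
    (t : (F ⋙ ModuleCat.extendScalars (augmentation K R)).obj (op U)) :
    ∃ a, t = oneTmul U a :=
  exists_one_tmul_extendScalars _ t

theorem isLocallyInjective_inducedPreHom_iff :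
    Presheaf.IsLocallyInjective (Opens.grothendieckTopology X) (inducedPreHom φ) ↔
      ∀ {U : Opens X} (a : F.obj (op U)),
        (φ.app (op U)).hom a = 0 → a ∈ locPow (paramIdeal K R) F 1 U := by
  constructor
  · intro h U a ha x hx
    obtain ⟨V, f, hf, hxV⟩ := Presheaf.equalizerSieve_mem (Opens.grothendieckTopology X)
      (inducedPreHom φ) (oneTmul U a) 0 (((inducedPreHom_oneTmul φ a).trans ha).trans
        (map_zero ((inducedPreHom φ).app (op U)).hom).symm) x hx
    refine ⟨V, f.le, hxV, ?_⟩
    rw [pow_one, ← oneTmul_eq_zero_iff K, ← res_oneTmul]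
    exact Eq.trans hf (map_zero ((F ⋙ ModuleCat.extendScalars (augmentation K R)).map f.op).hom)
  · refine fun h => ⟨fun {U} s t hst x hx => ?_⟩
    obtain ⟨a, ha⟩ := exists_oneTmul (U := U.unop) (s - t)
    have h0 : (φ.app (op U.unop)).hom a = 0 := by
      rw [← inducedPreHom_oneTmul, ← ha]
      exact (map_sub ((inducedPreHom φ).app U).hom s t).trans (sub_eq_zero.2 hst)
    obtain ⟨V, hV, hxV, ha'⟩ := h a h0 x hx
    refine ⟨V, homOfLE hV, ?_, hxV⟩
    rw [pow_one, ← oneTmul_eq_zero_iff K, ← res_oneTmul, ← ha] at ha'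
    exact sub_eq_zero.1 ((map_sub (res (F ⋙ ModuleCat.extendScalars (augmentation K R)) hV)
      s t).symm.trans ha')

theorem isLocallySurjective_inducedPreHom_iff :
    Presheaf.IsLocallySurjective (Opens.grothendieckTopology X) (inducedPreHom φ) ↔
      ∀ {U : Opens X} (n : N.obj (op U)) {x : X}, x ∈ U →
        ∃ (V : Opens X) (h : V ≤ U), x ∈ V ∧ ∃ a, (φ.app (op V)).hom a = res N h n := by
  constructor
  · intro h U n x hx
    obtain ⟨V, f, ⟨t, ht⟩, hxV⟩ := Presheaf.imageSieve_mem (Opens.grothendieckTopology X)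
      (inducedPreHom φ) n x hx
    obtain ⟨a, rfl⟩ := exists_oneTmul t
    exact ⟨V, f.le, hxV, a, (inducedPreHom_oneTmul φ a).symm.trans ht⟩
  · refine fun h => ⟨fun {U} n x hx => ?_⟩
    obtain ⟨V, hV, hxV, a, ha⟩ := h n hx
    exact ⟨V, homOfLE hV, ⟨oneTmul V a, (inducedPreHom_oneTmul φ a).trans ha⟩, hxV⟩

theorem isDeformationSheaf_iff :
    IsDeformationSheaf R hN φ ↔ IsDefSheaf (paramIdeal K R) φ := by
  have h0 : ∀ {U : Opens X} (a : F.obj (op U)), a ∈ locPow (paramIdeal K R) F 1 U →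
      (φ.app (op U)).hom a = 0 := fun {U} a ha => by
    refine section_ext (F := N) hN fun x hx => ?_
    obtain ⟨V, hV, hxV, ha⟩ := ha x hx
    refine ⟨V, hV, hxV, ?_⟩
    rw [pow_one, ← oneTmul_eq_zero_iff K] at ha
    have h1 := inducedPreHom_oneTmul φ (res F hV a)
    rw [ha, map_zero] at h1
    exact ((app_res φ hV a).symm.trans h1.symm).trans (map_zero (res N hV)).symm
  exact ⟨fun h => ⟨⟨h.flat,
      (isLocallySurjective_inducedPreHom_iff φ).1 ((isIso_inducedSheafHom_iff hN φ).1 h.isIso).2,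
      fun a => ⟨(isLocallyInjective_inducedPreHom_iff φ).1
        ((isIso_inducedSheafHom_iff hN φ).1 h.isIso).1 a, h0 a⟩⟩, h.complete⟩,
    fun h => ⟨h.flat, h.complete, (isIso_inducedSheafHom_iff hN φ).2
      ⟨(isLocallyInjective_inducedPreHom_iff φ).2 fun a => (h.ker a).1,
        (isLocallySurjective_inducedPreHom_iff φ).2 h.locSurj⟩⟩⟩

end Comparison

end Deformation
end

noncomputable section
namespace Deformation

/-! ### Germs and symbols of sections -/

section Symbols

variable {R : Type u} [CommRing R] {X : TopCat.{u}} {I : Ideal R}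
  {F N : TopCat.Presheaf (ModuleCat.{u} R) X} {U V W : Opens X} {φ : F ⟶ N}

theorem exists_common_nhd {r : ℕ} (V : Fin r → Opens X) {x : X} (hV : ∀ k, x ∈ V k)
    (hU : x ∈ U) : ∃ W ≤ U, x ∈ W ∧ ∀ k, W ≤ V k :=
  ⟨⟨⋂ k, (V k : Set X), isOpen_iInter_of_finite fun k => (V k).2⟩ ⊓ U, inf_le_right,
    ⟨Set.mem_iInter.2 hV, hU⟩, fun k _ hy => Set.mem_iInter.1 hy.1 k⟩

theorem map_mem_ideal_smul_top {J : Ideal R} {M M' : Type*} [AddCommGroup M] [Module R M]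
    [AddCommGroup M'] [Module R M'] (f : M →ₗ[R] M') {x : M} (hx : x ∈ (J • ⊤ : Submodule R M)) :
    f x ∈ (J • ⊤ : Submodule R M') := by
  have h := Submodule.mem_map_of_mem (f := f) hx
  rw [Submodule.map_smul''] at h
  exact Submodule.smul_mono le_rfl le_top h

variable (F) in

/-- The germ of a section, as a linear map. -/
def germL (U : Opens X) (x : X) (hx : x ∈ U) : F.obj (op U) →ₗ[R] F.stalk x :=
  (F.germ U x hx).hom

theorem germL_res (h : V ≤ U) {x : X} (hx : x ∈ V) (a : F.obj (op U)) :
    germL F V x hx (res F h a) = germL F U x (h hx) a :=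
  F.germ_res_apply (homOfLE h) x hx a

theorem exists_germL_eq {x : X} (t : F.stalk x) :
    ∃ (U : Opens X) (hx : x ∈ U) (a : F.obj (op U)), germL F U x hx a = t :=
  F.exists_germ_eq t

theorem germL_eq {x : X} (hU : x ∈ U) (hV : x ∈ V) {a : F.obj (op U)} {b : F.obj (op V)}
    (h : germL F U x hU a = germL F V x hV b) :
    ∃ (W : Opens X) (h : W ≤ U) (h' : W ≤ V), x ∈ W ∧ res F h a = res F h' b := by
  obtain ⟨W, hx, i, j, hij⟩ := F.germ_eq x hU hV a b h
  exact ⟨W, i.le, j.le, hx, hij⟩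

theorem exists_germL_eq_of_mem {J : Ideal R} {x : X} {t : F.stalk x}
    (ht : t ∈ (J • ⊤ : Submodule R (F.stalk x))) :
    ∃ (U : Opens X) (hx : x ∈ U) (a : F.obj (op U)),
      a ∈ (J • ⊤ : Submodule R (F.obj (op U))) ∧ germL F U x hx a = t := by
  induction ht using Submodule.smul_induction_on' with
  | smul r hr t _ =>
    obtain ⟨U, hx, a, rfl⟩ := exists_germL_eq t
    exact ⟨U, hx, r • a, Submodule.smul_mem_smul hr trivial, by simp⟩
  | add t _ t' _ h h' =>
    obtain ⟨U, hx, a, ha, rfl⟩ := h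
    obtain ⟨V, hx', b, hb, rfl⟩ := h'
    have hxUV : x ∈ U ⊓ V := ⟨hx, hx'⟩
    exact ⟨U ⊓ V, hxUV, res F inf_le_left a + res F inf_le_right b,
      add_mem (map_mem_ideal_smul_top _ ha) (map_mem_ideal_smul_top _ hb),
      by rw [map_add, germL_res, germL_res]⟩

/-- Membership in `J F_x` is witnessed by finitely many germs, so it persists on a neighbourhood. -/
theorem exists_res_mem {J : Ideal R} {x : X} (hx : x ∈ U) {a : F.obj (op U)}
    (ha : germL F U x hx a ∈ (J • ⊤ : Submodule R (F.stalk x))) :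
    ∃ (V : Opens X) (h : V ≤ U), x ∈ V ∧ res F h a ∈ (J • ⊤ : Submodule R (F.obj (op V))) := by
  obtain ⟨V, hxV, b, hb, h⟩ := exists_germL_eq_of_mem ha
  obtain ⟨W, hW, hW', hxW, hab⟩ := germL_eq hx hxV h.symm
  refine ⟨W, hW, hxW, ?_⟩
  rw [hab]
  exact map_mem_ideal_smul_top _ hb

/-- A linear relation in a stalk involves finitely many germs, hence holds already on a small basic
open set, where flatness of the sections trivializes it. -/
theorem isFlat_of_basis (ℬ : Set (Opens X)) (hℬ : Opens.IsBasis ℬ)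
    (h : ∀ U ∈ ℬ, Module.Flat R (F.obj (op U))) : IsFlat F := by
  intro x
  refine Module.Flat.of_forall_isTrivialRelation fun {l f t} ht => ?_
  choose V hx a ha using fun k => exists_germL_eq (t k)
  obtain ⟨W, -, hxW, hW⟩ := exists_common_nhd V hx (U := ⊤) trivial
  have h0 : germL F W x hxW (∑ k, f k • res F (hW k) (a k)) = germL F W x hxW 0 := by
    simp only [map_sum, map_smul, germL_res, ha, ht, map_zero]
  obtain ⟨W', h1, h2, hxW', h3⟩ := germL_eq hxW hxW h0
  obtain ⟨B, hB, hxB, hBW⟩ := Opens.isBasis_iff_nbhd.1 hℬ hxW'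
  have := h B hB
  have h4 : ∑ k, f k • res F ((hBW.trans h1).trans (hW k)) (a k) = 0 := by
    have := congrArg (res F hBW) h3
    simpa only [map_sum, map_smul, res_res, map_zero] using this
  obtain ⟨m, c, y, hy, hc⟩ := Module.Flat.isTrivialRelation_of_sum_smul_eq_zero h4
  refine ⟨m, c, fun j => germL F B x hxB (y j), fun k => ?_, hc⟩
  rw [← ha, ← germL_res ((hBW.trans h1).trans (hW k)) hxB]
  exact (congrArg (germL F B x hxB) (hy k)).trans (by simp only [map_sum, map_smul])

/-! ### Symbols -/

variable (I φ) in

/-- The family `c` is the symbol of the section `d` of `I ^ i F`, in terms of the elements `e`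
of `I ^ i`: locally, `d = ∑ e_k b_k` modulo `I ^ (i + 1) F`, with `φ b_k = c_k`. -/
def IsSymbol (i : ℕ) {r : ℕ} (e : Fin r → R) (d : F.obj (op U)) (c : Fin r → N.obj (op U)) :
    Prop :=
  ∀ x ∈ U, ∃ (V : Opens X) (h : V ≤ U), x ∈ V ∧ ∃ b : Fin r → F.obj (op V),
    res F h d - ∑ k, e k • b k ∈ locPow I F (i + 1) V ∧
      ∀ k, (φ.app (op V)).hom (b k) = res N h (c k)

variable {i r : ℕ} {e : Fin r → R} {d d' : F.obj (op U)} {c c' : Fin r → N.obj (op U)}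

theorem isSymbol_app (b : Fin r → F.obj (op U))
    (h : d - ∑ k, e k • b k ∈ locPow I F (i + 1) U) :
    IsSymbol I φ i e d fun k => (φ.app (op U)).hom (b k) := fun x hx =>
  ⟨U, le_rfl, hx, b, by rwa [res_self], fun k => by rw [res_self]⟩

theorem IsSymbol.res (hd : IsSymbol I φ i e d c) (h : V ≤ U) :
    IsSymbol I φ i e (res F h d) fun k => res N h (c k) := fun x hx => by
  obtain ⟨W, hW, hxW, b, hb, hc⟩ := hd x (h hx)
  refine ⟨W ⊓ V, inf_le_right, ⟨hxW, hx⟩, fun k => Deformation.res F inf_le_left (b k), ?_,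
    fun k => by rw [app_res, hc, res_res, res_res]⟩
  have := res_mem_locPow (inf_le_left : W ⊓ V ≤ W) hb
  simpa only [map_sub, res_res, map_sum, map_smul] using this

theorem IsSymbol.sub (hd : IsSymbol I φ i e d c) (hd' : IsSymbol I φ i e d' c') :
    IsSymbol I φ i e (d - d') (c - c') := fun x hx => by
  obtain ⟨V, hV, hxV, b, hb, hc⟩ := hd x hx
  obtain ⟨W, hW, hxW, b', hb', hc'⟩ := (hd'.res hV) x hxV
  have hb := res_mem_locPow hW hb
  have h1 : ∑ k, e k • (Deformation.res F hW (b k) - b' k) =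
      Deformation.res F hW (∑ k, e k • b k) - ∑ k, e k • b' k := by
    rw [map_sum, ← Finset.sum_sub_distrib]
    exact Finset.sum_congr rfl fun k _ => by rw [map_smul, smul_sub]
  refine ⟨W, hW.trans hV, hxW, fun k => Deformation.res F hW (b k) - b' k, ?_, fun k => ?_⟩
  · have h2 := sub_mem hb hb'
    rw [map_sub, res_res, res_res] at h2
    rw [h1, map_sub]
    convert h2 using 1
    abel
  · rw [map_sub, app_res, hc, hc', res_res, res_res, ← map_sub]
    rfl

theorem IsSymbol.mem (he : ∀ k, e k ∈ I ^ i) (hd : IsSymbol I φ i e d c) :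
    d ∈ locPow I F i U :=
  mem_locPow_of_locally fun x hx => by
    obtain ⟨V, hV, hxV, b, hb, -⟩ := hd x hx
    refine ⟨V, hV, hxV, ?_⟩
    have h1 : ∑ k, e k • b k ∈ locPow I F i V :=
      sum_mem fun k _ => smul_mem_locPow (j := 0) (he k) (locPow_zero (b k))
    have := add_mem (locPow_anti (Nat.le_succ i) hb) h1
    rwa [sub_add_cancel] at this

theorem exists_isSymbol_locally (he : IsGrBasis I i e) (hd : d ∈ locPow I F i U) {x : X}
    (hx : x ∈ U) : ∃ (V : Opens X) (h : V ≤ U), x ∈ V ∧ ∃ b : Fin r → F.obj (op V),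
      res F h d - ∑ k, e k • b k ∈ locPow I F (i + 1) V := by
  obtain ⟨V, hV, hxV, hd⟩ := hd x hx
  obtain ⟨b, hb⟩ := he.exists_sum hd
  exact ⟨V, hV, hxV, b, le_locPow _ hb⟩

theorem IsFlatThickening.mem_of_isSymbol_zero (hφ : IsFlatThickening I φ) (he : IsGrBasis I i e)
    (hd : IsSymbol I φ i e d 0) : d ∈ locPow I F (i + 1) U :=
  mem_locPow_of_locally fun x hx => by
    obtain ⟨V, hV, hxV, b, hb, h0⟩ := hd x hx
    refine ⟨V, hV, hxV, ?_⟩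
    have h1 : ∑ k, e k • b k ∈ locPow I F (i + 1) V := sum_mem fun k _ =>
      smul_mem_locPow (he.mem k) ((hφ.ker (b k)).1 ((h0 k).trans (map_zero _)))
    have := add_mem hb h1
    rwa [sub_add_cancel] at this

/-- Only stalks are assumed flat, so `IsGrBasis.coeff_mem` is applied to germs and the result is
spread to a neighbourhood. -/
theorem IsFlatThickening.app_eq_zero (hφ : IsFlatThickening I φ) (he : IsGrBasis I i e) {b : Fin r → F.obj (op U)}
    (hb : ∑ k, e k • b k ∈ locPow I F (i + 1) U) (k : Fin r) :
    (φ.app (op U)).hom (b k) = 0 := by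
  rw [hφ.ker]
  intro x hx
  obtain ⟨V, hV, hxV, hb⟩ := hb x hx
  have := hφ.flat x
  have h1 := map_mem_smul_top (germL F V x hxV) hb
  simp only [map_sum, map_smul, germL_res] at h1
  have h2 := he.coeff_mem h1 k
  rw [pow_one]
  exact exists_res_mem hx h2

theorem IsFlatThickening.isSymbol_eq_zero (hφ : IsFlatThickening I φ) (hN : TopCat.Presheaf.IsSheaf N) (he : IsGrBasis I i e)
    (hd : IsSymbol I φ i e d c) (h : d ∈ locPow I F (i + 1) U) : c = 0 := by
  funext k
  refine section_ext hN fun x hx => ?_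
  obtain ⟨V, hV, hxV, b, hb, hc⟩ := hd x hx
  refine ⟨V, hV, hxV, ?_⟩
  have := sub_mem (res_mem_locPow hV h) hb
  rw [sub_sub_cancel] at this
  rw [← hc, hφ.app_eq_zero he this, Pi.zero_apply, map_zero]

theorem IsFlatThickening.isSymbol_unique (hφ : IsFlatThickening I φ) (hN : TopCat.Presheaf.IsSheaf N) (he : IsGrBasis I i e)
    (hd : IsSymbol I φ i e d c) (hd' : IsSymbol I φ i e d' c')
    (h : d - d' ∈ locPow I F (i + 1) U) : c = c' :=
  sub_eq_zero.1 (hφ.isSymbol_eq_zero hN he (hd.sub hd') h)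

theorem IsFlatThickening.sub_mem_of_isSymbol (hφ : IsFlatThickening I φ) (he : IsGrBasis I i e)
    (hd : IsSymbol I φ i e d c) (hd' : IsSymbol I φ i e d' c) :
    d - d' ∈ locPow I F (i + 1) U :=
  hφ.mem_of_isSymbol_zero he (by simpa using hd.sub hd')

theorem IsFlatThickening.exists_lift_locally (hφ : IsFlatThickening I φ) (c : Fin r → N.obj (op U)) {x : X} (hx : x ∈ U) :
    ∃ (V : Opens X) (h : V ≤ U), x ∈ V ∧
      ∃ b : Fin r → F.obj (op V), ∀ k, (φ.app (op V)).hom (b k) = res N h (c k) := by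
  choose V hV hxV a ha using fun k => hφ.locSurj (c k) hx
  obtain ⟨W, hWU, hxW, hW⟩ := exists_common_nhd V hxV hx
  exact ⟨W, hWU, hxW, fun k => res F (hW k) (a k), fun k => by rw [app_res, ha, res_res]⟩

/-- The local coefficients `b k` need not glue, but their images under `φ` are unique and therefore
do. -/
theorem IsFlatThickening.exists_isSymbol (hφ : IsFlatThickening I φ)
    (hN : TopCat.Presheaf.IsSheaf N) (he : IsGrBasis I i e) (hd : d ∈ locPow I F i U) :
    ∃ c : Fin r → N.obj (op U), IsSymbol I φ i e d c := by
  have key : ∀ k, ∃ c : N.obj (op U), ∀ (V : Opens X) (hV : V ≤ U) (b : N.obj (op V)),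
      (∃ c' : Fin r → N.obj (op V), IsSymbol I φ i e (Deformation.res F hV d) c' ∧ c' k = b) →
        Deformation.res N hV c = b := by
    intro k
    refine exists_glue_of_unique hN (fun V hV b => ∃ c' : Fin r → N.obj (op V),
      IsSymbol I φ i e (Deformation.res F hV d) c' ∧ c' k = b) ?_ ?_ ?_
    · rintro V W hV h - ⟨c', hc, rfl⟩
      exact ⟨_, by simpa only [res_res] using hc.res h, rfl⟩
    · rintro V hV - - ⟨c, hc, rfl⟩ ⟨c', hc', rfl⟩
      rw [hφ.isSymbol_unique hN he hc hc' (by rw [sub_self]; exact Submodule.zero_mem _)]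
    · intro x hx
      obtain ⟨W, hW, hxW, b, hb⟩ := exists_isSymbol_locally he hd hx
      exact ⟨W, hW, hxW, _, _, isSymbol_app b hb, rfl⟩
  choose c hc using key
  refine ⟨c, fun x hx => ?_⟩
  obtain ⟨W, hW, hxW, b, hb⟩ := exists_isSymbol_locally he hd hx
  exact ⟨W, hW, hxW, b, hb, fun k => (hc k W hW _ ⟨_, isSymbol_app b hb, rfl⟩).symm⟩

/-- The symbol of a section of the truncation that vanishes in the previous truncation. -/

theorem IsFlatThickening.exists_isSymbol_trunc (hφ : IsFlatThickening I φ) (hN : TopCat.Presheaf.IsSheaf N)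
    {j : ℕ} (he : IsGrBasis I (j + 1) e) (t : (trunc I F (j + 1)).obj (op U))
    (ht : trMap I F U j t = 0) :
    ∃ c : Fin r → N.obj (op U), ∀ (V : Opens X) (hV : V ≤ U) (d : F.obj (op V))
      (c' : Fin r → N.obj (op V)), toTr I F V (j + 1) d = Deformation.res _ hV t →
        IsSymbol I φ (j + 1) e d c' → ∀ k, Deformation.res N hV (c k) = c' k := by
  have key : ∀ k, ∃ c : N.obj (op U), ∀ (V : Opens X) (hV : V ≤ U) (b : N.obj (op V)),
      (∃ (d : F.obj (op V)) (c' : Fin r → N.obj (op V)),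
        toTr I F V (j + 1) d = Deformation.res _ hV t ∧ IsSymbol I φ (j + 1) e d c' ∧ c' k = b) →
        Deformation.res N hV c = b := by
    intro k
    refine exists_glue_of_unique hN (fun V hV b => ∃ (d : F.obj (op V)) (c' : Fin r → N.obj (op V)),
      toTr I F V (j + 1) d = Deformation.res _ hV t ∧ IsSymbol I φ (j + 1) e d c' ∧ c' k = b)
      ?_ ?_ ?_
    · rintro V W hV h - ⟨d, c', hd, hc, rfl⟩
      exact ⟨_, _, by rw [toTr_res, hd, res_res], hc.res h, rfl⟩
    · rintro V hV - - ⟨d, c, hd, hc, rfl⟩ ⟨d', c', hd', hc', rfl⟩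
      rw [hφ.isSymbol_unique hN he hc hc' ((toTr_eq_iff _).1 (hd.trans hd'.symm))]
    · intro x hx
      obtain ⟨V, hV, hxV, d, hd⟩ := exists_toTr (j + 1) t hx
      have h0 : d ∈ locPow I F (j + 1) V := by
        rw [← toTr_eq_zero_iff, ← trMap_toTr, hd, trMap_res, ht, map_zero]
      obtain ⟨W, hW, hxW, b, hb⟩ := exists_isSymbol_locally he h0 hxV
      exact ⟨W, hW.trans hV, hxW, _, Deformation.res F hW d, _, by rw [toTr_res, hd, res_res],
        isSymbol_app b hb, rfl⟩
  choose c hc using key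
  exact ⟨c, fun V hV d c' hd hs k => hc k V hV _ ⟨d, c', hd, hs, rfl⟩⟩

end Symbols

end Deformation
end

noncomputable section
namespace Deformation

/-! ### Sections on open sets with vanishing Čech cohomology -/

section Sections

variable {R : Type u} [CommRing R] {X : TopCat.{u}} {I : Ideal R}
  {F N : TopCat.Presheaf (ModuleCat.{u} R) X} {U V W : Opens X} {φ : F ⟶ N}

/-- The first Čech cohomology of `N` on `U` vanishes: every open covering of `U` has a refinement
on which all 1-cocycles are coboundaries. -/
def CechVanishes (N : TopCat.Presheaf (ModuleCat.{u} R) X) (U : Opens X) : Prop :=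
  ∀ V : U → Opens X, (∀ x, (x : X) ∈ V x) → ∃ (ι : Type u) (W : ι → Opens X) (τ : ι → U),
    (∀ k, W k ≤ V (τ k)) ∧ (∀ k, W k ≤ U) ∧ (∀ x ∈ U, ∃ k, x ∈ W k) ∧
    ∀ c : ∀ j k, N.obj (op (W j ⊓ W k)),
      (∀ j k l, res N (inf_le_left : W j ⊓ W k ⊓ W l ≤ W j ⊓ W k) (c j k) +
        res N (inf_le_inf_right _ inf_le_right : W j ⊓ W k ⊓ W l ≤ W k ⊓ W l) (c k l) =
        res N (inf_le_inf_right _ inf_le_left : W j ⊓ W k ⊓ W l ≤ W j ⊓ W l) (c j l)) →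
      ∃ β : ∀ k, N.obj (op (W k)), ∀ j k, c j k =
        res N (inf_le_left : W j ⊓ W k ≤ W j) (β j) - res N (inf_le_right : W j ⊓ W k ≤ W k) (β k)

/-- A section of the sheaf of truncations on an open set with vanishing Čech cohomology lifts to
the next truncation. -/
theorem IsFlatThickening.exists_trMap_eq [IsNoetherianRing R] [I.IsMaximal]
    (hφ : IsFlatThickening I φ) (hN : TopCat.Presheaf.IsSheaf N) (hU : CechVanishes N U) (i : ℕ)
    (t : (trunc I F i).obj (op U)) : ∃ t', trMap I F U i t' = t := by
  obtain ⟨r, e, he⟩ := exists_isGrBasis I (i + 1)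
  choose V hV hxV a ha using fun x : U => exists_toTr i t x.2
  obtain ⟨ι, W, τ, hWV, hWU, hcov, hW⟩ := hU V hxV
  obtain ⟨s, hs⟩ : ∃ s : ∀ k, F.obj (op (W k)), ∀ k, toTr I F (W k) i (s k) = res _ (hWU k) t :=
    ⟨fun k => res F (hWV k) (a (τ k)), fun k => by rw [toTr_res, ha, res_res]⟩
  -- Local lifts `s j`, `s k` differ on overlaps by sections of `I ^ (i + 1) F`. The components of
  -- their symbols are 1-cocycles of `N`, and a cochain `β` bounding them prescribes how to correct
  -- the lifts.
  let δ : ∀ j k, F.obj (op (W j ⊓ W k)) := fun j k =>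
    res F inf_le_left (s j) - res F inf_le_right (s k)
  have hδ : ∀ j k, δ j k ∈ locPow I F (i + 1) (W j ⊓ W k) := fun j k => by
    rw [← toTr_eq_iff, toTr_res, toTr_res, hs, hs, res_res, res_res]
  choose c hc using fun j k => hφ.exists_isSymbol hN he (hδ j k)
  have hcocycle : ∀ l j k m, res N (inf_le_left : W j ⊓ W k ⊓ W m ≤ W j ⊓ W k) (c j k l) +
        res N (inf_le_inf_right _ inf_le_right : W j ⊓ W k ⊓ W m ≤ W k ⊓ W m) (c k m l) =
        res N (inf_le_inf_right _ inf_le_left : W j ⊓ W k ⊓ W m ≤ W j ⊓ W m) (c j m l) := by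
    intro l j k m
    have h1 := (hc j k).res (inf_le_left : W j ⊓ W k ⊓ W m ≤ W j ⊓ W k)
    have h2 := (hc k m).res (inf_le_inf_right _ inf_le_right : W j ⊓ W k ⊓ W m ≤ W k ⊓ W m)
    have h3 := (hc j m).res (inf_le_inf_right _ inf_le_left : W j ⊓ W k ⊓ W m ≤ W j ⊓ W m)
    have := hφ.isSymbol_unique hN he (h3.sub h2) h1 (by
      simp only [δ, map_sub, res_res]
      convert Submodule.zero_mem _ using 1
      abel)
    rw [← sub_eq_iff_eq_add.1 (congrFun this l)]
  choose β hβ using fun l => hW (fun j k => c j k l) (hcocycle l)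
  -- The corrected lifts `s k - ∑ e l • b l`, with `φ (b l)` equal to `β l k`, exist only locally,
  -- since `β` need not lift. Their classes in the next truncation depend only on `β` and agree on
  -- overlaps.
  obtain ⟨t', ht'⟩ := exists_glue_of_unique (trunc_isSheaf I F (i + 1)) (U := U)
    (fun B _ b => ∃ (k : ι) (h : B ≤ W k) (d : F.obj (op B)), b = toTr I F B (i + 1) d ∧
      IsSymbol I φ (i + 1) e (res F h (s k) - d) fun l => res N h (β l k)) (by
      rintro B B' hB h _ ⟨k, hk, d, rfl, hd⟩
      refine ⟨k, h.trans hk, res F h d, by rw [toTr_res], ?_⟩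
      simpa only [map_sub, res_res] using hd.res h) (by
      rintro B hB _ _ ⟨k, hk, d, rfl, hd⟩ ⟨k', hk', d', rfl, hd'⟩
      rw [toTr_eq_iff]
      have h1 := (hc k k').res (le_inf hk hk')
      have h2 := hd.sub hd'
      have h3 : ((fun l => res N hk (β l k)) - fun l => res N hk' (β l k')) =
          fun l => res N (le_inf hk hk') (c k k' l) := by
        funext l
        rw [hβ, map_sub, res_res, res_res]
        rfl
      rw [h3] at h2
      convert hφ.sub_mem_of_isSymbol he h1 h2 using 1
      simp only [δ, map_sub, res_res]
      abel) (by
      intro x hx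
      obtain ⟨k, hk⟩ := hcov x hx
      obtain ⟨B, hB, hxB, b, hb⟩ := hφ.exists_lift_locally (fun l => β l k) hk
      refine ⟨B, hB.trans (hWU k), hxB, _, k, hB, res F hB (s k) - ∑ l, e l • b l, rfl, ?_⟩
      rw [sub_sub_cancel]
      simp_rw [← hb]
      exact isSymbol_app b (by rw [sub_self]; exact Submodule.zero_mem _))
  refine ⟨t', section_ext (trunc_isSheaf I F i) fun x hx => ?_⟩
  obtain ⟨k, hk⟩ := hcov x hx
  obtain ⟨B, hB, hxB, b, hb⟩ := hφ.exists_lift_locally (fun l => β l k) hk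
  refine ⟨B, hB.trans (hWU k), hxB, ?_⟩
  have h1 : IsSymbol I φ (i + 1) e (res F hB (s k) - (res F hB (s k) - ∑ l, e l • b l))
      fun l => res N hB (β l k) := by
    rw [sub_sub_cancel]
    simp_rw [← hb]
    exact isSymbol_app b (by rw [sub_self]; exact Submodule.zero_mem _)
  rw [← trMap_res, ht' B (hB.trans (hWU k)) _ ⟨k, hB, _, rfl, h1⟩, trMap_toTr,
    ← res_res (hWU k) hB, ← hs k, ← toTr_res, eq_comm, toTr_eq_iff]
  exact h1.mem he.mem

/-- Modulo `I` the sheaf `F` is `N`, so `n` defines a section of the truncation of level 0. It is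
lifted through all truncations by `exists_trMap_eq`, and completeness of `F` yields a section. -/
theorem IsDefSheaf.app_surjective [IsNoetherianRing R] [I.IsMaximal] (hφ : IsDefSheaf I φ)
    (hN : TopCat.Presheaf.IsSheaf N) (hU : CechVanishes N U) :
    Function.Surjective (φ.app (op U)).hom := by
  intro n
  obtain ⟨t₀, ht₀⟩ := exists_glue_of_unique (trunc_isSheaf I F 0) (U := U)
    (fun V hV t => ∃ a, (φ.app (op V)).hom a = res N hV n ∧ toTr I F V 0 a = t) (by
      rintro V W hV h _ ⟨a, ha, rfl⟩
      exact ⟨res F h a, by rw [app_res, ha, res_res], toTr_res _ _ _⟩) (by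
      rintro V hV _ _ ⟨a, ha, rfl⟩ ⟨b, hb, rfl⟩
      rw [toTr_eq_iff, ← hφ.ker, map_sub, ha, hb, sub_self]) (by
      intro x hx
      obtain ⟨V, hV, hxV, a, ha⟩ := hφ.locSurj n hx
      exact ⟨V, hV, hxV, _, a, ha, rfl⟩)
  choose g hg using hφ.exists_trMap_eq hN hU
  let s : ∀ i, (trunc I F i).obj (op U) := fun i => Nat.rec t₀ (fun i t => g i t) i
  obtain ⟨a, ha, -⟩ := hφ.complete (op U) s fun i => hg i (s i)
  refine ⟨a, section_ext hN fun x hx => ?_⟩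
  obtain ⟨V, hV, hxV, b, hb⟩ := hφ.locSurj n hx
  refine ⟨V, hV, hxV, ?_⟩
  have h1 : toTr I F V 0 (res F hV a) = toTr I F V 0 b := by
    rw [toTr_res, ← ht₀ V hV _ ⟨b, hb, rfl⟩]
    exact congrArg (res _ hV) (ha 0)
  rw [toTr_eq_iff, ← hφ.ker, map_sub, app_res, hb] at h1
  exact sub_eq_zero.1 h1

/-- The sections on `U` are complete for the filtration by `locPow`. As `φ` is surjective on `U`,
every symbol is realized by global coefficients on `U`; so this filtration is the `I`-adic one, and
`flat_of_coeff_mem` applies. -/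
theorem IsDefSheaf.isDefMod [IsNoetherianRing R] [I.IsMaximal] [IsAdicComplete I R]
    (hφ : IsDefSheaf I φ) (hN : TopCat.Presheaf.IsSheaf N) (hU : CechVanishes N U) :
    IsDefMod I (φ.app (op U)).hom := by
  have hsurj := hφ.app_surjective hN hU
  have hfil : IsCompleteFiltration I fun n => locPow I F n U :=
    { sep := fun x hx => hφ.complete.eq_zero hx
      complete := fun f hf => hφ.complete.exists_limit f hf
      pow := le_locPow
      anti := fun i => locPow_anti (Nat.le_succ i)
      gen := fun i x hx => by
        obtain ⟨r, e, he⟩ := exists_isGrBasis I i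
        obtain ⟨c, hc⟩ := hφ.exists_isSymbol hN he hx
        choose b hb using fun k => hsurj (c k)
        have h1 : IsSymbol I φ i e (∑ k, e k • b k) c := by
          convert isSymbol_app (φ := φ) b (show _ ∈ locPow I F (i + 1) U by
            rw [sub_self]; exact Submodule.zero_mem _) using 1
          exact funext fun k => (hb k).symm
        have h2 := hφ.sub_mem_of_isSymbol he hc h1
        rw [← add_sub_cancel (∑ k, e k • b k) x]
        exact Submodule.add_mem_sup (he.sum_mem (j := 0) fun k => by simp) h2 }
  have := hfil.isAdicComplete
  have hker : ∀ x, (φ.app (op U)).hom x = 0 ↔ x ∈ (I • ⊤ : Submodule R (F.obj (op U))) :=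
    fun x => by rw [hφ.ker, hfil.eq_smul_top, pow_one]
  refine ⟨flat_of_coeff_mem (I := I) fun i r e he x hx k => ?_, this, hsurj, hker⟩
  rw [← hker]
  exact hφ.app_eq_zero he (le_locPow _ hx) k

theorem isFlatThickening_of_basis (hN : TopCat.Presheaf.IsSheaf N) (ℬ : Set (Opens X))
    (hℬ : Opens.IsBasis ℬ) (h : ∀ U ∈ ℬ, IsDefMod I (φ.app (op U)).hom) :
    IsFlatThickening I φ where
  flat := isFlat_of_basis ℬ hℬ fun U hU => (h U hU).flat
  locSurj := fun {U} n x hx => by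
    obtain ⟨B, hB, hxB, hBU⟩ := Opens.isBasis_iff_nbhd.1 hℬ hx
    obtain ⟨a, ha⟩ := (h B hB).surj (res N hBU n)
    exact ⟨B, hBU, hxB, a, ha⟩
  ker := fun {U} a => by
    constructor
    · intro ha x hx
      obtain ⟨B, hB, hxB, hBU⟩ := Opens.isBasis_iff_nbhd.1 hℬ hx
      refine ⟨B, hBU, hxB, ?_⟩
      rw [pow_one, ← (h B hB).ker, app_res, ha, map_zero]
    · intro ha
      refine section_ext hN fun x hx => ?_
      obtain ⟨V, hV, hxV, ha⟩ := ha x hx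
      obtain ⟨B, hB, hxB, hBV⟩ := Opens.isBasis_iff_nbhd.1 hℬ hxV
      refine ⟨B, hBV.trans hV, hxB, ?_⟩
      have h1 := map_mem_smul_top (res F hBV) ha
      rw [pow_one, ← (h B hB).ker, res_res, app_res] at h1
      rw [h1, map_zero]

/-- Leading coefficients of a section that is locally of higher order are killed by `φ`, hence lie
in `I` times the sections on `U` itself; the order goes up by one globally as well. -/
theorem IsFlatThickening.locPow_le [IsNoetherianRing R] [I.IsMaximal]
    (hφ : IsFlatThickening I φ) (h : IsDefMod I (φ.app (op U)).hom) (n : ℕ) :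
    locPow I F n U ≤ (I ^ n • ⊤ : Submodule R (F.obj (op U))) := by
  induction n with
  | zero => simp
  | succ n ih =>
    intro d hd
    obtain ⟨r, e, he⟩ := exists_isGrBasis I n
    obtain ⟨b, hb⟩ := he.exists_sum (ih (locPow_anti (Nat.le_succ n) hd))
    have h1 := sub_mem hd (le_locPow _ hb)
    rw [sub_sub_cancel] at h1
    have h2 : ∀ k, b k ∈ (I ^ 1 • ⊤ : Submodule R (F.obj (op U))) := fun k => by
      rw [pow_one, ← h.ker]
      exact hφ.app_eq_zero he h1 k
    have := add_mem hb (he.sum_mem 1 h2)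
    rwa [sub_add_cancel] at this

/-- A preimage at one level fails at the next by a section with a symbol in `N(U)`; the components
of the symbol lift to `U` by surjectivity, and adding `∑ e_k b_k` repairs the failure. -/
theorem IsFlatThickening.exists_toTr_eq [IsNoetherianRing R] [I.IsMaximal]
    (hφ : IsFlatThickening I φ) (hN : TopCat.Presheaf.IsSheaf N)
    (hsurj : Function.Surjective (φ.app (op U)).hom) (i : ℕ) (t : (trunc I F i).obj (op U)) :
    ∃ a, toTr I F U i a = t := by
  induction i with
  | zero =>
    obtain ⟨n, hn⟩ := exists_glue_of_unique hN (U := U)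
      (fun V hV b => ∃ a, toTr I F V 0 a = res _ hV t ∧ (φ.app (op V)).hom a = b) (by
        rintro V W hV h _ ⟨a, ha, rfl⟩
        exact ⟨res F h a, by rw [toTr_res, ha, res_res], app_res _ _ _⟩) (by
        rintro V hV _ _ ⟨a, ha, rfl⟩ ⟨b, hb, rfl⟩
        rw [← sub_eq_zero, ← map_sub, hφ.ker]
        exact (toTr_eq_iff 0).1 (ha.trans hb.symm)) (by
        intro x hx
        obtain ⟨V, hV, hxV, a, ha⟩ := exists_toTr 0 t hx
        exact ⟨V, hV, hxV, _, a, ha, rfl⟩)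
    obtain ⟨a, rfl⟩ := hsurj n
    refine ⟨a, section_ext (trunc_isSheaf I F 0) fun x hx => ?_⟩
    obtain ⟨V, hV, hxV, b, hb⟩ := exists_toTr 0 t hx
    refine ⟨V, hV, hxV, ?_⟩
    rw [← hb, ← toTr_res, toTr_eq_iff, ← hφ.ker, map_sub, app_res, hn V hV _ ⟨b, hb, rfl⟩, sub_self]
  | succ i ih =>
    obtain ⟨a, ha⟩ := ih (trMap I F U i t)
    obtain ⟨r, e, he⟩ := exists_isGrBasis I (i + 1)
    obtain ⟨c, hc⟩ := hφ.exists_isSymbol_trunc hN he (t - toTr I F U (i + 1) a) (by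
      rw [map_sub, trMap_toTr, ha, sub_self])
    choose b hb using fun k => hsurj (c k)
    refine ⟨a + ∑ k, e k • b k, section_ext (trunc_isSheaf I F (i + 1)) fun x hx => ?_⟩
    obtain ⟨V, hV, hxV, d, hd⟩ := exists_toTr (i + 1) (t - toTr I F U (i + 1) a) hx
    have h0 : d ∈ locPow I F (i + 1) V := by
      rw [← toTr_eq_zero_iff, ← trMap_toTr, hd, trMap_res, map_sub, trMap_toTr, ha, sub_self,
        map_zero]
    obtain ⟨c', hc'⟩ := hφ.exists_isSymbol hN he h0
    refine ⟨V, hV, hxV, ?_⟩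
    have h1 : IsSymbol I φ (i + 1) e (res F hV (∑ k, e k • b k)) c' := by
      convert (isSymbol_app (φ := φ) b (show _ ∈ locPow I F (i + 1 + 1) U by
        rw [sub_self]; exact Submodule.zero_mem _)).res hV using 1
      exact funext fun k => by rw [hb, hc V hV d c' hd hc']
    have h2 := (toTr_eq_iff (i + 1)).2 (hφ.sub_mem_of_isSymbol he hc' h1)
    rw [hd, map_sub, sub_eq_iff_eq_add] at h2
    rw [h2, map_add, map_add, toTr_res]
    exact add_comm _ _

/-- On a basic open set a compatible family in the truncations comes from a convergent sequence of
sections. Sections are determined by their truncations, so the limits on basic open sets glue over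
any open set. -/
theorem isDefSheaf_of_basis [IsNoetherianRing R] [I.IsMaximal] (hF : TopCat.Presheaf.IsSheaf F)
    (hN : TopCat.Presheaf.IsSheaf N) (ℬ : Set (Opens X)) (hℬ : Opens.IsBasis ℬ)
    (h : ∀ U ∈ ℬ, IsDefMod I (φ.app (op U)).hom) : IsDefSheaf I φ := by
  have hφ := isFlatThickening_of_basis hN ℬ hℬ h
  have hsep : ∀ {U : Opens X} (a : F.obj (op U)), (∀ i, a ∈ locPow I F (i + 1) U) → a = 0 := by
    intro U a ha
    refine section_ext hF fun x hx => ?_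
    obtain ⟨B, hB, hxB, hBU⟩ := Opens.isBasis_iff_nbhd.1 hℬ hx
    refine ⟨B, hBU, hxB, ?_⟩
    have := (h B hB).complete
    rw [map_zero]
    exact eq_zero_of_forall_mem (I := I) fun i => mem_smul_top_of_succ
      (hφ.locPow_le (h B hB) _ (res_mem_locPow hBU (ha i)))
  have huniq : ∀ {U : Opens X} (a b : F.obj (op U)),
      (∀ i, toTr I F U i a = toTr I F U i b) → a = b := fun a b hab =>
    sub_eq_zero.1 (hsep _ fun i => (toTr_eq_iff i).1 (hab i))
  have hbasic : ∀ B ∈ ℬ, ∀ s : ∀ i, (trunc I F i).obj (op B),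
      (∀ i, trMap I F B i (s (i + 1)) = s i) → ∃ a, ∀ i, toTr I F B i a = s i := by
    intro B hB s hs
    have := (h B hB).complete
    choose b hb using fun i => hφ.exists_toTr_eq hN (h B hB).surj i (s i)
    obtain ⟨a, ha⟩ := exists_limit (I := I) b fun i => mem_smul_top_of_succ
      (hφ.locPow_le (h B hB) (i + 1) ((toTr_eq_iff i).1 (by
        rw [← trMap_toTr, hb, hb, hs])))
    refine ⟨a, fun i => ?_⟩
    rw [← hs i, ← hb (i + 1), trMap_toTr, toTr_eq_iff]
    exact le_locPow _ (ha (i + 1))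
  refine ⟨hφ, fun U s hs => ?_⟩
  have hex : ∀ x ∈ U.unop, ∃ (V : Opens X) (hV : V ≤ U.unop), x ∈ V ∧
      ∃ b : F.obj (op V), ∀ i, toTr I F V i b = res _ hV (s i) := by
    intro x hx
    obtain ⟨B, hB, hxB, hBU⟩ := Opens.isBasis_iff_nbhd.1 hℬ hx
    obtain ⟨b, hb⟩ := hbasic B hB (fun i => res _ hBU (s i)) fun i => by
      rw [trMap_res]
      exact congrArg _ (hs i)
    exact ⟨B, hBU, hxB, b, hb⟩
  obtain ⟨a, ha⟩ := exists_glue_of_unique hF (U := U.unop)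
    (fun V hV b => ∀ i, toTr I F V i b = res _ hV (s i)) (by
      intro V W hV h b hb i
      rw [toTr_res, hb, res_res]) (by
      intro V hV b b' hb hb'
      exact huniq b b' fun i => (hb i).trans (hb' i).symm) hex
  have ha' : ∀ i, toTr I F U.unop i a = s i := fun i =>
    section_ext (trunc_isSheaf I F i) fun x hx => by
      obtain ⟨V, hV, hxV, b, hb⟩ := hex x hx
      exact ⟨V, hV, hxV, by rw [← hb i, ← toTr_res, ha V hV b hb]⟩
  exact ⟨a, ha', fun b hb => huniq _ _ fun i => (hb i).trans (ha' i).symm⟩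

end Sections

end Deformation
end

noncomputable section
namespace Deformation

/-! ### Integral affine schemes -/

section Scheme

variable (X : Scheme.{u})

/-- The restriction of regular functions. -/
def fres {U V : X.Opens} (h : V ≤ U) : Γ(X, U) →+* Γ(X, V) :=
  (X.presheaf.map (homOfLE h).op).hom

variable {X} in
@[simp]
theorem fres_fres {U V W : X.Opens} (h : V ≤ U) (h' : W ≤ V) (a : Γ(X, U)) :
    fres X h' (fres X h a) = fres X (h'.trans h) a := by
  unfold fres
  rw [← RingHom.comp_apply, ← CommRingCat.hom_comp, ← X.presheaf.map_comp]
  rfl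

/-- A prime ideal containing all `g k` but not `s` would be a point of `D(s)` outside every `D(g
k)`. -/
theorem mem_radical_span [IsAffine X] (s : Γ(X, ⊤)) {ι : Type*} (g : ι → Γ(X, ⊤))
    (h : ∀ x ∈ X.basicOpen s, ∃ k, x ∈ X.basicOpen (g k)) :
    s ∈ (Ideal.span (Set.range g)).radical := by
  rw [Ideal.radical_eq_sInf, Ideal.mem_sInf]
  rintro p ⟨hp, hprime⟩
  by_contra hs
  let y : Spec Γ(X, ⊤) := (⟨p, hprime⟩ : PrimeSpectrum Γ(X, ⊤))
  have key : ∀ f : Γ(X, ⊤), (isAffineOpen_top X).fromSpec y ∈ X.basicOpen f ↔ f ∉ p := by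
    intro f
    change y ∈ (isAffineOpen_top X).fromSpec ⁻¹ᵁ X.basicOpen f ↔ f ∉ p
    rw [(isAffineOpen_top X).fromSpec_preimage_basicOpen f]
    exact PrimeSpectrum.mem_basicOpen f _
  obtain ⟨k, hk⟩ := h _ ((key s).2 hs)
  exact (key _).1 hk (hp (Ideal.subset_span ⟨k, rfl⟩))

variable {X}

theorem ne_zero_of_mem_basicOpen {s : Γ(X, ⊤)} {x : X} (hx : x ∈ X.basicOpen s) : s ≠ 0 := by
  rintro rfl
  rw [Scheme.basicOpen_zero] at hx
  exact hx

theorem isUnit_fres {U : X.Opens} {s : Γ(X, ⊤)} (h : U ≤ X.basicOpen s) :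
    IsUnit (fres X (le_top : U ≤ ⊤) s) := by
  have h1 : IsUnit (fres X (le_top : X.basicOpen s ≤ ⊤) s) :=
    RingedSpace.isUnit_res_basicOpen X.toRingedSpace s
  have := h1.map (fres X h)
  rwa [fres_fres] at this

theorem exists_pow_mul_eq [IsAffine X] (s : Γ(X, ⊤)) (v : Γ(X, X.basicOpen s)) :
    ∃ (n : ℕ) (a : Γ(X, ⊤)), fres X le_top s ^ n * v = fres X le_top a := by
  have := (isAffineOpen_top X).isLocalization_basicOpen s
  obtain ⟨n, a, h⟩ := IsLocalization.Away.surj s v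
  exact ⟨n, a, by rw [mul_comm]; exact h⟩

variable [IsIntegral X]

variable (X) in

theorem genericPoint_mem {U : X.Opens} {x : X} (hx : x ∈ U) : genericPoint X ∈ U :=
  ((genericPoint_spec X).mem_open_set_iff U.isOpen).2 ⟨x, trivial, hx⟩

/-- The rational function defined by a regular function on a nonempty open set. -/
def ratl {U : X.Opens} (hU : genericPoint X ∈ U) : Γ(X, U) →+* X.functionField :=
  (X.presheaf.germ U (genericPoint X) hU).hom

theorem ratl_injective {U : X.Opens} (hU : genericPoint X ∈ U) : Function.Injective (ratl hU) :=
  germ_injective_of_isIntegral X _ hU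

theorem ratl_fres {U V : X.Opens} (h : V ≤ U) (hV : genericPoint X ∈ V) (a : Γ(X, U)) :
    ratl hV (fres X h a) = ratl (h hV) a :=
  X.presheaf.germ_res_apply (homOfLE h) (genericPoint X) hV a

variable (X) in

/-- The homomorphism from regular functions to rational functions. -/
abbrev ratlTop : Γ(X, ⊤) →+* X.functionField := ratl (U := ⊤) trivial

theorem genericPoint_mem_basicOpen {s : Γ(X, ⊤)} (hs : s ≠ 0) : genericPoint X ∈ X.basicOpen s := by
  have : X.basicOpen s ≠ ⊥ := by rwa [Ne, basicOpen_eq_bot_iff]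
  obtain ⟨x, hx⟩ := Opens.ne_bot_iff_nonempty _ |>.1 this
  exact genericPoint_mem X hx

theorem ratl_ne_zero {U : X.Opens} (hU : genericPoint X ∈ U) {s : Γ(X, U)} (hs : s ≠ 0) :
    ratl hU s ≠ 0 :=
  (map_ne_zero_iff _ (ratl_injective hU)).2 hs

theorem exists_fraction [IsAffine X] (l : X.functionField) :
    ∃ s : Γ(X, ⊤), s ≠ 0 ∧ ∃ a, ratlTop X s * l = ratlTop X a := by
  have : Nonempty (⊤ : X.Opens) := ⟨⟨genericPoint X, trivial⟩⟩
  have := functionField_isFractionRing_of_isAffineOpen X ⊤ (isAffineOpen_top X)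
  obtain ⟨a, s, hs, rfl⟩ := IsFractionRing.div_surjective (A := Γ(X, ⊤)) l
  have hs0 : s ≠ 0 := nonZeroDivisors.ne_zero hs
  refine ⟨s, hs0, a, ?_⟩
  exact mul_div_cancel₀ (ratlTop X a) (ratl_ne_zero (U := ⊤) trivial hs0)

theorem ratl_fres_top {U : X.Opens} (hU : genericPoint X ∈ U) (a : Γ(X, ⊤)) :
    ratl hU (fres X le_top a) = ratlTop X a :=
  ratl_fres _ _ _

theorem exists_ratl_eq {U : X.Opens} (hU : genericPoint X ∈ U) {s a : Γ(X, ⊤)}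
    (hs : U ≤ X.basicOpen s) {l : X.functionField} (h : ratlTop X s * l = ratlTop X a) :
    ∃ v, ratl hU v = l := by
  obtain ⟨w, hw⟩ := isUnit_fres hs
  refine ⟨((w⁻¹ : Γ(X, U)ˣ) : Γ(X, U)) * fres X le_top a, ?_⟩
  rw [map_mul, ratl_fres_top, ← h, ← ratl_fres_top hU, ← hw, ← mul_assoc, ← map_mul, w.inv_mul,
    map_one, one_mul]

/-- The global functions `c` for which `c l` is a global function form an ideal. The available
denominators cover `D(s)`, so this ideal contains a power of `s`. -/
theorem exists_ratl_eq_of_forall [IsAffine X] {s : Γ(X, ⊤)} (hs : genericPoint X ∈ X.basicOpen s)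
    {l : X.functionField} (h : ∀ x ∈ X.basicOpen s, ∃ b a : Γ(X, ⊤), x ∈ X.basicOpen b ∧
      ratlTop X b * l = ratlTop X a) : ∃ v, ratl hs v = l := by
  choose b a hb hl using fun x : X.basicOpen s => h x x.2
  obtain ⟨n, hn⟩ := mem_radical_span X s b fun x hx => ⟨⟨x, hx⟩, hb _⟩
  have hJ : ∀ c ∈ Ideal.span (Set.range b), ∃ a, ratlTop X c * l = ratlTop X a := by
    intro c hc
    induction hc using Submodule.span_induction with
    | mem c hc =>
      obtain ⟨k, rfl⟩ := hc
      exact ⟨a k, hl k⟩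
    | zero => exact ⟨0, by simp⟩
    | add c d _ _ h h' =>
      obtain ⟨a, ha⟩ := h
      obtain ⟨a', ha'⟩ := h'
      exact ⟨a + a', by rw [map_add, map_add, add_mul, ha, ha']⟩
    | smul r c _ h =>
      obtain ⟨a, ha⟩ := h
      exact ⟨r * a, by rw [smul_eq_mul, map_mul, map_mul, mul_assoc, ha]⟩
  obtain ⟨a, ha⟩ := hJ _ hn
  refine exists_ratl_eq hs ?_ ha
  rcases n.eq_zero_or_pos with rfl | hn
  · rw [pow_zero, Scheme.basicOpen_one]; exact le_top
  · rw [Scheme.basicOpen_pow _ _ hn]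

/-- Čech 1-cocycles of regular functions on coverings by finitely many basic open sets are
coboundaries. -/
theorem exists_coboundary [IsAffine X] (s : Γ(X, ⊤)) {ι : Type*} [Finite ι] (g : ι → Γ(X, ⊤))
    (hgs : ∀ k, X.basicOpen (g k) ≤ X.basicOpen s) (hg : ∀ k, g k ≠ 0)
    (hcov : ∀ x ∈ X.basicOpen s, ∃ k, x ∈ X.basicOpen (g k))
    (hη : ∀ j k, genericPoint X ∈ X.basicOpen (g j) ⊓ X.basicOpen (g k))
    (c : ∀ j k, Γ(X, X.basicOpen (g j) ⊓ X.basicOpen (g k)))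
    (hc : ∀ j k l, ratl (hη j k) (c j k) + ratl (hη k l) (c k l) = ratl (hη j l) (c j l)) :
    ∃ β : ∀ k, Γ(X, X.basicOpen (g k)),
      ∀ j k, c j k = fres X inf_le_left (β j) - fres X inf_le_right (β k) := by
  have := Fintype.ofFinite ι
  have hη' : ∀ k, genericPoint X ∈ X.basicOpen (g k) := fun k => genericPoint_mem_basicOpen (hg k)
  -- For large `m`, the product `g k ^ m` times `c j k` extends from `D(g j) ∩ D(g k)` to `D(g j)`.
  have h1 : ∀ j k, ∃ n : ℕ, ∀ m, n ≤ m →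
      ∃ v, ratl (hη' j) v = ratlTop X (g k) ^ m * ratl (hη j k) (c j k) := by
    intro j k
    have hjk : X.basicOpen (g j * g k) ≤ X.basicOpen (g j) ⊓ X.basicOpen (g k) :=
      (Scheme.basicOpen_mul _ _ _).le
    obtain ⟨n, a, h⟩ := exists_pow_mul_eq (g j * g k) (fres X hjk (c j k))
    refine ⟨n, fun m hm => ?_⟩
    have hη2 : genericPoint X ∈ X.basicOpen (g j * g k) := by
      rw [Scheme.basicOpen_mul]; exact hη j k
    have h2 := congrArg (ratl hη2) h
    rw [map_mul, map_pow, ratl_fres_top, ratl_fres_top, ratl_fres] at h2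
    refine exists_ratl_eq (hη' j) (s := g j ^ (n + 1)) (a := g j * a * g k ^ (m - n))
      (by rw [Scheme.basicOpen_pow _ _ (Nat.succ_pos n)]) ?_
    obtain ⟨d, rfl⟩ := Nat.exists_eq_add_of_le hm
    rw [Nat.add_sub_cancel_left, map_mul, map_mul, ← h2]
    simp only [map_mul, map_pow]
    ring
  choose n hn using h1
  -- One exponent for all pairs; adding 1 makes it positive, so that `g k ^ M` and `g k` have the
  -- same basic open set.
  let M := (∑ j, ∑ k, n j k) + 1
  have hM : ∀ j k, n j k ≤ M := fun j k =>
    ((Finset.single_le_sum (f := fun k => n j k) (fun _ _ => Nat.zero_le _)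
      (Finset.mem_univ k)).trans (Finset.single_le_sum (f := fun j => ∑ k, n j k)
        (fun _ _ => Nat.zero_le _) (Finset.mem_univ j))).trans (Nat.le_succ _)
  choose v hv using fun j k => hn j k M (hM j k)
  obtain ⟨q, hq⟩ := mem_radical_span X s (fun k => g k ^ M) fun x hx => by
    obtain ⟨k, hk⟩ := hcov x hx
    exact ⟨k, by rwa [Scheme.basicOpen_pow _ _ (Nat.succ_pos _)]⟩
  obtain ⟨a, ha⟩ := (Submodule.mem_span_range_iff_exists_fun Γ(X, ⊤)).1 hq
  choose w hw using fun k => isUnit_fres (hgs k)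
  -- From the partition of unity `s ^ q = ∑ a k * g k ^ M`, the bounding cochain is `β j = s ^ (-q)
  -- ∑ a k * g k ^ M * c j k`.
  refine ⟨fun j => ((w j ^ q)⁻¹ : _ˣ) * ∑ k, fres X le_top (a k) * v j k, fun j k => ?_⟩
  have hsne : ratlTop X s ≠ 0 := by
    intro h0
    have : s = 0 := ratl_injective (U := ⊤) trivial (h0.trans (map_zero _).symm)
    subst this
    have := hgs j (hη' j)
    rw [Scheme.basicOpen_zero] at this
    exact this
  have hβ : ∀ j, ratlTop X s ^ q * ratl (hη' j)
      (((w j ^ q)⁻¹ : _ˣ) * ∑ k, fres X le_top (a k) * v j k) =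
        ∑ k, ratlTop X (a k) * (ratlTop X (g k) ^ M * ratl (hη j k) (c j k)) := by
    intro j
    rw [← ratl_fres_top (hη' j), ← hw, ← map_pow, ← map_mul, ← mul_assoc, ← Units.val_pow_eq_pow_val,
      Units.mul_inv, one_mul, map_sum]
    exact Finset.sum_congr rfl fun k _ => by rw [map_mul, ratl_fres_top, hv]
  apply ratl_injective (hη j k)
  rw [map_sub, ratl_fres, ratl_fres]
  apply mul_left_cancel₀ (pow_ne_zero q hsne)
  rw [mul_sub, hβ, hβ, ← Finset.sum_sub_distrib, ← map_pow, ← ha, map_sum, Finset.sum_mul]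
  refine Finset.sum_congr rfl fun l _ => ?_
  rw [← hc j k l, smul_eq_mul, map_mul, map_pow]
  ring

end Scheme

end Deformation
end

noncomputable section
namespace Deformation

/-! ### Gluing from a basis of open sets -/

section Basis

variable {R : Type u} [CommRing R] {X : TopCat.{u}} {F : TopCat.Presheaf (ModuleCat.{u} R) X}
  {ℬ : Set (Opens X)} {U : Opens X}

theorem section_ext_of_basis (hℬ : Opens.IsBasis ℬ) (hF : TopCat.Presheaf.IsSheaf F)
    {a b : F.obj (op U)} (h : ∀ B ∈ ℬ, ∀ hB : B ≤ U, res F hB a = res F hB b) : a = b :=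
  section_ext hF fun _ hx => by
    obtain ⟨B, hB, hxB, hBU⟩ := Opens.isBasis_iff_nbhd.1 hℬ hx
    exact ⟨B, hBU, hxB, h B hB hBU⟩

theorem exists_glue_of_basis (hℬ : Opens.IsBasis ℬ) (hF : TopCat.Presheaf.IsSheaf F)
    (g : ∀ B ∈ ℬ, B ≤ U → F.obj (op B))
    (hg : ∀ B hB hBU B' hB', ∀ h : B' ≤ B, res F h (g B hB hBU) = g B' hB' (h.trans hBU)) :
    ∃ a : F.obj (op U), ∀ B hB hBU, res F hBU a = g B hB hBU := by
  obtain ⟨a, ha⟩ := exists_glue_of_unique hF (U := U)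
    (fun V hV b => ∀ B hB, ∀ h : B ≤ V, res F h b = g B hB (h.trans hV))
    (fun hV h a ha B hB hBW => by rw [res_res, ha])
    (fun hV a b ha hb => section_ext_of_basis hℬ hF fun B hB hBV => by rw [ha B hB, hb B hB])
    (fun x hx => by
      obtain ⟨B, hB, hxB, hBU⟩ := Opens.isBasis_iff_nbhd.1 hℬ hx
      exact ⟨B, hBU, hxB, g B hB hBU, fun B' hB' h => hg _ _ _ _ _ _⟩)
  exact ⟨a, fun B hB hBU => ha B hBU _ fun B' hB' h => hg _ _ _ _ _ _⟩

end Basis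

/-! ### Sections of a deformation on basic open sets -/

section Variety

variable {K : Type u} [Field K] {X : Scheme.{u}} (f : X ⟶ Spec (CommRingCat.of K))
  {R : Type u} [CommRing R] [Algebra K R] [IsParameterAlgebra K R]

variable (X) in

/-- The nonempty basic open sets. -/
def basicOpens : Set X.Opens := {U | ∃ s : Γ(X, ⊤), s ≠ 0 ∧ X.basicOpen s = U}

theorem isBasis_basicOpens [IsAffine X] : Opens.IsBasis (basicOpens X) := by
  rw [Opens.isBasis_iff_nbhd]
  intro U x hx
  obtain ⟨_, ⟨s, rfl⟩, hxs, hs⟩ := Opens.isBasis_iff_nbhd.1 (isBasis_basicOpen X) hx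
  exact ⟨_, ⟨s, ne_zero_of_mem_basicOpen hxs, rfl⟩, hxs, hs⟩

variable (R) in

/-- The structure sheaf, as a sheaf of modules over the parameter algebra. -/
abbrev structureMod : TopCat.Presheaf (ModuleCat.{u} R) X.toPresheafedSpace.carrier :=
  ((structureSheaf f).pre ⋙ commToMod K) ⋙ ModuleCat.restrictScalars (augmentation K R)

theorem structureMod_isSheaf : TopCat.Presheaf.IsSheaf (structureMod f R) :=
  (Presheaf.isSheaf_iff_isSheaf_comp (Opens.grothendieckTopology X) (structureMod f R)
    (forget (ModuleCat.{u} R))).2 (structureSheaf f).isSheaf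

/-- A basic open set is quasi-compact, so any covering is refined by finitely many basic open sets;
there the cocycle condition can be read in the function field and `exists_coboundary` applies. -/
theorem cechVanishes_basicOpen [IsAffine X] [IsIntegral X] (s : Γ(X, ⊤)) :
    CechVanishes (structureMod f R) (X.basicOpen s) := by
  intro V hV
  have h1 : ∀ x : X.basicOpen s, ∃ g : Γ(X, ⊤), (x : X) ∈ X.basicOpen g ∧
      X.basicOpen g ≤ V x ⊓ X.basicOpen s := fun x => by
    obtain ⟨_, ⟨g, rfl⟩, hxg, hg⟩ := Opens.isBasis_iff_nbhd.1 (isBasis_basicOpen X)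
      (show (x : X) ∈ V x ⊓ X.basicOpen s from ⟨hV x, x.2⟩)
    exact ⟨g, hxg, hg⟩
  choose g hxg hg using h1
  obtain ⟨T, hT⟩ := ((isAffineOpen_top X).basicOpen s).isCompact.elim_finite_subcover
    (fun x => (X.basicOpen (g x) : Set X)) (fun x => (X.basicOpen (g x)).2)
    (fun x hx => Set.mem_iUnion.2 ⟨⟨x, hx⟩, hxg _⟩)
  have hcov : ∀ x ∈ X.basicOpen s, ∃ k : T, x ∈ X.basicOpen (g k) := fun x hx => by
    obtain ⟨k, hk, hx⟩ := Set.mem_iUnion₂.1 (hT hx)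
    exact ⟨⟨k, hk⟩, hx⟩
  have hη : ∀ j k : T, genericPoint X ∈ X.basicOpen (g j) ⊓ X.basicOpen (g k) := fun j k =>
    ⟨genericPoint_mem X (hxg j), genericPoint_mem X (hxg k)⟩
  refine ⟨T, fun k => X.basicOpen (g k), fun k => k, fun k => (hg k).trans inf_le_left,
    fun k => (hg k).trans inf_le_right, hcov, fun (c : ∀ j k : T, Γ(X, X.basicOpen (g j) ⊓ X.basicOpen (g k))) hc => ?_⟩
  refine exists_coboundary s (fun k : T => g k) (fun k => (hg k).trans inf_le_right)
    (fun k => ne_zero_of_mem_basicOpen (hxg k)) hcov hη c fun j k l => ?_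
  have hη3 : genericPoint X ∈ X.basicOpen (g j) ⊓ X.basicOpen (g k) ⊓ X.basicOpen (g l) :=
    ⟨hη j k, (hη j l).2⟩
  have h2 := congrArg (ratl hη3) (show fres X inf_le_left (c j k) +
    fres X (inf_le_inf_right _ inf_le_right) (c k l) =
      fres X (inf_le_inf_right _ inf_le_left) (c j l) from hc j k l)
  rwa [map_add, ratl_fres, ratl_fres, ratl_fres] at h2

variable {f} (A : AugAssSheaf R (structureSheaf f))

/-- The restriction homomorphisms of a sheaf of algebras. -/
def AugAssSheaf.res {U V : X.Opens} (h : V ≤ U) : A.pre.obj (op U) →ₐ[R] A.pre.obj (op V) :=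
  (A.pre.map (homOfLE h).op).hom

variable (f R) in

/-- The regular functions on `U`, as an `R`-algebra. -/
abbrev regular (U : X.Opens) : CommAlgCat.{u} R := viaAug R ((structureSheaf f).pre.obj (op U))

variable (f R) in

/-- The restriction of regular functions, as a homomorphism of `R`-algebras. -/
def rres {U V : X.Opens} (h : V ≤ U) : regular f R U →ₐ[R] regular f R V :=
  (((structureSheaf f).pre ⋙ restrictAlg (augmentation K R)).map (homOfLE h).op).hom

/-- The augmentation of the algebra of sections. -/
def AugAssSheaf.augHom (U : X.Opens) : A.pre.obj (op U) →ₐ[R] regular f R U :=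
  (A.aug.app (op U)).hom

variable (f R) in

/-- The identification of regular functions. -/
def regularEquiv (U : X.Opens) : regular f R U ≃+* Γ(X, U) := RingEquiv.refl Γ(X, U)

variable {A}

theorem AugAssSheaf.augHom_res {U V : X.Opens} (h : V ≤ U) (a : A.pre.obj (op U)) :
    A.augHom V (A.res h a) = rres f R h (A.augHom U a) :=
  congrArg (fun g => g.hom a) (A.aug.naturality (homOfLE h).op)

variable (A) in

/-- The underlying sheaf of modules. -/
abbrev AugAssSheaf.mod : TopCat.Presheaf (ModuleCat.{u} R) X.toPresheafedSpace.carrier :=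
  A.pre ⋙ assToMod R

variable (A) in

theorem AugAssSheaf.mod_isSheaf : TopCat.Presheaf.IsSheaf A.mod :=
  (Presheaf.isSheaf_iff_isSheaf_comp (Opens.grothendieckTopology X) A.mod
    (forget (ModuleCat.{u} R))).2 A.isSheaf

variable (A) in

/-- The augmentation, as a homomorphism of sheaves of modules. -/
abbrev AugAssSheaf.augMod : A.mod ⟶ structureMod f R := Functor.whiskerRight A.aug (assToMod R)

variable (K R) in

theorem paramIdeal_isMaximal : (paramIdeal K R).IsMaximal :=
  have : IsLocalRing R := IsParameterAlgebra.isLocalRing K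
  inferInstanceAs (IsLocalRing.maximalIdeal R).IsMaximal

variable (K R) in

theorem paramIdeal_isAdicComplete : IsAdicComplete (paramIdeal K R) R :=
  IsParameterAlgebra.isAdicComplete (K := K)

theorem isAssDefSheaf_iff : isAssDefSheaf R (structureSheaf f) A ↔
    IsDefSheaf (paramIdeal K R) A.augMod :=
  isDeformationSheaf_iff (structureSheaf f).isSheaf_mod _

theorem isAssDef_iff {C : CommAlgCat.{u} K} (B : AugAss R C) :
    isAssDef R C B ↔ IsDefMod (paramIdeal K R) ((assToMod R).map B.aug).hom :=
  isDeformationModule_iff _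

variable (f) in

/-- The elements of an augmented algebra whose augmentation vanishes nowhere on `U`. -/
def nonvanishing {B : Type*} [Ring B] [Algebra R B] (π : B →ₐ[R] regular f R ⊤) (U : X.Opens) :
    Submonoid B where
  carrier := {a | U ≤ X.basicOpen (regularEquiv f R ⊤ (π a))}
  one_mem' := by
    change U ≤ _
    rw [map_one, map_one, Scheme.basicOpen_one]
    exact le_top
  mul_mem' := fun {a b} ha hb => by
    change U ≤ _
    rw [map_mul, map_mul, Scheme.basicOpen_mul]
    exact le_inf ha hb

theorem isUnit_rres {U : X.Opens} {a : regular f R ⊤}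
    (h : U ≤ X.basicOpen (regularEquiv f R ⊤ a)) :
    IsUnit (rres f R (le_top : U ≤ ⊤) a) := isUnit_fres h

theorem rres_injective [IsIntegral X] {U V : X.Opens} (h : V ≤ U) (hV : genericPoint X ∈ V) :
    Function.Injective (rres f R h) := by
  intro a b hab
  apply ratl_injective (h hV)
  exact ((ratl_fres h hV a).symm.trans (congrArg (ratl hV) hab)).trans (ratl_fres h hV b)

variable [IsAffine X] [IsIntegral X]

theorem isDefMod_augHom_basicOpen (hA : isAssDefSheaf R (structureSheaf f) A) (s : Γ(X, ⊤)) :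
    IsDefMod (paramIdeal K R) (A.augHom (X.basicOpen s)).toLinearMap := by
  have := IsParameterAlgebra.isNoetherianRing K (R := R)
  have := paramIdeal_isMaximal K R
  have := paramIdeal_isAdicComplete K R
  exact (isAssDefSheaf_iff.1 hA).isDefMod (structureMod_isSheaf f) (cechVanishes_basicOpen f s)

theorem isDefMod_augHom_top (hA : isAssDefSheaf R (structureSheaf f) A) :
    IsDefMod (paramIdeal K R) (A.augHom ⊤).toLinearMap := by
  have h := isDefMod_augHom_basicOpen hA 1
  rwa [Scheme.basicOpen_one] at h

/-- Beyond the deformation property, the conditions concern functions only: those on `D(s)` are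
fractions of global functions with powers of `s` as denominators, and restriction is injective
because `X` is integral. -/
theorem isDefLoc_res (hA : isAssDefSheaf R (structureSheaf f) A) {s : Γ(X, ⊤)} (hs : s ≠ 0) :
    IsDefLoc (paramIdeal K R) (A.augHom ⊤) (A.augHom (X.basicOpen s)) (A.res le_top)
      (nonvanishing f (A.augHom ⊤) (X.basicOpen s)) where
  left := isDefMod_augHom_top hA
  right := isDefMod_augHom_basicOpen hA s
  inj := fun a ha => by
    rw [AugAssSheaf.augHom_res] at ha
    exact (map_eq_zero_iff _ (rres_injective le_top (genericPoint_mem_basicOpen hs))).1 ha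
  unit := fun a ha => by
    rw [AugAssSheaf.augHom_res]
    exact isUnit_rres ha
  frac := fun v => by
    obtain ⟨n, a, h⟩ := exists_pow_mul_eq s (regularEquiv f R _ v)
    obtain ⟨t, ht⟩ := (isDefMod_augHom_top hA).surj ((regularEquiv f R ⊤).symm s)
    obtain ⟨b, hb⟩ := (isDefMod_augHom_top hA).surj ((regularEquiv f R ⊤).symm a)
    have ht' : A.augHom ⊤ t = (regularEquiv f R ⊤).symm s := ht
    have hb' : A.augHom ⊤ b = (regularEquiv f R ⊤).symm a := hb
    refine ⟨t ^ n, Submonoid.pow_mem _ ?_ n, b, ?_⟩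
    · change _ ≤ X.basicOpen (regularEquiv f R ⊤ (A.augHom ⊤ t))
      rw [ht']
      rfl
    · rw [AugAssSheaf.augHom_res, AugAssSheaf.augHom_res, map_pow, map_pow, ht', hb']
      exact h

end Variety

end Deformation
end

noncomputable section
namespace Deformation

/-! ### Extending gauge transformations from global sections to sheaves -/

section Extension

variable {K : Type u} [Field K] {X : Scheme.{u}} {f : X ⟶ Spec (CommRingCat.of K)}
  {R : Type u} [CommRing R] [Algebra K R] [IsParameterAlgebra K R]
  {A A' : AugAssSheaf R (structureSheaf f)}

/-- The restriction homomorphisms of a presheaf of algebras. -/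
def algRes (G : TopCat.Presheaf (AlgCat.{u} R) X.toPresheafedSpace.carrier) {U V : X.Opens}
    (h : V ≤ U) : G.obj (op U) →ₐ[R] G.obj (op V) :=
  (G.map (homOfLE h).op).hom

theorem algRes_algRes {G : TopCat.Presheaf (AlgCat.{u} R) X.toPresheafedSpace.carrier}
    {U V W : X.Opens} (h : V ≤ U) (h' : W ≤ V) (a : G.obj (op U)) :
    algRes G h' (algRes G h a) = algRes G (h'.trans h) a :=
  res_res (F := G ⋙ assToMod R) h h' a

theorem app_algRes {G G' : TopCat.Presheaf (AlgCat.{u} R) X.toPresheafedSpace.carrier}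
    (η : G ⟶ G') {U V : X.Opens} (h : V ≤ U) (a : G.obj (op U)) :
    (η.app (op V)).hom (algRes G h a) = algRes G' h ((η.app (op U)).hom a) :=
  congrArg (fun g => g.hom a) (η.naturality (homOfLE h).op)

variable [IsAffine X] [IsIntegral X]

/-- Sections are determined on basic open sets, and there a homomorphism is determined by its values
on global sections. The target is more general than a deformation, so that the statement also
applies to the structure sheaf and yields compatibility with augmentations. -/
theorem natTrans_ext (hA : isAssDefSheaf R (structureSheaf f) A)
    {G : TopCat.Presheaf (AlgCat.{u} R) X.toPresheafedSpace.carrier}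
    (hG : TopCat.Presheaf.IsSheaf (G ⋙ assToMod R))
    (hH : ∀ s : Γ(X, ⊤), s ≠ 0 → IsHausdorff (paramIdeal K R) (G.obj (op (X.basicOpen s))))
    {η η' : A.pre ⟶ G} (h : ∀ a, (η.app (op ⊤)).hom a = (η'.app (op ⊤)).hom a) : η = η' := by
  refine NatTrans.ext (funext fun U => AlgCat.hom_ext _ (AlgHom.ext fun a => ?_))
  refine section_ext_of_basis (isBasis_basicOpens (X := X)) hG ?_
  rintro _ ⟨s, hs, rfl⟩ hsU
  change algRes G hsU ((η.app (op U.unop)).hom a) = algRes G hsU ((η'.app (op U.unop)).hom a)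
  have := hH s hs
  rw [← app_algRes, ← app_algRes]
  refine DFunLike.congr_fun ((isDefLoc_res hA hs).algHom_ext (f := (η.app _).hom)
    (g := (η'.app _).hom) fun b => ?_) _
  change (η.app _).hom (algRes _ _ b) = (η'.app _).hom (algRes _ _ b)
  rw [app_algRes, app_algRes, h]

/-- Elements whose augmentation vanishes nowhere on `D(s)` go to units of the target on `D(s)`, so
`h` extends there by the universal property. Uniqueness makes the extensions compatible with
restriction and with the algebra operations after gluing. -/
theorem exists_natTrans (hA : isAssDefSheaf R (structureSheaf f) A)
    (hA' : isAssDefSheaf R (structureSheaf f) A')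
    (h : A.pre.obj (op ⊤) →ₐ[R] A'.pre.obj (op ⊤)) (hh : ∀ a, A'.augHom ⊤ (h a) = A.augHom ⊤ a) :
    ∃ η : A.pre ⟶ A'.pre, ∀ a, (η.app (op ⊤)).hom a = h a := by
  have := IsParameterAlgebra.isNoetherianRing K (R := R)
  have := paramIdeal_isMaximal K R
  have hloc : ∀ s : Γ(X, ⊤), s ≠ 0 →
      ∃ g : A.pre.obj (op (X.basicOpen s)) →ₐ[R] A'.pre.obj (op (X.basicOpen s)),
        ∀ a, g (A.res le_top a) = A'.res le_top (h a) := by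
    intro s hs
    have hD := isDefMod_augHom_basicOpen hA' s
    have := hD.complete
    refine (isDefLoc_res hA hs).exists_lift ((A'.res le_top).comp h) fun a ha => ?_
    refine hD.isUnit ?_
    rw [AlgHom.comp_apply, AugAssSheaf.augHom_res, hh]
    exact isUnit_rres ha
  have hloc' : ∀ B : basicOpens X, ∃ g : A.pre.obj (op B) →ₐ[R] A'.pre.obj (op B),
        ∀ a, g (A.res le_top a) = A'.res le_top (h a) := by
    rintro ⟨_, s, hs, rfl⟩
    exact hloc s hs
  choose g hg using hloc'
  have hcompat : ∀ (B B' : basicOpens X) (hB : B'.1 ≤ B.1) (a : A.pre.obj (op B.1)),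
      A'.res hB (g B a) = g B' (A.res hB a) := by
    rintro ⟨_, s, hs, rfl⟩ ⟨_, s', hs', rfl⟩ hB a
    have := (isDefMod_augHom_basicOpen hA' s').complete
    refine DFunLike.congr_fun ((isDefLoc_res hA hs).algHom_ext
      (f := (A'.res hB).comp (g ⟨_, s, hs, rfl⟩))
      (g := (g ⟨_, s', hs', rfl⟩).comp (A.res hB)) fun b => ?_) a
    rw [AlgHom.comp_apply, AlgHom.comp_apply, hg]
    exact (algRes_algRes le_top hB (h b)).trans ((hg ⟨_, s', hs', rfl⟩ b).symm.trans
      (congrArg (g ⟨_, s', hs', rfl⟩) (algRes_algRes le_top hB b).symm))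
  have hex : ∀ (U : X.Opens) (a : A.pre.obj (op U)), ∃ b : A'.pre.obj (op U),
      ∀ (B : basicOpens X) (hB : B.1 ≤ U), A'.res hB b = g B (A.res hB a) := by
    intro U a
    obtain ⟨b, hb⟩ := exists_glue_of_basis isBasis_basicOpens A'.mod_isSheaf
      (fun B hB hBU => g ⟨B, hB⟩ (A.res hBU a)) fun B hB hBU B' hB' hle =>
        (hcompat ⟨B, hB⟩ ⟨B', hB'⟩ hle _).trans
          (congrArg (g ⟨B', hB'⟩) (algRes_algRes (G := A.pre) hBU hle a))
    exact ⟨b, fun B hB => hb B.1 B.2 hB⟩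
  choose G hG using hex
  have hext : ∀ {U : X.Opens} {b b' : A'.pre.obj (op U)},
      (∀ (B : basicOpens X) (hB : B.1 ≤ U), A'.res hB b = A'.res hB b') → b = b' :=
    fun hb => section_ext_of_basis isBasis_basicOpens A'.mod_isSheaf fun B hB hBU => hb ⟨B, hB⟩ hBU
  let GH : ∀ U : X.Opens, A.pre.obj (op U) →ₐ[R] A'.pre.obj (op U) := fun U =>
    { toFun := G U
      map_one' := hext fun B hB => by rw [hG, map_one, map_one, map_one]
      map_mul' := fun a b => hext fun B hB => by rw [hG, map_mul, map_mul, map_mul, hG, hG]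
      map_zero' := hext fun B hB => by rw [hG, map_zero, map_zero, map_zero]
      map_add' := fun a b => hext fun B hB => by rw [hG, map_add, map_add, map_add, hG, hG]
      commutes' := fun r => hext fun B hB => by
        rw [hG, AlgHom.commutes, AlgHom.commutes, AlgHom.commutes] }
  refine ⟨{ app := fun U => AlgCat.ofHom (GH U.unop), naturality := fun U V i => ?_ }, fun a => ?_⟩
  · refine AlgCat.hom_ext _ (AlgHom.ext fun a => hext fun B hB => ?_)
    change A'.res hB (G V.unop (A.res i.unop.le a)) = A'.res hB (A'.res i.unop.le (G U.unop a))
    rw [hG]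
    exact (congrArg (g B) (algRes_algRes (G := A.pre) i.unop.le hB a)).trans
      ((hG U.unop a B (hB.trans i.unop.le)).symm.trans
        (algRes_algRes (G := A'.pre) i.unop.le hB _).symm)
  · exact hext fun B hB => (hG ⊤ a B hB).trans (hg B a)

theorem isHausdorff_section (hA : isAssDefSheaf R (structureSheaf f) A) (s : Γ(X, ⊤)) :
    IsHausdorff (paramIdeal K R) (A.pre.obj (op (X.basicOpen s))) :=
  (isDefMod_augHom_basicOpen hA s).complete.toIsHausdorff

/-- Isomorphisms of global sections extend uniquely to gauge transformations of sheaves. -/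

theorem existsUnique_gauge (hA : isAssDefSheaf R (structureSheaf f) A)
    (hA' : isAssDefSheaf R (structureSheaf f) A')
    (h : (gammaAss R (structureSheaf f)).obj A ⟶ (gammaAss R (structureSheaf f)).obj A') :
    ∃! g : A ⟶ A', (gammaAss R (structureSheaf f)).map g = h := by
  have haug : ∀ a, A'.augHom ⊤ (h.iso.hom.hom a) = A.augHom ⊤ a := fun a =>
    congrArg (fun k => k.hom a) h.comm
  have haug' : ∀ a, A.augHom ⊤ (h.iso.inv.hom a) = A'.augHom ⊤ a := fun a => by
    rw [← haug]
    exact congrArg (A'.augHom ⊤) (congrArg (fun k => k.hom a) h.iso.inv_hom_id)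
  obtain ⟨η, hη⟩ := exists_natTrans hA hA' h.iso.hom.hom haug
  obtain ⟨η', hη'⟩ := exists_natTrans hA' hA h.iso.inv.hom haug'
  let g : A ⟶ A' :=
    { iso :=
        { hom := η
          inv := η'
          hom_inv_id := natTrans_ext hA A.mod_isSheaf (fun s _ => isHausdorff_section hA s) fun a =>
            (hη' _).trans ((congrArg h.iso.inv.hom (hη a)).trans
              (congrArg (fun k => k.hom a) h.iso.hom_inv_id))
          inv_hom_id := natTrans_ext hA' A'.mod_isSheaf (fun s _ => isHausdorff_section hA' s)
            fun a => (hη _).trans ((congrArg h.iso.hom.hom (hη' a)).trans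
              (congrArg (fun k => k.hom a) h.iso.inv_hom_id)) }
      comm := natTrans_ext hA (structureMod_isSheaf f)
        (fun s _ => (isDefMod_augHom_basicOpen hA s).isHausdorff) fun a =>
          (congrArg (A'.augHom ⊤) (hη a)).trans (haug a) }
  refine ⟨g, AugAss.Hom.ext (Iso.ext (AlgCat.hom_ext _ (AlgHom.ext hη))), fun g' hg' => ?_⟩
  refine AugAssSheaf.Hom.ext (Iso.ext (natTrans_ext hA A'.mod_isSheaf
    (fun s _ => isHausdorff_section hA' s) fun a => ?_))
  rw [hη, ← hg']
  rfl

end Extension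

end Deformation
end

noncomputable section
namespace Deformation

/-! ### Gauge transformations of Poisson deformations -/

section Poisson

variable {K : Type u} [Field K] {R : Type u} [CommRing R] [Algebra K R] [IsParameterAlgebra K R]

/-- The augmented associative algebra underlying an augmented Poisson algebra. -/
def AugPois.toAss {C : CommAlgCat.{u} K} (A : AugPois R C) : AugAss R C :=
  ⟨(commToAss R).obj A.alg, (commToAss R).map A.aug⟩

/-- The isomorphism of associative algebras underlying a gauge transformation. -/
def AugPois.Hom.toAss {C : CommAlgCat.{u} K} {A A' : AugPois R C} (h : A ⟶ A') :
    A.toAss ⟶ A'.toAss :=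
  ⟨(commToAss R).mapIso h.iso, by
    have := congrArg (commToAss R).map h.comm
    rwa [Functor.map_comp] at this⟩

/-- The augmented sheaf of associative algebras underlying an augmented sheaf of Poisson
algebras. -/
def AugPoisSheaf.toAss {X : TopCat.{u}} {O : CommAlgSheaf K X} (A : AugPoisSheaf R O) :
    AugAssSheaf R O :=
  ⟨A.pre ⋙ commToAss R, A.isSheaf, Functor.whiskerRight A.aug (commToAss R)⟩

/-- Natural transformations between presheaves of commutative algebras, from natural
transformations between presheaves of associative algebras. -/
def commNatTrans {X : TopCat.{u}} {F G : TopCat.Presheaf (CommAlgCat.{u} R) X}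
    (η : F ⋙ commToAss R ⟶ G ⋙ commToAss R) : F ⟶ G where
  app U := CommAlgCat.ofHom (η.app U).hom
  naturality _ _ i := CommAlgCat.hom_ext (AlgHom.ext fun a =>
    congrArg (fun g => g.hom a) (η.naturality i))

variable {X : Scheme.{u}} {f : X ⟶ Spec (CommRingCat.of K)}

theorem natTrans_comm_ext {F G : TopCat.Presheaf (CommAlgCat.{u} R) X.toPresheafedSpace.carrier}
    {η η' : F ⟶ G}
    (h : Functor.whiskerRight η (commToAss R) = Functor.whiskerRight η' (commToAss R)) :
    η = η' :=
  NatTrans.ext (funext fun U => CommAlgCat.hom_ext (AlgHom.ext fun a =>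
    congrArg (fun g => (g.app U).hom a) h))

variable {A A' : AugPoisSheaf R (structureSheaf f)}

/-- The restriction homomorphisms of a sheaf of Poisson algebras. -/
def AugPoisSheaf.res (A : AugPoisSheaf R (structureSheaf f)) {U V : X.Opens} (h : V ≤ U) :
    A.pre.obj (op U) →ₐ[R] A.pre.obj (op V) :=
  (A.pre.map (homOfLE h).op).hom

/-- The augmentation of the algebra of sections. -/
def AugPoisSheaf.augHom (A : AugPoisSheaf R (structureSheaf f)) (U : X.Opens) :
    A.pre.obj (op U) →ₐ[R] regular f R U :=
  (A.aug.app (op U)).hom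

theorem AugPoisSheaf.res_br {U V : X.Opens} (h : V ≤ U) (a b : A.pre.obj (op U)) :
    A.res h ((A.bracket (op U)).br a b) = (A.bracket (op V)).br (A.res h a) (A.res h b) :=
  A.map_bracket _ a b

variable [IsAffine X] [IsIntegral X]

theorem isDefLoc_res_comm (hA : isPoisDefSheaf R (structureSheaf f) A) {s : Γ(X, ⊤)} (hs : s ≠ 0) :
    IsDefLoc (paramIdeal K R) (A.augHom ⊤) (A.augHom (X.basicOpen s)) (A.res le_top)
      (nonvanishing f (A.augHom ⊤) (X.basicOpen s)) :=
  isDefLoc_res (A := A.toAss) hA hs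

/-- After restriction to basic open sets this is `PoissonBracket.map_br_of_isDefLoc`, so preserving
the bracket of global sections is enough. -/
theorem app_br (hA : isPoisDefSheaf R (structureSheaf f) A)
    (hA' : isPoisDefSheaf R (structureSheaf f) A') (η : A.pre ⟶ A'.pre)
    (h : ∀ a b : A.pre.obj (op ⊤), (η.app (op ⊤)).hom ((A.bracket (op ⊤)).br a b) =
      (A'.bracket (op ⊤)).br ((η.app (op ⊤)).hom a) ((η.app (op ⊤)).hom b))
    (U : (Opens X)ᵒᵖ) (a b : A.pre.obj U) :
    (η.app U).hom ((A.bracket U).br a b) =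
      (A'.bracket U).br ((η.app U).hom a) ((η.app U).hom b) := by
  have nat : ∀ {U V : X.Opens} (h : V ≤ U) (a : A.pre.obj (op U)),
      (η.app (op V)).hom (A.res h a) = A'.res h ((η.app (op U)).hom a) := fun h a =>
    congrArg (fun g => g.hom a) (η.naturality (homOfLE h).op)
  refine section_ext_of_basis (isBasis_basicOpens (X := X)) A'.toAss.mod_isSheaf ?_
  rintro _ ⟨s, hs, rfl⟩ hsU
  change A'.res hsU ((η.app (op U.unop)).hom _) = A'.res hsU _
  rw [← nat, A.res_br]
  refine Eq.trans ?_ (A'.res_br hsU _ _).symm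
  have := isHausdorff_section (A := A'.toAss) hA' s
  have hH : IsHausdorff (paramIdeal K R) (A'.pre.obj (op (X.basicOpen s))) := this
  refine ((A.bracket _).map_br_of_isDefLoc (isDefLoc_res_comm hA hs) (A'.bracket _)
    (η.app (op (X.basicOpen s))).hom (fun a a' => ?_) _ _).trans ?_
  · rw [← A.res_br, nat, h, nat, nat, A'.res_br]
  · exact congrArg₂ (fun x y => (A'.bracket _).br x y) (nat hsU a) (nat hsU b)

/-- The underlying associative gauge transformation exists and is unique; it preserves brackets on
all open sets by `app_br`. -/
theorem existsUnique_gauge_pois (hA : isPoisDefSheaf R (structureSheaf f) A)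
    (hA' : isPoisDefSheaf R (structureSheaf f) A')
    (h : (gammaPois R (structureSheaf f)).obj A ⟶ (gammaPois R (structureSheaf f)).obj A') :
    ∃! g : A ⟶ A', (gammaPois R (structureSheaf f)).map g = h := by
  obtain ⟨g, hg, hu⟩ := existsUnique_gauge (A := A.toAss) (A' := A'.toAss) hA hA'
    (AugPois.Hom.toAss h)
  have hg' : ∀ a, (g.iso.hom.app (op ⊤)).hom a = h.iso.hom.hom a := fun a =>
    congrArg (fun k => k.iso.hom.hom a) hg
  let g' : A ⟶ A' :=
    { iso :=
        { hom := commNatTrans g.iso.hom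
          inv := commNatTrans g.iso.inv
          hom_inv_id := natTrans_comm_ext g.iso.hom_inv_id
          inv_hom_id := natTrans_comm_ext g.iso.inv_hom_id }
      comm := natTrans_comm_ext g.comm
      map_bracket := app_br hA hA' _ fun a b => by
        have h1 := h.map_bracket a b
        exact (hg' _).trans (h1.trans (congrArg₂ (fun x y => (A'.bracket _).br x y)
          (hg' a).symm (hg' b).symm)) }
  refine ⟨g', AugPois.Hom.ext (Iso.ext (CommAlgCat.hom_ext (AlgHom.ext hg'))), fun k hk => ?_⟩
  have hk' : (⟨Functor.isoWhiskerRight k.iso (commToAss R),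
      congrArg (fun η => Functor.whiskerRight η (commToAss R)) k.comm⟩ : A.toAss ⟶ A'.toAss) = g :=
    hu _ (by
      subst hk
      rfl)
  refine AugPoisSheaf.Hom.ext (Iso.ext (natTrans_comm_ext ?_))
  exact congrArg (fun k => k.iso.hom) hk'

end Poisson

end Deformation
end

noncomputable section
namespace Deformation

/-! ### Comparison of deformations, and fractions determined locally -/

section Modules

variable {R : Type*} [CommRing R] {I : Ideal R}

/-- A homomorphism between deformations of the same module is an isomorphism. -/

theorem IsDefMod.bijective_of_comp [IsNoetherianRing R] [I.IsMaximal] {M M' N : Type*}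
    [AddCommGroup M] [Module R M] [AddCommGroup M'] [Module R M'] [AddCommGroup N] [Module R N]
    {π : M →ₗ[R] N} {π' : M' →ₗ[R] N} (h : IsDefMod I π) (h' : IsDefMod I π') (f : M →ₗ[R] M')
    (hf : ∀ x, π' (f x) = π x) : Function.Bijective f := by
  have := h.complete
  have := h'.complete
  have := h'.flat
  constructor
  · refine (injective_iff_map_eq_zero f).2 fun x hx => eq_zero_of_forall_mem (I := I) fun n =>
      reflects_smul_top f (fun x hx => ?_) (by rw [hx]; exact Submodule.zero_mem _)
    rwa [← h.ker, ← hf, h'.ker]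
  -- Surjectivity modulo `I` gives surjectivity on each quotient `I ^ n M' / I ^ (n + 1) M'`; a
  -- preimage is then found by successive approximation.
  · have key : ∀ n (y : M'), y ∈ (I ^ n • ⊤ : Submodule R M') →
        ∃ x ∈ (I ^ n • ⊤ : Submodule R M), y - f x ∈ (I ^ (n + 1) • ⊤ : Submodule R M') := by
      intro n y hy
      induction hy using Submodule.smul_induction_on' with
      | smul r hr y _ =>
        obtain ⟨x, hx⟩ := h.surj (π' y)
        refine ⟨r • x, Submodule.smul_mem_smul hr trivial, ?_⟩
        rw [map_smul, ← smul_sub, pow_succ, Submodule.mul_smul]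
        refine Submodule.smul_mem_smul hr ?_
        rw [← h'.ker, map_sub, hf, hx, sub_self]
      | add y _ y' _ hy hy' =>
        obtain ⟨x, hx, hxy⟩ := hy
        obtain ⟨x', hx', hxy'⟩ := hy'
        refine ⟨x + x', add_mem hx hx', ?_⟩
        convert add_mem hxy hxy' using 1
        rw [map_add]
        abel
    intro y
    choose g hg hgy using key
    let s : ∀ n : ℕ, {x : M // y - f x ∈ (I ^ n • ⊤ : Submodule R M')} := fun n =>
      Nat.rec ⟨0, by simp⟩ (fun n x => ⟨x.1 + g n _ x.2, by
        rw [map_add, ← sub_sub]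
        exact hgy n _ x.2⟩) n
    obtain ⟨x, hx⟩ := exists_limit (I := I) (fun n => (s n).1) fun n => by
      change (s n).1 + g n _ (s n).2 - (s n).1 ∈ _
      rw [add_sub_cancel_left]
      exact hg n _ _
    refine ⟨x, (sub_eq_zero.1 (eq_zero_of_forall_mem (I := I) fun n => ?_)).symm⟩
    have h1 := map_mem_smul_top f (hx n)
    have := sub_mem (s n).2 h1
    rw [map_sub] at this
    simpa using this

/-- Local fractions are global fractions, if this holds modulo `I`. -/

theorem mem_fracClosure_of_forall_mem [IsNoetherianRing R] [I.IsMaximal] {A C Q L : Type*} [Ring A]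
    [Algebra R A] [CommRing C] [Algebra R C] [Ring Q] [Algebra R Q] [CommRing L] [Algebra R L]
    {πA : A →ₐ[R] C} {πQ : Q →ₐ[R] L} {φ : A →ₐ[R] Q} (hA : IsDefMod I πA.toLinearMap)
    (hQ : IsDefMod I πQ.toLinearMap) (hinj : ∀ a, πQ (φ a) = 0 → πA a = 0) {S : Submonoid A}
    (hS : ∀ s ∈ S, IsUnit (πQ (φ s))) {T : Type*} {S' : T → Submonoid A} (hSS' : ∀ x, S ≤ S' x)
    (hloc : ∀ l : L, (∀ x, ∃ s ∈ S' x, ∃ a, πQ (φ s) * l = πQ (φ a)) →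
      ∃ s ∈ S, ∃ a, πQ (φ s) * l = πQ (φ a))
    {q : Q} (hq : ∀ x, q ∈ fracClosure I hA.isCommMod φ (S' x)) :
    q ∈ fracClosure I hA.isCommMod φ S := by
  have := hQ.flat
  -- An element of `I ^ n Q` is approximated modulo `I ^ (n + 1)`: its leading coefficients in `L`
  -- are fractions for every `S' x`, hence for `S` by `hloc`.
  have key : ∀ n (q : Q), (∀ x, q ∈ fracClosure I hA.isCommMod φ (S' x)) →
      q ∈ (I ^ n • ⊤ : Submodule R Q) → ∃ c ∈ fracClosure I hA.isCommMod φ S,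
        q - c ∈ (I ^ (n + 1) • ⊤ : Submodule R Q) := by
    intro n q hq hqn
    obtain ⟨r, e, he⟩ := exists_isGrBasis I n
    obtain ⟨y, hy⟩ := he.exists_sum hqn
    have h1 : ∀ k, ∃ c ∈ fracClosure I hA.isCommMod φ S, πQ c = πQ (y k) := by
      intro k
      obtain ⟨s, hs, a, ha⟩ := hloc (πQ (y k)) fun x => by
        obtain ⟨t, ht, a, hta⟩ := mem_fracClosure.1 (hq x) (n + 1)
        have h2 : φ a ∈ (I ^ n • ⊤ : Submodule R Q) := by
          have := sub_mem (mul_mem_smul_top_left (φ t) hqn) (mem_smul_top_of_succ hta)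
          rwa [sub_sub_cancel] at this
        obtain ⟨b, hb⟩ := he.exists_sum (reflects_smul_top φ.toLinearMap (fun x hx => by
          rw [← hA.ker]
          rw [← hQ.ker] at hx
          exact hinj x hx) h2)
        refine ⟨t, ht, b k, ?_⟩
        -- Both `φ t * q` and `φ a` have order `n` and agree modulo `I ^ (n + 1)`; flatness of `Q`
        -- lets their leading coefficients be compared.
        have h3 : ∑ k, e k • (φ t * y k - φ (b k)) ∈ (I ^ (n + 1) • ⊤ : Submodule R Q) := by
          have h4 := sub_mem (add_mem hta (map_mem_smul_top φ.toLinearMap hb))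
            (mul_mem_smul_top_left (φ t) hy)
          convert h4 using 1
          simp only [smul_sub, Finset.sum_sub_distrib, AlgHom.toLinearMap_apply, map_sub, map_sum,
            map_smul, mul_sub, Finset.mul_sum, mul_smul_comm]
          abel
        have h5 := (hQ.ker _).2 (he.coeff_mem h3 k)
        rw [map_sub, sub_eq_zero] at h5
        simpa using h5
      obtain ⟨u, hu⟩ := hQ.isUnit (hS s hs)
      have h6 : φ s * (↑u⁻¹ * φ a) = φ a := by rw [← hu, Units.mul_inv_cancel_left]
      refine ⟨↑u⁻¹ * φ a, fraction_mem_fracClosure hs h6, (hS s hs).mul_left_cancel ?_⟩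
      rw [ha, ← map_mul, h6]
    choose c hc hcy using h1
    refine ⟨∑ k, e k • c k, sum_mem fun k _ => Subalgebra.smul_mem _ (hc k) _, ?_⟩
    have h2 := he.sum_mem (y := fun k => y k - c k) 1 fun k => by
      rw [pow_one, ← hQ.ker, map_sub, sub_eq_zero]
      exact (hcy k).symm
    convert add_mem hy h2 using 1
    simp only [smul_sub, Finset.sum_sub_distrib]
    abel
  have hle : ∀ x, fracClosure I hA.isCommMod φ S ≤ fracClosure I hA.isCommMod φ (S' x) :=
    fun x => fracClosure_mono (hSS' x)
  have happ : ∀ n : ℕ, ∃ c ∈ fracClosure I hA.isCommMod φ S,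
      q - c ∈ (I ^ n • ⊤ : Submodule R Q) := by
    intro n
    induction n with
    | zero => exact ⟨0, Subalgebra.zero_mem _, by simp⟩
    | succ n ih =>
      obtain ⟨c, hc, hqc⟩ := ih
      obtain ⟨d, hd, hqd⟩ := key n (q - c) (fun x => sub_mem (hq x) (hle x hc)) hqc
      exact ⟨c + d, add_mem hc hd, by rwa [← sub_sub]⟩
  choose c hc hqc using happ
  refine mem_fracClosure_of_forall_sub_mem (f := c) (fun n => ?_) hqc
  obtain ⟨s, hs, a, h⟩ := mem_fracClosure.1 (hc n) n
  exact ⟨s, hs, a, h⟩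

end Modules

end Deformation
end

noncomputable section
namespace Deformation

section Nonvanishing

variable {K : Type u} [Field K] {X : Scheme.{u}} {f : X ⟶ Spec (CommRingCat.of K)}
  {R : Type u} [CommRing R] [Algebra K R] [IsParameterAlgebra K R]

variable {B : Type u} [Ring B] [Algebra R B] (π : B →ₐ[R] regular f R ⊤)

/-- The elements of an augmented algebra whose augmentation does not vanish at `x`. -/
def nonvanishingAt (x : X) : Submonoid B where
  carrier := {a | x ∈ X.basicOpen (regularEquiv f R ⊤ (π a))}
  one_mem' := by
    change x ∈ X.basicOpen (regularEquiv f R ⊤ (π 1))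
    rw [map_one, map_one, Scheme.basicOpen_one]
    trivial
  mul_mem' := fun {a b} ha hb => by
    change x ∈ X.basicOpen (regularEquiv f R ⊤ (π (a * b)))
    rw [map_mul, map_mul, Scheme.basicOpen_mul]
    exact ⟨ha, hb⟩

theorem nonvanishing_le {U : X.Opens} {x : X} (hx : x ∈ U) :
    nonvanishing f π U ≤ nonvanishingAt π x := fun _ ha => ha hx

end Nonvanishing

/-! ### The sheaf of fractions of a deformation -/

section Existence

variable {K : Type u} [Field K] {X : Scheme.{u}} (f : X ⟶ Spec (CommRingCat.of K))
  (R : Type u) [CommRing R] [Algebra K R] [IsParameterAlgebra K R] [IsIntegral X]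

/-- The field of rational functions, as an `R`-algebra. -/
def rational : CommAlgCat.{u} R :=
  letI : Algebra R X.functionField :=
    ((ratlTop X).comp ((regularEquiv f R ⊤).toRingHom.comp
      (algebraMap R (regular f R ⊤)))).toAlgebra
  CommAlgCat.of R X.functionField

/-- The identification of rational functions. -/
def rationalEquiv : rational f R ≃+* X.functionField := RingEquiv.refl X.functionField

variable {f R}

variable (f R) in

/-- The rational function defined by a regular function, as a homomorphism of `R`-algebras. -/
def toRational {U : X.Opens} (hU : genericPoint X ∈ U) : regular f R U →ₐ[R] rational f R :=
  { (rationalEquiv f R).symm.toRingHom.comp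
      ((ratl hU).comp (regularEquiv f R U).toRingHom) with
    commutes' := fun r => by
      have h1 := (rres f R (le_top : U ≤ ⊤)).commutes r
      exact (congrArg (ratl hU) h1).symm.trans (ratl_fres_top hU _) }

theorem toRational_rres {U V : X.Opens} (h : V ≤ U) (hV : genericPoint X ∈ V)
    (a : regular f R U) : toRational f R hV (rres f R h a) = toRational f R (h hV) a :=
  ratl_fres h hV a

theorem toRational_injective {U : X.Opens} (hU : genericPoint X ∈ U) :
    Function.Injective (toRational f R hU) := ratl_injective hU

variable {B : Type u} [Ring B] [Algebra R B]

variable {π : B →ₐ[R] regular f R ⊤} {Q : Type u} [Ring Q] [Algebra R Q] (hB : IsCommMod (paramIdeal K R) B)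
  (πQ : Q →ₐ[R] rational f R) (φ : B →ₐ[R] Q)

variable (π) in

/-- The sections on `U` of the sheaf of fractions. -/
def fracSections (U : X.Opens) : Subalgebra R ((U → Q) × regular f R U) where
  -- A section is one element of `Q`, recorded as a constant function on `U`, together with the
  -- regular function it induces. Indexing by the points of `U` makes the first component trivial
  -- when `U` is empty, as the sheaf condition requires.
  carrier := {p | (∀ x y, p.1 x = p.1 y) ∧
    (∀ x : U, p.1 x ∈ fracClosure (paramIdeal K R) hB φ (nonvanishingAt π x.1)) ∧
    ∀ x : U, πQ (p.1 x) = toRational f R (genericPoint_mem X x.2) p.2}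
  mul_mem' := fun {p q} hp hq => ⟨fun x y => by
      rw [Prod.fst_mul, Pi.mul_apply, Pi.mul_apply, hp.1 x y, hq.1 x y],
    fun x => Subalgebra.mul_mem _ (hp.2.1 x) (hq.2.1 x), fun x => by
      rw [Prod.fst_mul, Pi.mul_apply, Prod.snd_mul, map_mul, map_mul, hp.2.2, hq.2.2]⟩
  add_mem' := fun {p q} hp hq => ⟨fun x y => by
      rw [Prod.fst_add, Pi.add_apply, Pi.add_apply, hp.1 x y, hq.1 x y],
    fun x => Subalgebra.add_mem _ (hp.2.1 x) (hq.2.1 x), fun x => by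
      rw [Prod.fst_add, Pi.add_apply, Prod.snd_add, map_add, map_add, hp.2.2, hq.2.2]⟩
  algebraMap_mem' := fun r => ⟨fun _ _ => rfl, fun _ => Subalgebra.algebraMap_mem _ r, fun x =>
    (πQ.commutes r).trans ((toRational f R (genericPoint_mem X x.2)).commutes r).symm⟩

variable {hB πQ φ} in

theorem mem_fracSections {U : X.Opens} {g : U → Q} {v : regular f R U} :
    (g, v) ∈ fracSections π hB πQ φ U ↔ (∀ x y, g x = g y) ∧
      (∀ x : U, g x ∈ fracClosure (paramIdeal K R) hB φ (nonvanishingAt π x.1)) ∧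
      ∀ x : U, πQ (g x) = toRational f R (genericPoint_mem X x.2) v := Iff.rfl

variable (π) in

/-- The restriction homomorphisms of the sheaf of fractions. -/
def fracRes {U V : X.Opens} (h : V ≤ U) :
    fracSections π hB πQ φ U →ₐ[R] fracSections π hB πQ φ V :=
  (((AlgHom.pi fun x : V =>
    (Pi.evalAlgHom R (fun _ : U => Q) ⟨x, h x.2⟩)).prodMap (rres f R h)).comp
      (fracSections π hB πQ φ U).val).codRestrict _ fun p => ⟨fun _ _ => p.2.1 _ _,
        fun x => p.2.2.1 ⟨x, h x.2⟩, fun x => by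
          refine Eq.trans (p.2.2.2 ⟨x, h x.2⟩) ?_
          exact (toRational_rres h (genericPoint_mem X x.2) p.1.2).symm⟩

variable (π) in
/-- The sheaf of fractions. -/
def fracPresheaf : TopCat.Presheaf (AlgCat.{u} R) X.toPresheafedSpace.carrier where
  obj U := AlgCat.of R (fracSections π hB πQ φ U.unop)
  map i := AlgCat.ofHom (fracRes π hB πQ φ i.unop.le)
  map_id _ := AlgCat.hom_ext _ (AlgHom.ext fun p => Subtype.ext (Prod.ext rfl
    (res_self (F := structureMod f R) le_rfl p.1.2)))
  map_comp i j := AlgCat.hom_ext _ (AlgHom.ext fun p => Subtype.ext (Prod.ext rfl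
    (res_res (F := structureMod f R) i.unop.le j.unop.le p.1.2).symm))

theorem existsUnique_glue_fracSections {ι : Type*} (U : ι → X.Opens)
    (p : ∀ i, fracSections π hB πQ φ (U i))
    (hp : ∀ i j, fracRes π hB πQ φ (inf_le_left : U i ⊓ U j ≤ U i) (p i) =
      fracRes π hB πQ φ (inf_le_right : U i ⊓ U j ≤ U j) (p j)) :
    ∃! q : fracSections π hB πQ φ (iSup U), ∀ i, fracRes π hB πQ φ (le_iSup U i) q = p i := by
  have hp2 : ∀ i j, rres f R (inf_le_left : U i ⊓ U j ≤ U i) (p i).1.2 =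
      rres f R (inf_le_right : U i ⊓ U j ≤ U j) (p j).1.2 := fun i j =>
    congrArg (fun z : fracSections π hB πQ φ (U i ⊓ U j) => z.1.2) (hp i j)
  obtain ⟨v, hv⟩ : ∃ v : regular f R (iSup U), ∀ i, rres f R (le_iSup U i) v = (p i).1.2 :=
    exists_glue (structureMod_isSheaf f (R := R)) (U := iSup U) U (le_iSup U)
      (fun x hx => Opens.mem_iSup.1 hx) (fun i => (p i).1.2) hp2
  have hmem : ∀ x : (iSup U : X.Opens), ∃ i, (x : X) ∈ U i := fun x => Opens.mem_iSup.1 x.2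
  choose τ hτ using hmem
  -- Nonempty open sets all meet in the generic point, so the local values are one and the same
  -- element of `Q`.
  have hval : ∀ i j (x : U i) (y : U j), (p i).1.1 x = (p j).1.1 y := fun i j x y => by
    have hη : genericPoint X ∈ U i ⊓ U j := ⟨genericPoint_mem X x.2, genericPoint_mem X y.2⟩
    have h1 := congrArg (fun z : fracSections π hB πQ φ (U i ⊓ U j) => z.1.1 ⟨_, hη⟩) (hp i j)
    exact ((p i).2.1 _ _).trans (Eq.trans h1 ((p j).2.1 _ _))
  obtain ⟨g, hg⟩ : ∃ g : ↥(iSup U) → Q, ∀ x i (y : U i), g x = (p i).1.1 y :=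
    ⟨fun x => (p (τ x)).1.1 ⟨x, hτ x⟩, fun x i y => hval _ _ _ _⟩
  have hmem : (g, v) ∈ fracSections π hB πQ φ (iSup U) := by
    refine mem_fracSections.2 ⟨fun x y => ?_, fun x => ?_, fun x => ?_⟩
    · rw [hg x (τ y) ⟨y, hτ y⟩, hg y (τ y) ⟨y, hτ y⟩]
    · rw [hg x (τ x) ⟨x, hτ x⟩]
      exact (p (τ x)).2.2.1 ⟨x, hτ x⟩
    · rw [hg x (τ x) ⟨x, hτ x⟩]
      refine ((p (τ x)).2.2.2 ⟨x, hτ x⟩).trans ?_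
      rw [← hv (τ x), toRational_rres]
  refine ⟨⟨(g, v), hmem⟩, fun i => ?_, fun q hq => ?_⟩
  · exact Subtype.ext (Prod.ext (funext fun x => hg _ _ _) (hv i))
  · refine Subtype.ext (Prod.ext (funext fun x => ?_) ?_)
    · refine Eq.trans ?_ (hg x (τ x) ⟨x, hτ x⟩).symm
      exact congrArg (fun z : fracSections π hB πQ φ (U (τ x)) => z.1.1 ⟨x, hτ x⟩) (hq (τ x))
    · refine section_ext (F := structureMod f R) (structureMod_isSheaf f) fun x hx => ?_
      obtain ⟨i, hi⟩ := Opens.mem_iSup.1 hx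
      exact ⟨U i, le_iSup U i, hi, (congrArg (fun z : fracSections π hB πQ φ (U i) => z.1.2)
        (hq i)).trans (hv i).symm⟩

theorem fracPresheaf_isSheaf :
    TopCat.Presheaf.IsSheaf (fracPresheaf π hB πQ φ ⋙ forget (AlgCat.{u} R)) :=
  TopCat.Presheaf.isSheaf_of_isSheafUniqueGluing_types _ fun _ U p hp =>
    existsUnique_glue_fracSections hB πQ φ U p hp

variable (π) in

/-- The sheaf of fractions, with its augmentation. -/
def fracSheaf : AugAssSheaf R (structureSheaf f) where
  pre := fracPresheaf π hB πQ φ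
  isSheaf := fracPresheaf_isSheaf hB πQ φ
  aug :=
    { app := fun U => AlgCat.ofHom
        ((AlgHom.snd R (U.unop → Q) (regular f R U.unop)).comp (fracSections π hB πQ φ U.unop).val)
      naturality := fun _ _ _ => rfl }

end Existence

end Deformation
end

noncomputable section
namespace Deformation

/-! ### The sheaf of fractions is a deformation -/

section Existence

variable {K : Type u} [Field K] {X : Scheme.{u}} {f : X ⟶ Spec (CommRingCat.of K)}
  {R : Type u} [CommRing R] [Algebra K R] [IsParameterAlgebra K R] [IsIntegral X]
  {B : Type u} [Ring B] [Algebra R B] {π : B →ₐ[R] regular f R ⊤}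

theorem regular_isDomain : IsDomain (regular f R ⊤) :=
  inferInstanceAs (IsDomain Γ(X, ⊤))

theorem isUnit_rational {l : rational f R} (h : l ≠ 0) : IsUnit l :=
  (MulEquiv.isUnit_map (rationalEquiv f R)).1
    (IsUnit.mk0 _ ((map_ne_zero_iff _ (rationalEquiv f R).injective).2 h))

variable [IsAffine X]

/-- The generic localization of a deformation of the algebra of global regular functions. -/

theorem exists_rational_localization (hB : IsDefMod (paramIdeal K R) π.toLinearMap) :
    ∃ (Q : AlgCat.{u} R) (πQ : Q →ₐ[R] rational f R) (φ : B →ₐ[R] Q),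
      (∀ a, πQ (φ a) = toRational f R (U := ⊤) trivial (π a)) ∧
        IsDefMod (paramIdeal K R) πQ.toLinearMap := by
  have := IsParameterAlgebra.isNoetherianRing K (R := R)
  have := paramIdeal_isMaximal K R
  have := paramIdeal_isAdicComplete K R
  have := regular_isDomain (f := f) (R := R)
  obtain ⟨Q, πQ, φ, h, hl⟩ := exists_generic_localization hB (toRational f R (U := ⊤) trivial)
    (toRational_injective _) (fun c hc => isUnit_rational
      ((map_ne_zero_iff _ (toRational_injective (U := ⊤) trivial)).2 hc))
    (fun x => exists_fraction (X := X) x)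
  exact ⟨Q, πQ, φ, h, hl.right⟩

variable {Q : Type u} [Ring Q] [Algebra R Q] {πQ : Q →ₐ[R] rational f R} {φ : B →ₐ[R] Q}

/-- The value of a section of the sheaf of fractions. -/
def fracValue (hB : IsCommMod (paramIdeal K R) B) {U : X.Opens} (hU : genericPoint X ∈ U) :
    fracSections π hB πQ φ U →ₗ[R] Q :=
  (LinearMap.proj (R := R) (φ := fun _ : U => Q) ⟨_, hU⟩ ∘ₗ LinearMap.fst R _ _) ∘ₗ
    (fracSections π hB πQ φ U).val.toLinearMap

/-- The augmentation of the sections of the sheaf of fractions. -/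
def fracAug (hB : IsCommMod (paramIdeal K R) B) (U : X.Opens) :
    fracSections π hB πQ φ U →ₗ[R] regular f R U :=
  LinearMap.snd R _ _ ∘ₗ (fracSections π hB πQ φ U).val.toLinearMap

/-- Modulo `I` the content is that a rational function regular at every point of `D(s)` is regular
on `D(s)`, by `exists_ratl_eq_of_forall`; `mem_fracClosure_of_forall_mem` lifts this to `Q`. -/
theorem mem_fracClosure_iff
    (hB : IsDefMod (paramIdeal K R) π.toLinearMap)
    (hQ : IsDefMod (paramIdeal K R) πQ.toLinearMap)
    (hφ : ∀ a, πQ (φ a) = toRational f R (U := ⊤) trivial (π a))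
    {s : Γ(X, ⊤)} (hs : s ≠ 0) (q : Q) :
    q ∈ fracClosure (paramIdeal K R) hB.isCommMod φ (nonvanishing f π (X.basicOpen s)) ↔
      ∃ b : fracSections π hB.isCommMod πQ φ (X.basicOpen s),
        fracValue hB.isCommMod (genericPoint_mem_basicOpen hs) b = q := by
  have := IsParameterAlgebra.isNoetherianRing K (R := R)
  have := paramIdeal_isMaximal K R
  have hη := genericPoint_mem_basicOpen hs
  have hne : ∀ t ∈ nonvanishing f π (X.basicOpen s), π t ≠ 0 := fun t ht =>
    ne_zero_of_mem_basicOpen (ht hη)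
  have hunit : ∀ t ∈ nonvanishing f π (X.basicOpen s), IsUnit (πQ (φ t)) := fun t ht => by
    rw [hφ]
    exact isUnit_rational ((map_ne_zero_iff _ (toRational_injective (U := ⊤) trivial)).2 (hne t ht))
  constructor
  · intro hq
    obtain ⟨t, ht, a, hta⟩ := mem_fracClosure.1 hq 1
    rw [pow_one, ← hQ.ker, map_sub, sub_eq_zero] at hta
    have h1 : toRational f R (U := ⊤) trivial (π t) * πQ q =
        toRational f R (U := ⊤) trivial (π a) := by
      rw [← hφ, ← hφ, ← map_mul]
      exact hta
    obtain ⟨v, hv⟩ := exists_ratl_eq hη (s := regularEquiv f R ⊤ (π t))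
      (a := regularEquiv f R ⊤ (π a)) ht (l := πQ q) h1
    exact ⟨⟨(fun _ => q, v), mem_fracSections.2 ⟨fun _ _ => rfl,
      fun x => fracClosure_mono (nonvanishing_le π x.2) hq, fun x => hv.symm⟩⟩, rfl⟩
  · rintro ⟨b, rfl⟩
    refine mem_fracClosure_of_forall_mem hB hQ (fun a ha => ?_) hunit
      (T := X.basicOpen s) (S' := fun x => nonvanishingAt π x.1)
      (fun x => nonvanishing_le π x.2) (fun l hl => ?_) fun x => ?_
    · rw [hφ] at ha
      exact (map_eq_zero_iff _ (toRational_injective (U := ⊤) trivial)).1 ha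
    · obtain ⟨v, hv⟩ := exists_ratl_eq_of_forall hη (l := l) fun x hx => by
        obtain ⟨t, ht, a, hta⟩ := hl ⟨x, hx⟩
        rw [hφ, hφ] at hta
        exact ⟨regularEquiv f R ⊤ (π t), regularEquiv f R ⊤ (π a), ht, hta⟩
      obtain ⟨n, a, hna⟩ := exists_pow_mul_eq s v
      obtain ⟨t, ht⟩ := hB.surj ((regularEquiv f R ⊤).symm s)
      obtain ⟨b, hb⟩ := hB.surj ((regularEquiv f R ⊤).symm a)
      have ht' : π t = (regularEquiv f R ⊤).symm s := ht
      have hb' : π b = (regularEquiv f R ⊤).symm a := hb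
      refine ⟨t ^ n, Submonoid.pow_mem _ ?_ n, b, ?_⟩
      · change _ ≤ X.basicOpen (regularEquiv f R ⊤ (π t))
        rw [ht']
        rfl
      · rw [hφ, hφ, map_pow, map_pow, ht', hb', ← hv]
        have h2 := congrArg (ratl hη) hna
        rw [map_mul, map_pow, ratl_fres_top, ratl_fres_top] at h2
        exact h2
    · have := b.2.2.1 x
      rwa [b.2.1 x ⟨_, hη⟩] at this

/-- The value at the generic point embeds the sections on `D(s)` in `Q`, with image the closure of
the fractions whose denominators do not vanish on `D(s)`; so `isDefMod_of_range_eq_fracClosure`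
applies. -/
theorem isDefMod_fracAug
    (hB : IsDefMod (paramIdeal K R) π.toLinearMap)
    (hQ : IsDefMod (paramIdeal K R) πQ.toLinearMap)
    (hφ : ∀ a, πQ (φ a) = toRational f R (U := ⊤) trivial (π a))
    {s : Γ(X, ⊤)} (hs : s ≠ 0) :
    IsDefMod (paramIdeal K R)
      (fracAug (π := π) (πQ := πQ) (φ := φ) hB.isCommMod (X.basicOpen s)) := by
  have := IsParameterAlgebra.isNoetherianRing K (R := R)
  have := paramIdeal_isMaximal K R
  have := paramIdeal_isAdicComplete K R
  have hη := genericPoint_mem_basicOpen hs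
  refine isDefMod_of_range_eq_fracClosure hB hQ (fun a ha => ?_)
    (nonvanishing f π (X.basicOpen s)) (fun t ht => ?_) (fracValue hB.isCommMod hη) ?_
    (mem_fracClosure_iff hB hQ hφ hs) _ (toRational f R hη).toLinearMap (toRational_injective hη)
    (fun b => (b.2.2.2 ⟨_, hη⟩).symm) fun v => ?_
  · rw [hφ] at ha
    exact (map_eq_zero_iff _ (toRational_injective (U := ⊤) trivial)).1 ha
  · rw [hφ]
    exact isUnit_rational ((map_ne_zero_iff _ (toRational_injective (U := ⊤) trivial)).2
      (ne_zero_of_mem_basicOpen (ht hη)))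
  · intro b b' hbb'
    refine Subtype.ext (Prod.ext (funext fun x => ?_) ?_)
    · rw [b.2.1 x ⟨_, hη⟩, b'.2.1 x ⟨_, hη⟩]
      exact hbb'
    · apply toRational_injective hη
      rw [← b.2.2.2 ⟨_, hη⟩, ← b'.2.2.2 ⟨_, hη⟩]
      exact congrArg πQ hbb'
  · obtain ⟨n, a, hna⟩ := exists_pow_mul_eq s (regularEquiv f R _ v)
    obtain ⟨t, ht⟩ := hB.surj ((regularEquiv f R ⊤).symm s)
    obtain ⟨b, hb⟩ := hB.surj ((regularEquiv f R ⊤).symm a)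
    have ht' : π t = (regularEquiv f R ⊤).symm s := ht
    have hb' : π b = (regularEquiv f R ⊤).symm a := hb
    refine ⟨t ^ n, Submonoid.pow_mem _ ?_ n, b, ?_⟩
    · change _ ≤ X.basicOpen (regularEquiv f R ⊤ (π t))
      rw [ht']
      rfl
    · rw [hφ, hφ, map_pow, map_pow, ht', hb']
      have h2 := congrArg (ratl hη) hna
      rw [map_mul, map_pow, ratl_fres_top, ratl_fres_top] at h2
      exact h2

theorem isAssDefSheaf_fracSheaf
    (hB : IsDefMod (paramIdeal K R) π.toLinearMap)
    (hQ : IsDefMod (paramIdeal K R) πQ.toLinearMap)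
    (hφ : ∀ a, πQ (φ a) = toRational f R (U := ⊤) trivial (π a)) :
    isAssDefSheaf R (structureSheaf f) (fracSheaf π hB.isCommMod πQ φ) := by
  have := IsParameterAlgebra.isNoetherianRing K (R := R)
  have := paramIdeal_isMaximal K R
  rw [isAssDefSheaf_iff]
  refine isDefSheaf_of_basis (AugAssSheaf.mod_isSheaf _) (structureMod_isSheaf f) _
    (isBasis_basicOpens (X := X)) ?_
  rintro _ ⟨s, hs, rfl⟩
  exact isDefMod_fracAug hB hQ hφ hs

end Existence

/-! ### Associative deformations: global sections and existence -/

section Gauge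

variable {K : Type u} [Field K] {X : Scheme.{u}} {f : X ⟶ Spec (CommRingCat.of K)}
  {R : Type u} [CommRing R] [Algebra K R] [IsParameterAlgebra K R] [IsIntegral X] [IsAffine X]

theorem isAssDef_gamma {A : AugAssSheaf R (structureSheaf f)}
    (hA : isAssDefSheaf R (structureSheaf f) A) :
    isAssDef R (globalSections (structureSheaf f)) ((gammaAss R (structureSheaf f)).obj A) :=
  (isAssDef_iff _).2 (isDefMod_augHom_top hA)

/-- Every deformation of the algebra of global regular functions extends to a deformation of the
structure sheaf. -/
theorem exists_assDefSheaf (A : AugAss R (globalSections (structureSheaf f)))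
    (hA : isAssDef R (globalSections (structureSheaf f)) A) :
    ∃ S : AugAssSheaf R (structureSheaf f), isAssDefSheaf R (structureSheaf f) S ∧
      Nonempty (A ⟶ (gammaAss R (structureSheaf f)).obj S) := by
  have := IsParameterAlgebra.isNoetherianRing K (R := R)
  have := paramIdeal_isMaximal K R
  let π : A.alg →ₐ[R] regular f R ⊤ := A.aug.hom
  have hB : IsDefMod (paramIdeal K R) π.toLinearMap := (isAssDef_iff A).1 hA
  obtain ⟨Q, πQ, φ, hφ, hQ⟩ := exists_rational_localization hB
  have hS := isAssDefSheaf_fracSheaf hB hQ hφ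
  refine ⟨fracSheaf π hB.isCommMod πQ φ, hS, ?_⟩
  let g : A.alg →ₐ[R] fracSections π hB.isCommMod πQ φ ⊤ :=
    ((AlgHom.pi fun _ : (⊤ : X.Opens) => φ).prod π).codRestrict _ fun a =>
      mem_fracSections.2 ⟨fun _ _ => rfl, fun _ => map_mem_fracClosure a, fun _ => hφ a⟩
  -- Both sides are deformations of the algebra of global functions and `g` respects augmentations,
  -- so bijectivity is automatic.
  have hg : Function.Bijective g :=
    hB.bijective_of_comp (isDefMod_augHom_top hS) g.toLinearMap fun _ => rfl
  exact ⟨⟨(AlgEquiv.ofBijective g hg).toAlgebraIso, rfl⟩⟩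

end Gauge

end Deformation
end

noncomputable section
namespace Deformation

/-- Transport of a Poisson bracket along an isomorphism of algebras. -/
def PoissonBracket.congr {R A B : Type u} [CommRing R] [CommRing A] [Algebra R A] [CommRing B]
    [Algebra R B] (P : PoissonBracket R A) (e : A ≃ₐ[R] B) : PoissonBracket R B where
  br := LinearMap.mk₂ R (fun x y => e (P.br (e.symm x) (e.symm y))) (by simp) (by simp) (by simp)
    (by simp)
  antisymm a b := by
    simp only [LinearMap.mk₂_apply]
    rw [P.antisymm, map_neg]
  jacobi a b c := by simp only [LinearMap.mk₂_apply, e.symm_apply_apply, ← map_add, P.jacobi, map_zero]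
  leibniz_right a b c := by simp [P.leibniz_right]
  leibniz_left a b c := by simp [P.leibniz_left]

/-! ### Extending Poisson brackets to sheaves -/

section Sheaf

variable {K : Type u} [Field K] {X : Scheme.{u}} {f : X ⟶ Spec (CommRingCat.of K)}
  {R : Type u} [CommRing R] [Algebra K R] [IsParameterAlgebra K R]

/-- The presheaf of commutative algebras defined by a presheaf of algebras with commutative
sections. -/
def commPresheaf (F : TopCat.Presheaf (AlgCat.{u} R) X.toPresheafedSpace.carrier)
    (h : ∀ (U : (Opens X)ᵒᵖ) (a b : F.obj U), a * b = b * a) :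
    TopCat.Presheaf (CommAlgCat.{u} R) X.toPresheafedSpace.carrier where
  obj U :=
    letI : CommRing (F.obj U) := { (inferInstance : Ring (F.obj U)) with mul_comm := h U }
    CommAlgCat.of R (F.obj U)
  map {U V} i :=
    letI : CommRing (F.obj U) := { (inferInstance : Ring (F.obj U)) with mul_comm := h U }
    letI : CommRing (F.obj V) := { (inferInstance : Ring (F.obj V)) with mul_comm := h V }
    CommAlgCat.ofHom (F.map i).hom
  map_id U := CommAlgCat.hom_ext (AlgHom.ext fun a => congrArg (fun g => g.hom a) (F.map_id U))
  map_comp i j := CommAlgCat.hom_ext (AlgHom.ext fun a =>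
    congrArg (fun g => g.hom a) (F.map_comp i j))

/-- The restriction homomorphisms of a presheaf of commutative algebras. -/
def commRes (F : TopCat.Presheaf (CommAlgCat.{u} R) X.toPresheafedSpace.carrier) {U V : X.Opens}
    (h : V ≤ U) : F.obj (op U) →ₐ[R] F.obj (op V) :=
  (F.map (homOfLE h).op).hom

variable {F : TopCat.Presheaf (CommAlgCat.{u} R) X.toPresheafedSpace.carrier}

theorem commRes_commRes {U V W : X.Opens} (h : V ≤ U) (h' : W ≤ V) (a : F.obj (op U)) :
    commRes F h' (commRes F h a) = commRes F (h'.trans h) a :=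
  res_res (F := F ⋙ commToMod R) h h' a

variable [IsAffine X] [IsIntegral X]

theorem mul_comm_section {A : AugAssSheaf R (structureSheaf f)}
    (hA : isAssDefSheaf R (structureSheaf f) A)
    (h : ∀ a b : A.pre.obj (op ⊤), a * b = b * a) (U : (Opens X)ᵒᵖ) (a b : A.pre.obj U) :
    a * b = b * a := by
  refine section_ext_of_basis (isBasis_basicOpens (X := X)) A.mod_isSheaf ?_
  rintro _ ⟨s, hs, rfl⟩ hsU
  change A.res hsU (a * b) = A.res hsU (b * a)
  rw [map_mul, map_mul]
  exact (isDefLoc_res hA hs).mul_comm h _ _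

variable (isSheaf : TopCat.Presheaf.IsSheaf (F ⋙ forget (CommAlgCat.{u} R)))
  (aug : F ⟶ (structureSheaf f).pre ⋙ restrictAlg (augmentation K R))

/-- A Poisson bracket on the global sections of a deformation extends to all sections. -/

theorem exists_sheaf_bracket
    (hF : isAssDefSheaf R (structureSheaf f)
      ⟨F ⋙ commToAss R, isSheaf, Functor.whiskerRight aug (commToAss R)⟩)
    (P : PoissonBracket R (F.obj (op ⊤))) (hP : ∀ a b, (aug.app (op ⊤)).hom (P.br a b) = 0) :
    ∃ br : ∀ U : X.Opens, PoissonBracket R (F.obj (op U)),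
      (∀ a b, (br ⊤).br a b = P.br a b) ∧
      (∀ {U V : X.Opens} (h : V ≤ U) (a b : F.obj (op U)),
        commRes F h ((br U).br a b) = (br V).br (commRes F h a) (commRes F h b)) ∧
      ∀ (U : X.Opens) (a b : F.obj (op U)), (aug.app (op U)).hom ((br U).br a b) = 0 := by
  have := IsParameterAlgebra.isNoetherianRing K (R := R)
  have := paramIdeal_isMaximal K R
  let T : AugAssSheaf R (structureSheaf f) :=
    ⟨F ⋙ commToAss R, isSheaf, Functor.whiskerRight aug (commToAss R)⟩
  have hT : isAssDefSheaf R (structureSheaf f) T := hF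
  have hS : TopCat.Presheaf.IsSheaf (F ⋙ commToMod R) := T.mod_isSheaf
  have loc : ∀ {s : Γ(X, ⊤)}, s ≠ 0 → IsDefLoc (paramIdeal K R) (aug.app (op ⊤)).hom
      (aug.app (op (X.basicOpen s))).hom (commRes F (le_top : X.basicOpen s ≤ ⊤))
      (nonvanishing f (aug.app (op ⊤)).hom (X.basicOpen s)) := fun hs => isDefLoc_res hT hs
  have haus : ∀ s : Γ(X, ⊤), IsHausdorff (paramIdeal K R) (F.obj (op (X.basicOpen s))) :=
    fun s => isHausdorff_section hT s
  have nat : ∀ {U V : X.Opens} (h : V ≤ U) (a : F.obj (op U)),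
      (aug.app (op V)).hom (commRes F h a) = rres f R h ((aug.app (op U)).hom a) :=
    fun h a => congrArg (fun g => g.hom a) (aug.naturality (homOfLE h).op)
  have ext : ∀ {U : X.Opens} {a b : F.obj (op U)},
      (∀ B ∈ basicOpens X, ∀ hB : B ≤ U, commRes F hB a = commRes F hB b) → a = b :=
    fun h => section_ext_of_basis (isBasis_basicOpens (X := X)) hS h
  have hex : ∀ B : X.Opens, B ∈ basicOpens X → ∃ PB : PoissonBracket R (F.obj (op B)),
      ∀ a a', PB.br (commRes F le_top a) (commRes F le_top a') = commRes F le_top (P.br a a') := by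
    rintro _ ⟨s, hs, rfl⟩
    exact (loc hs).exists_poissonBracket P
  choose PB hPB using hex
  have compat : ∀ B hB B' hB' (h : B' ≤ B) (a b : F.obj (op B)),
      commRes F h ((PB B hB).br a b) = (PB B' hB').br (commRes F h a) (commRes F h b) := by
    intro B hB B' hB' h a b
    obtain ⟨s, hs, rfl⟩ := id hB
    obtain ⟨s', -, rfl⟩ := id hB'
    have := haus s'
    refine (PB _ _).map_br_of_isDefLoc (loc hs) (PB _ _) (commRes F h) (fun a a' => ?_) a b
    rw [hPB, commRes_commRes, commRes_commRes, commRes_commRes, hPB]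
  -- The augmentation is compared with the zero bracket on functions, so the result on preservation
  -- of brackets applies.
  have augPB : ∀ B hB (a b : F.obj (op B)), (aug.app (op B)).hom ((PB B hB).br a b) = 0 := by
    intro B hB a b
    obtain ⟨s, hs, rfl⟩ := id hB
    have : IsHausdorff (paramIdeal K R) (regular f R (X.basicOpen s)) := (loc hs).right.isHausdorff
    refine (PB _ _).map_br_of_isDefLoc (loc hs) (PoissonBracket.zero R (regular f R _))
      (aug.app (op (X.basicOpen s))).hom (fun a a' => ?_) a b
    rw [hPB, nat, hP, map_zero]
    rfl
  have hglue : ∀ (U : X.Opens) (a b : F.obj (op U)), ∃ c : F.obj (op U), ∀ B hB (h : B ≤ U),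
      commRes F h c = (PB B hB).br (commRes F h a) (commRes F h b) := fun U a b =>
    exists_glue_of_basis (F := F ⋙ commToMod R) (isBasis_basicOpens (X := X)) hS
      (fun B hB h => (PB B hB).br (commRes F h a) (commRes F h b))
      (fun B hB hBU B' hB' h => (compat B hB B' hB' h _ _).trans (by
        rw [commRes_commRes, commRes_commRes]))
  choose br hbr using hglue
  refine ⟨fun U =>
    { br := LinearMap.mk₂ R (br U) ?_ ?_ ?_ ?_
      antisymm := ?_
      jacobi := ?_
      leibniz_right := ?_
      leibniz_left := ?_ }, ?_, ?_, ?_⟩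
  · exact fun a a' b => ext fun B hB h => by simp [hbr _ _ _ B hB]
  · exact fun r a b => ext fun B hB h => by simp [hbr _ _ _ B hB]
  · exact fun a b b' => ext fun B hB h => by simp [hbr _ _ _ B hB]
  · exact fun r a b => ext fun B hB h => by simp [hbr _ _ _ B hB]
  · exact fun a b => ext fun B hB h => by
      simp only [LinearMap.mk₂_apply, map_neg, hbr _ _ _ B hB]
      exact (PB B hB).antisymm _ _
  · exact fun a b c => ext fun B hB h => by
      simp only [LinearMap.mk₂_apply, map_add, map_zero, hbr _ _ _ B hB]
      exact (PB B hB).jacobi _ _ _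
  · exact fun a b c => ext fun B hB h => by
      simp only [LinearMap.mk₂_apply, map_add, map_mul, hbr _ _ _ B hB]
      exact (PB B hB).leibniz_right _ _ _
  · exact fun a b c => ext fun B hB h => by
      simp only [LinearMap.mk₂_apply, map_add, map_mul, hbr _ _ _ B hB]
      exact (PB B hB).leibniz_left _ _ _
  · exact fun a b => ext fun B hB h => by
      simp only [LinearMap.mk₂_apply, hbr _ _ _ B hB]
      exact hPB B hB a b
  · exact fun h a b => ext fun B hB hBV => by
      simp only [LinearMap.mk₂_apply, commRes_commRes, hbr _ _ _ B hB]
  · intro U a b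
    rw [LinearMap.mk₂_apply]
    have h1 : ∀ B ∈ basicOpens X, ∀ h : B ≤ U,
        rres f R h ((aug.app (op U)).hom (br U a b)) = rres f R h 0 := fun B hB h => by
      rw [← nat h, hbr _ _ _ B hB, augPB B hB, map_zero]
    exact section_ext_of_basis (F := structureMod f R) (isBasis_basicOpens (X := X))
      (structureMod_isSheaf f) h1

end Sheaf

/-! ### Poisson deformations: global sections and existence -/

section Gauge

variable {K : Type u} [Field K] {X : Scheme.{u}} {f : X ⟶ Spec (CommRingCat.of K)}
  {R : Type u} [CommRing R] [Algebra K R] [IsParameterAlgebra K R] [IsIntegral X] [IsAffine X]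

theorem isPoisDef_gamma {A : AugPoisSheaf R (structureSheaf f)}
    (hA : isPoisDefSheaf R (structureSheaf f) A) :
    isPoisDef R (globalSections (structureSheaf f)) ((gammaPois R (structureSheaf f)).obj A) :=
  isAssDef_gamma (A := A.toAss) hA

/-- Every Poisson deformation of the algebra of global regular functions extends to a Poisson
deformation of the structure sheaf. -/
theorem exists_poisDefSheaf (A : AugPois R (globalSections (structureSheaf f)))
    (hA : isPoisDef R (globalSections (structureSheaf f)) A) :
    ∃ S : AugPoisSheaf R (structureSheaf f), isPoisDefSheaf R (structureSheaf f) S ∧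
      Nonempty (A ⟶ (gammaPois R (structureSheaf f)).obj S) := by
  obtain ⟨S, hS, ⟨g⟩⟩ := exists_assDefSheaf A.toAss hA
  have hinv : ∀ a : S.pre.obj (op ⊤), g.iso.hom.hom (g.iso.inv.hom a) = a := fun a =>
    congrArg (fun k => k.hom a) g.iso.inv_hom_id
  have hinv' : ∀ a : A.alg, g.iso.inv.hom (g.iso.hom.hom a) = a := fun a =>
    congrArg (fun k => k.hom a) g.iso.hom_inv_id
  have hg : ∀ a : A.alg, S.augHom ⊤ (g.iso.hom.hom a) = A.aug.hom a := fun a =>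
    congrArg (fun k => k.hom a) g.comm
  -- The associative construction yields algebras that are not known to be commutative;
  -- commutativity is carried from `A` to the global sections and from there to all open sets.
  have hcomm := mul_comm_section hS fun a b => by
    have h1 := congrArg g.iso.hom.hom
      (mul_comm (G := A.alg) (g.iso.inv.hom a) (g.iso.inv.hom b))
    have h2 := ((map_mul g.iso.hom.hom _ _).symm.trans h1).trans (map_mul g.iso.hom.hom _ _)
    rwa [hinv, hinv] at h2
  let F := commPresheaf S.pre hcomm
  let aug : F ⟶ (structureSheaf f).pre ⋙ restrictAlg (augmentation K R) := commNatTrans S.aug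
  let e : A.alg ≃ₐ[R] F.obj (op ⊤) := AlgEquiv.ofAlgHom (A₂ := F.obj (op ⊤)) g.iso.hom.hom
    g.iso.inv.hom (AlgHom.ext hinv) (AlgHom.ext hinv')
  obtain ⟨br, h1, h2, h3⟩ := exists_sheaf_bracket (F := F) S.isSheaf aug hS (A.bracket.congr e)
    fun a b => (hg _).trans (A.aug_bracket _ _)
  refine ⟨⟨F, S.isSheaf, fun U => br U.unop, fun i => h2 i.unop.le, aug, fun U => h3 U.unop⟩, hS,
    ⟨⟨CommAlgCat.isoMk e, CommAlgCat.hom_ext (AlgHom.ext hg), fun a b => ?_⟩⟩⟩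
  refine Eq.trans ?_ (h1 (e a) (e b)).symm
  change e _ = e (A.bracket.br (e.symm (e a)) (e.symm (e b)))
  rw [e.symm_apply_apply, e.symm_apply_apply]

end Gauge

end Deformation
end

noncomputable section
namespace Deformation

/-! ### Invertibility of gauge transformations -/

section Groupoid

variable {K R : Type u} [Field K] [CommRing R] [Algebra K R] [IsParameterAlgebra K R]
  {C : CommAlgCat.{u} K}

/-- Gauge transformations of associative deformations are invertible. -/

theorem AssDef.isIso {A A' : AssDef R C} (g : A ⟶ A') : IsIso g :=
  ⟨ObjectProperty.homMk ⟨g.hom.iso.symm, (Iso.inv_comp_eq _).2 g.hom.comm.symm⟩,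
    ObjectProperty.hom_ext _ (AugAss.Hom.ext g.hom.iso.self_symm_id),
    ObjectProperty.hom_ext _ (AugAss.Hom.ext g.hom.iso.symm_self_id)⟩

/-- Gauge transformations of Poisson deformations are invertible. -/

theorem PoisDef.isIso {A A' : PoisDef R C} (g : A ⟶ A') : IsIso g := by
  have h1 : ∀ a : A'.obj.alg, g.hom.iso.hom.hom (g.hom.iso.inv.hom a) = a := fun a =>
    congrArg (fun k => k.hom a) g.hom.iso.inv_hom_id
  have h2 : ∀ a : A.obj.alg, g.hom.iso.inv.hom (g.hom.iso.hom.hom a) = a := fun a =>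
    congrArg (fun k => k.hom a) g.hom.iso.hom_inv_id
  exact ⟨ObjectProperty.homMk ⟨g.hom.iso.symm, (Iso.inv_comp_eq _).2 g.hom.comm.symm,
      fun a b => by
        have := g.hom.map_bracket (g.hom.iso.inv.hom a) (g.hom.iso.inv.hom b)
        rw [h1, h1] at this
        exact (congrArg g.hom.iso.inv.hom this).symm.trans (h2 _)⟩,
    ObjectProperty.hom_ext _ (AugPois.Hom.ext g.hom.iso.self_symm_id),
    ObjectProperty.hom_ext _ (AugPois.Hom.ext g.hom.iso.symm_self_id)⟩

end Groupoid

end Deformation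
end

theorem mainTheorem8 (K R : Type u) [Field K] [CommRing R] [Algebra K R]
    [IsParameterAlgebra K R] (X : Scheme.{u}) (f : X ⟶ Spec (CommRingCat.of K))
    (hX : IsAlgebraicVariety f) (hXaff : IsAffine X) :
    -- associative deformations
    (∃ hΓ : ∀ A : AssDefSheaf R (structureSheaf f),
        isAssDef R (globalSections (structureSheaf f))
          ((gammaAss R (structureSheaf f)).obj A.obj),
      (∀ A : AssDef R (globalSections (structureSheaf f)),
        ∃ 𝒜 : AssDefSheaf R (structureSheaf f),
          Nonempty (A ⟶ (gammaAssDef R (structureSheaf f) hΓ).obj 𝒜)) ∧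
      (∀ (𝒜 𝒜' : AssDefSheaf R (structureSheaf f))
        (h : (gammaAssDef R (structureSheaf f) hΓ).obj 𝒜 ⟶
          (gammaAssDef R (structureSheaf f) hΓ).obj 𝒜'),
        ∃! h' : 𝒜 ⟶ 𝒜', (gammaAssDef R (structureSheaf f) hΓ).map h' = h) ∧
      (gammaAssDef R (structureSheaf f) hΓ).IsEquivalence) ∧
    -- Poisson deformations
    (∃ hΓ : ∀ A : PoisDefSheaf R (structureSheaf f),
        isPoisDef R (globalSections (structureSheaf f))
          ((gammaPois R (structureSheaf f)).obj A.obj),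
      (∀ A : PoisDef R (globalSections (structureSheaf f)),
        ∃ 𝒜 : PoisDefSheaf R (structureSheaf f),
          Nonempty (A ⟶ (gammaPoisDef R (structureSheaf f) hΓ).obj 𝒜)) ∧
      (∀ (𝒜 𝒜' : PoisDefSheaf R (structureSheaf f))
        (h : (gammaPoisDef R (structureSheaf f) hΓ).obj 𝒜 ⟶
          (gammaPoisDef R (structureSheaf f) hΓ).obj 𝒜'),
        ∃! h' : 𝒜 ⟶ 𝒜', (gammaPoisDef R (structureSheaf f) hΓ).map h' = h) ∧
      (gammaPoisDef R (structureSheaf f) hΓ).IsEquivalence) := by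
  have := hX.isIntegral
  constructor
  · have hex : ∀ A : AssDef R (globalSections (structureSheaf f)),
        ∃ S : AssDefSheaf R (structureSheaf f), Nonempty
          (A ⟶ (gammaAssDef R (structureSheaf f) fun A => isAssDef_gamma A.property).obj S) := by
      intro A
      obtain ⟨S, hS, ⟨g⟩⟩ := exists_assDefSheaf A.obj A.property
      exact ⟨⟨S, hS⟩, ⟨ObjectProperty.homMk g⟩⟩
    have huniq : ∀ (S S' : AssDefSheaf R (structureSheaf f))
        (h : (gammaAssDef R (structureSheaf f) fun A => isAssDef_gamma A.property).obj S ⟶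
          (gammaAssDef R (structureSheaf f) fun A => isAssDef_gamma A.property).obj S'),
        ∃! h' : S ⟶ S', (gammaAssDef R (structureSheaf f) _).map h' = h := by
      intro S S' h
      obtain ⟨g, hg, hu⟩ := existsUnique_gauge S.property S'.property h.hom
      exact ⟨ObjectProperty.homMk g, ObjectProperty.hom_ext _ hg, fun k hk =>
        ObjectProperty.hom_ext _ (hu k.hom (congrArg (fun z => z.hom) hk))⟩
    -- Unique extension of gauge transformations gives full faithfulness; essential surjectivity is
    -- existence, since every gauge transformation is invertible.
    exact ⟨fun A => isAssDef_gamma A.property, hex, huniq,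
      { faithful := ⟨fun {S S'} a b hab => (huniq S S' _).unique hab rfl⟩
        full := ⟨fun {S S'} h => (huniq S S' h).exists⟩
        essSurj := ⟨fun A => by
          obtain ⟨S, ⟨g⟩⟩ := hex A
          have : IsIso g := AssDef.isIso g
          exact ⟨S, ⟨(asIso g).symm⟩⟩⟩ }⟩
  · have hex : ∀ A : PoisDef R (globalSections (structureSheaf f)),
        ∃ S : PoisDefSheaf R (structureSheaf f), Nonempty
          (A ⟶ (gammaPoisDef R (structureSheaf f) fun A => isPoisDef_gamma A.property).obj S) := by
      intro A
      obtain ⟨S, hS, ⟨g⟩⟩ := exists_poisDefSheaf A.obj A.property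
      exact ⟨⟨S, hS⟩, ⟨ObjectProperty.homMk g⟩⟩
    have huniq : ∀ (S S' : PoisDefSheaf R (structureSheaf f))
        (h : (gammaPoisDef R (structureSheaf f) fun A => isPoisDef_gamma A.property).obj S ⟶
          (gammaPoisDef R (structureSheaf f) fun A => isPoisDef_gamma A.property).obj S'),
        ∃! h' : S ⟶ S', (gammaPoisDef R (structureSheaf f) _).map h' = h := by
      intro S S' h
      obtain ⟨g, hg, hu⟩ := existsUnique_gauge_pois S.property S'.property h.hom
      exact ⟨ObjectProperty.homMk g, ObjectProperty.hom_ext _ hg, fun k hk =>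
        ObjectProperty.hom_ext _ (hu k.hom (congrArg (fun z => z.hom) hk))⟩
    exact ⟨fun A => isPoisDef_gamma A.property, hex, huniq,
      { faithful := ⟨fun {S S'} a b hab => (huniq S S' _).unique hab rfl⟩
        full := ⟨fun {S S'} h => (huniq S S' h).exists⟩
        essSurj := ⟨fun A => by
          obtain ⟨S, ⟨g⟩⟩ := hex A
          have : IsIso g := PoisDef.isIso g
          exact ⟨S, ⟨(asIso g).symm⟩⟩⟩ }⟩
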